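/- Let $\Omega\subseteq\mathbb R^n$ be Lebesgue measurable, let $|\cdot|$ denote Lebesgue measure, $B(x,r)$ the open ball, $B_1=B(0,1)$, let $0<\alpha<n$, and let $I_\alpha f(x)=\int_{\mathbb R^n}|x-y|^{\alpha-n}f(y)\,dy$. Functions in $L^{n/\alpha}(\Omega)$ are real valued and extended by $0$ outside $\Omega$. For an integer $m\ge 0$ put $\exp_m(t)=e^t-\sum_{k=0}^m t^k/k!$, and write $\lceil\lambda\rceil$ for the smallest integer $\ge\lambda$. Consider the condition $$\operatorname*{ess\,sup}_{x\in\Omega}\int_1^\infty\frac{|\Omega\cap B(x,r)|}{r^{n+1}}\,dr<\infty.\tag{G}$$ (a) Suppose that (G) holds. Then for every $f\in L^{n/\alpha}(\Omega)$ the integral defining $I_\alpha f(x)$ converges absolutely for a.e. $x\in\Omega$, and there is a constant $C>0$ (depending only on $\Omega$ and $\alpha$) such that for all $f\in L^{n/\alpha}(\Omega)$ with $\|f\|_{n/\alpha}\le1$ and all measurable $E\subseteq\Omega$ with $|E|<\infty$ $$\int_E\exp\Big[\frac1{|B_1|}|I_\alpha f(x)|^{\frac n{n-\alpha}}\Big]dx\le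 C(1+|E|),\tag{1}$$ and for all such $f$ $$\int_\Omega\exp_{\lceil n/\alpha-2\rceil}\Big[\frac1{|B_1|}|I_\alpha f(x)|^{\frac n{n-\alpha}}\Big]dx\le C\big(1+\|I_\alpha f\|_{L^{n/\alpha}(\Omega)}^{n/\alpha}\big).\tag{2}$$ If moreover $|\Omega\cap B(x_0,r_0)|=|B(x_0,r_0)|$ for some $x_0\in\Omega$ and $r_0>0$, then the exponential constant $1/|B_1|$ is sharp: for every $\gamma>1/|B_1|$, inequality (1) with $\gamma$ in place of $1/|B_1|$ fails for every measurable $E\subseteq\Omega$ with $0<|E|<\infty$ (for no $C$ does it hold on $E$ for all $f$ in the unit ball of $L^{n/\alpha}(\Omega)$), and (2) with $\gamma$ in place of $1/|B_1|$ holds for no $C$. (b) Conversely, suppose that (G) fails. Then there is no $C$ for which (1) holds for all $f\in L^{n/\alpha}(\Omega)$ with $\|f\|_{n/\alpha}\le1$ and all measurable $E\subseteq\Omega$ with $|E|<\infty$. In fact, there are functions $\Psi_m\in L^{n/\alpha}(\Omega)$ with $\|\Psi_m\|_{n/\alpha}=1$, points $x_m\in\Omega$, radii $r_m>0$ and a number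 $\delta>0$ such that the sets $B_m=B(x_m,r_m)\cap\Omega$ satisfy $|B_m|=\delta$ for all $m$ and $$\inf_{x\in B_m}|I_\alpha\Psi_m(x)|\to+\infty\qquad(m\to\infty).$$ -/

import Mathlib

open MeasureTheory Set Filter Topology
open scoped ENNReal

/-- The Riesz potential `I_α f = |·|^{α-n} * f` on `ℝⁿ`. -/
noncomputable def rieszPotential {n : ℕ} (α : ℝ) (f : EuclideanSpace ℝ (Fin n) → ℝ)
    (x : EuclideanSpace ℝ (Fin n)) : ℝ :=
  ∫ y, ‖x - y‖ ^ (α - (n : ℝ)) * f y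

/-- The volume `|B₁|` of the unit ball of `ℝⁿ`. -/
noncomputable def unitBallVolume (n : ℕ) : ℝ :=
  (volume : Measure (EuclideanSpace ℝ (Fin n))).real (Metric.ball 0 1)

/-- The growth function `Λ_Ω(x,r) = |Ω ∩ B(x,r)|`. -/
noncomputable def growth {n : ℕ} (Ω : Set (EuclideanSpace ℝ (Fin n)))
    (x : EuclideanSpace ℝ (Fin n)) (r : ℝ) : ℝ≥0∞ :=
  volume (Ω ∩ Metric.ball x r)

/-- The integral `∫₁^∞ Λ_Ω(x,r) r^{-n-1} dr`, with values in `[0,∞]`. -/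
noncomputable def growthIntegral {n : ℕ} (Ω : Set (EuclideanSpace ℝ (Fin n)))
    (x : EuclideanSpace ℝ (Fin n)) : ℝ≥0∞ :=
  ∫⁻ r in Ioi (1 : ℝ), growth Ω x r / ENNReal.ofReal (r ^ (n + 1))

/-- Riesz subcriticality: the (essential) supremum over `x ∈ Ω` of `∫₁^∞ Λ_Ω(x,r) r^{-n-1} dr`
is finite. -/
def IsRieszSubcritical {n : ℕ} (Ω : Set (EuclideanSpace ℝ (Fin n))) : Prop :=
  essSup (growthIntegral Ω) (volume.restrict Ω) < ∞

/-- `f ∈ L^p(Ω)`, seen as a function in `L^p(ℝⁿ)` that is zero almost everywhere outside `Ω`. -/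
def MemLpOn {n : ℕ} (Ω : Set (EuclideanSpace ℝ (Fin n))) (p : ℝ)
    (f : EuclideanSpace ℝ (Fin n) → ℝ) : Prop :=
  MemLp f (ENNReal.ofReal p) volume ∧ ∀ᵐ x, x ∉ Ω → f x = 0

/-- The regularized exponential `exp_m(t) = e^t - ∑_{k=0}^m t^k / k!`. -/
noncomputable def regExp (m : ℕ) (t : ℝ) : ℝ :=
  Real.exp t - ∑ k ∈ Finset.range (m + 1), t ^ k / (k.factorial : ℝ)

/-- The Adams inequality on `E` with exponential constant `γ` and constant `C`:
`∫_E exp(γ |I_α f|^{n/(n-α)}) ≤ C (1 + |E|)` for all `f` in the unit ball of `L^{n/α}(Ω)`. -/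
def AdamsBound {n : ℕ} (Ω : Set (EuclideanSpace ℝ (Fin n))) (α γ : ℝ)
    (E : Set (EuclideanSpace ℝ (Fin n))) (C : ℝ) : Prop :=
  ∀ f : EuclideanSpace ℝ (Fin n) → ℝ, MemLpOn Ω (n / α) f →
    eLpNorm f (ENNReal.ofReal (n / α)) volume ≤ 1 →
    ∫⁻ x in E, ENNReal.ofReal
        (Real.exp (γ * |rieszPotential α f x| ^ ((n : ℝ) / (n - α))))
      ≤ ENNReal.ofReal C * (1 + volume E)

/-- The regularized Adams inequality on `Ω` with exponential constant `γ` and constant `C`: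
`∫_Ω exp_m(γ |I_α f|^{n/(n-α)}) ≤ C (1 + ‖I_α f‖^{n/α})`, with the norm of `L^{n/α}(Ω)` and with
`m` the smallest integer `≥ n/α - 2`, for all `f` in the unit ball of `L^{n/α}(Ω)`.
For `0 < α < n` one has `n/α - 2 > -1`, so that `m` is a natural number. -/
def RegAdamsBound {n : ℕ} (Ω : Set (EuclideanSpace ℝ (Fin n))) (α γ : ℝ) (C : ℝ) : Prop :=
  ∀ f : EuclideanSpace ℝ (Fin n) → ℝ, MemLpOn Ω (n / α) f →
    eLpNorm f (ENNReal.ofReal (n / α)) volume ≤ 1 →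
    ∫⁻ x in Ω, ENNReal.ofReal
        (regExp ⌈(n : ℝ) / α - 2⌉₊ (γ * |rieszPotential α f x| ^ ((n : ℝ) / (n - α))))
      ≤ ENNReal.ofReal C *
        (1 + eLpNorm (rieszPotential α f) (ENNReal.ofReal (n / α)) (volume.restrict Ω)
          ^ ((n : ℝ) / α))

/-! ### Volumes of balls -/

/-! Write κ = |B₁|, p = n/α and q = n/(n-α), which are conjugate exponents. The q-th power of the
Riesz kernel is |x-y|^{-n}, and the layer cake formula turns n times the growth integral into ∫_Ω
max(1,|x-y|)^{-n} dy (`growthIntegral_eq`). So (G) says exactly that the kernel cut off at scale 1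
has bounded L^q(Ω) norm. Between the scales r and 1 the same integral is at most nκ log(1/r), and
this is where the constant 1/κ comes from.

Upper bound. Let D be a superlevel set of |f| of volume |B_σ| and let A be a set of volume at least
|B_ρ|, with ρ ≤ σ ≤ 1. At some point of A the potential is controlled by the L^p norms of f on D and
off D, weighted by q-th roots of κ·log((σ/ρ)^n) and κ·log(1/σ^n) plus constants
(`exists_lRiesz_le`). The singular part is handled by averaging over A with Young's inequality, the
rest by Hölder. Taking volumes κe^{-i} for D and κe^{-j} for A gives a two-index inequality for the
levels l_j above which the potential lives on volume at most κe^{-j} (`exists_levels`). A discrete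
Adams–Garsia argument (`GarsiaBound.exists_tsum_le`) deduces that ∑ exp(l_j^q/κ - j) is bounded, and
summing over level sets yields (1). For (2), (1) is used on {|I_α f| ≥ 1}, whose volume is finite by
Chebyshev, and the truncated exponential is bounded by a multiple of |I_α f|^p elsewhere
(`exists_regAdamsBound`).

Lower bounds. The test functions are |x-y|^{-α} on a shell around x. Their p-th power is |x-y|^{-n},
and near x their potential is comparable to A = ∫|x-y|^{-n} over the shell. After normalization the
potential is therefore of size A^{1/q}. If (G) fails, large shells make A arbitrarily large while
the hole keeps volume 1 in Ω (`exists_large_potential`). If γ > 1/κ, a shell shrinking to a density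
point of E has A close to κ log(1/εⁿ), and exp(γ|I_α f|^q) then outweighs the volume εⁿ of the hole
(`not_adamsBound_of_lt`).

Sharpness in (2) also needs ‖I_α f‖_p bounded, whereas the potential of a positive test function
decays only like |z|^{α-n}, which need not be in L^p at infinity. A combination of dyadic dilates of
the shell, with weights killing enough moments, decays like |z|^{α-2n} and still has weight 1 on
most of the shell (`exists_annihilating_weights`, `exists_decay`). -/

lemma unitBallVolume_pos (n : ℕ) : 0 < unitBallVolume n := by
  unfold unitBallVolume
  rw [measureReal_def, ENNReal.toReal_pos_iff]
  exact ⟨Metric.measure_ball_pos _ _ one_pos, measure_ball_lt_top⟩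

lemma volume_ball_eq {n : ℕ} (hn : 0 < n) (x : EuclideanSpace ℝ (Fin n)) {r : ℝ} (hr : 0 ≤ r) :
    volume (Metric.ball x r) = ENNReal.ofReal (unitBallVolume n * r ^ (n : ℝ)) := by
  have : Nonempty (Fin n) := ⟨⟨0, hn⟩⟩
  rw [Measure.addHaar_ball volume x hr, finrank_euclideanSpace, Fintype.card_fin,
    mul_comm (unitBallVolume n), ENNReal.ofReal_mul (Real.rpow_nonneg hr _), Real.rpow_natCast]
  congr 1
  unfold unitBallVolume
  rw [measureReal_def, ENNReal.ofReal_toReal measure_ball_lt_top.ne]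

/-! ### The layer cake formula for powers of the distance -/

lemma lintegral_Ioi_rpow_eq {β s : ℝ} (hβ : 0 < β) (hs : 0 < s) :
    ∫⁻ r in Ioi s, ENNReal.ofReal (β * r ^ (-β - 1)) = ENNReal.ofReal (s ^ (-β)) := by
  rw [← ofReal_integral_eq_lintegral_ofReal]
  · rw [integral_const_mul, integral_Ioi_rpow_of_lt (by linarith) hs]
    congr 1
    rw [show -β - 1 + 1 = -β by ring]
    field_simp
  · exact (integrableOn_Ioi_rpow_of_lt (by linarith) hs).const_mul β
  · filter_upwards [ae_restrict_mem measurableSet_Ioi] with r hr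
    have : 0 < r := hs.trans hr
    positivity

lemma lintegral_Ioi_rpow_eq_max {β a s : ℝ} (hβ : 0 < β) (h : 0 < max a s) :
    ENNReal.ofReal (max a s ^ (-β)) =
      ∫⁻ r in Ioi a, ENNReal.ofReal (β * r ^ (-β - 1)) * (Ioi s).indicator 1 r := by
  have : ∀ r, ENNReal.ofReal (β * r ^ (-β - 1)) * (Ioi s).indicator (1 : ℝ → ℝ≥0∞) r
      = (Ioi s).indicator (fun r => ENNReal.ofReal (β * r ^ (-β - 1))) r := by
    intro r
    by_cases hr : r ∈ Ioi s <;> simp [hr]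
  simp_rw [this]
  rw [lintegral_indicator measurableSet_Ioi, Measure.restrict_restrict measurableSet_Ioi,
    Ioi_inter_Ioi, max_comm s a, lintegral_Ioi_rpow_eq hβ h]

/-- Allowing a = 0 costs the equality: if moreover s ≤ 0, the left side is 0^(-β) = 0 by convention
while the right side is infinite. -/
lemma lintegral_Ioi_rpow_le {β a s : ℝ} (hβ : 0 < β) (ha : 0 ≤ a) :
    ENNReal.ofReal (max a s ^ (-β)) ≤
      ∫⁻ r in Ioi a, ENNReal.ofReal (β * r ^ (-β - 1)) * (Ioi s).indicator 1 r := by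
  rcases (le_max_of_le_left ha : 0 ≤ max a s).eq_or_lt with h | h
  · rw [← h, Real.zero_rpow (by linarith)]
    simp
  · exact (lintegral_Ioi_rpow_eq_max hβ h).le

section LayerCake

variable {n : ℕ} (ν : Measure (EuclideanSpace ℝ (Fin n))) [SFinite ν]
  (x : EuclideanSpace ℝ (Fin n)) {β a : ℝ}

/-- Tonelli: for fixed r the condition ‖x - y‖ < r says that y lies in the ball of radius r around
x. -/
lemma lintegral_layer_swap :
    ∫⁻ y, (∫⁻ r in Ioi a, ENNReal.ofReal (β * r ^ (-β - 1)) * (Ioi ‖x - y‖).indicator 1 r) ∂ν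
      = ∫⁻ r in Ioi a, ENNReal.ofReal (β * r ^ (-β - 1)) * ν (Metric.ball x r) := by
  rw [lintegral_lintegral_swap]
  · refine lintegral_congr fun r => ?_
    have hm : Measurable fun y : EuclideanSpace ℝ (Fin n) =>
        (Metric.ball x r).indicator (1 : EuclideanSpace ℝ (Fin n) → ℝ≥0∞) y :=
      measurable_one.indicator Metric.isOpen_ball.measurableSet
    have : ∀ y : EuclideanSpace ℝ (Fin n), (Ioi ‖x - y‖).indicator (1 : ℝ → ℝ≥0∞) r
        = (Metric.ball x r).indicator 1 y := by
      intro y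
      simp only [indicator, mem_Ioi, Metric.mem_ball, dist_eq_norm, norm_sub_rev x y, Pi.one_apply]
    simp_rw [this]
    rw [lintegral_const_mul _ hm, lintegral_indicator_one Metric.isOpen_ball.measurableSet]
  · have hm : MeasurableSet {z : EuclideanSpace ℝ (Fin n) × ℝ | ‖x - z.1‖ < z.2} :=
      measurableSet_lt (by fun_prop) (by fun_prop)
    have : (Function.uncurry fun (y : EuclideanSpace ℝ (Fin n)) (r : ℝ) =>
        ENNReal.ofReal (β * r ^ (-β - 1)) * (Ioi ‖x - y‖).indicator (1 : ℝ → ℝ≥0∞) r)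
        = fun z => ENNReal.ofReal (β * z.2 ^ (-β - 1)) *
          {z : EuclideanSpace ℝ (Fin n) × ℝ | ‖x - z.1‖ < z.2}.indicator 1 z := by
      funext z
      simp [Function.uncurry, indicator]
    rw [this]
    refine Measurable.aemeasurable (Measurable.mul (by fun_prop) (measurable_one.indicator hm))

lemma lintegral_max_rpow_eq (hβ : 0 < β) (ha : 0 < a) :
    ∫⁻ y, ENNReal.ofReal (max a ‖x - y‖ ^ (-β)) ∂ν
      = ∫⁻ r in Ioi a, ENNReal.ofReal (β * r ^ (-β - 1)) * ν (Metric.ball x r) := by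
  rw [← lintegral_layer_swap]
  exact lintegral_congr fun y => lintegral_Ioi_rpow_eq_max hβ (lt_max_of_lt_left ha)

lemma lintegral_max_rpow_le (hβ : 0 < β) (ha : 0 ≤ a) :
    ∫⁻ y, ENNReal.ofReal (max a ‖x - y‖ ^ (-β)) ∂ν
      ≤ ∫⁻ r in Ioi a, ENNReal.ofReal (β * r ^ (-β - 1)) * ν (Metric.ball x r) := by
  rw [← lintegral_layer_swap]
  exact lintegral_mono fun y => lintegral_Ioi_rpow_le hβ ha

end LayerCake

/-! ### Integrals of |x-y|^{-β} over balls, shells and sets of given volume -/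

section Consequences

variable {n : ℕ} (x : EuclideanSpace ℝ (Fin n))

/-- The right side is the layer cake form of ∫_Ω max(1,|x-y|)^{-n} dy, so this lemma translates (G)
into a statement about the q-th power of the kernel. -/
lemma growthIntegral_eq (hn : 0 < n) (Ω : Set (EuclideanSpace ℝ (Fin n))) :
    ENNReal.ofReal n * growthIntegral Ω x
      = ∫⁻ r in Ioi (1 : ℝ), ENNReal.ofReal (n * r ^ (-(n : ℝ) - 1)) *
          (volume.restrict Ω) (Metric.ball x r) := by
  have hn' : (0 : ℝ) < n := by exact_mod_cast hn
  unfold growthIntegral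
  rw [← lintegral_const_mul' _ _ ENNReal.ofReal_ne_top]
  refine setLIntegral_congr_fun measurableSet_Ioi fun r hr => ?_
  have hr0 : (0 : ℝ) < r := one_pos.trans hr
  simp only [growth]
  rw [Measure.restrict_apply Metric.isOpen_ball.measurableSet, inter_comm,
    ENNReal.ofReal_mul hn'.le, mul_assoc, ENNReal.div_eq_inv_mul,
    ← ENNReal.ofReal_inv_of_pos (by positivity)]
  congr 3
  rw [← Real.rpow_natCast, ← Real.rpow_neg hr0.le]
  push_cast
  ring_nf

/-- For a part of Lebesgue measure, the integral of `max(a, |x - y|)^{-n}` is at most logarithmic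
up to the contribution of the large balls. -/
lemma lintegral_max_rpow_le_log (hn : 0 < n) (ν : Measure (EuclideanSpace ℝ (Fin n))) [SFinite ν]
    (hν : ν ≤ volume) {a R : ℝ} (ha : 0 < a) (haR : a ≤ R) :
    ∫⁻ y, ENNReal.ofReal (max a ‖x - y‖ ^ (-(n : ℝ))) ∂ν
      ≤ ENNReal.ofReal (n * unitBallVolume n * Real.log (R / a)) +
        ∫⁻ r in Ioi R, ENNReal.ofReal (n * r ^ (-(n : ℝ) - 1)) * ν (Metric.ball x r) := by
  have hn' : (0 : ℝ) < n := by exact_mod_cast hn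
  have hκ := unitBallVolume_pos n
  -- For radii up to R the bound ν(B_r) ≤ κrⁿ leaves nκ∫dr/r; beyond R the measure ν itself is kept.
  rw [lintegral_max_rpow_eq ν x hn' ha, ← Ioc_union_Ioi_eq_Ioi haR,
    lintegral_union measurableSet_Ioi (Ioc_disjoint_Ioi le_rfl)]
  gcongr
  calc ∫⁻ r in Ioc a R, ENNReal.ofReal (n * r ^ (-(n : ℝ) - 1)) * ν (Metric.ball x r)
      ≤ ∫⁻ r in Ioc a R, ENNReal.ofReal (n * unitBallVolume n * r⁻¹) := by
        refine setLIntegral_mono' measurableSet_Ioc fun r hr => ?_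
        have hr0 : 0 < r := ha.trans hr.1
        refine (mul_le_mul_right (hν (Metric.ball x r)) _).trans (le_of_eq ?_)
        rw [volume_ball_eq hn x hr0.le, ← ENNReal.ofReal_mul (by positivity)]
        congr 1
        have : r ^ (-(n : ℝ) - 1) * r ^ (n : ℝ) = r⁻¹ := by
          rw [← Real.rpow_add hr0, ← Real.rpow_neg_one]
          ring_nf
        linear_combination (n * unitBallVolume n : ℝ) * this
    _ = ENNReal.ofReal (n * unitBallVolume n * Real.log (R / a)) := by
        have hint : IntegrableOn (fun r : ℝ => n * unitBallVolume n * r⁻¹) (Ioc a R) := by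
          rw [← intervalIntegrable_iff_integrableOn_Ioc_of_le haR]
          refine (ContinuousOn.intervalIntegrable ?_)
          refine continuousOn_const.mul (continuousOn_inv₀.mono ?_)
          intro r hr
          rw [uIcc_of_le haR] at hr
          exact (ha.trans_le hr.1).ne'
        rw [← ofReal_integral_eq_lintegral_ofReal hint]
        · rw [integral_const_mul, ← intervalIntegral.integral_of_le haR,
            integral_inv_of_pos ha (ha.trans_le haR)]
        · filter_upwards [ae_restrict_mem measurableSet_Ioc] with r hr
          have hr0 : 0 < r := ha.trans hr.1
          positivity

/-- The integral of `max(a, |x - y|)^{-n}` over a set of volume at most `V`. -/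
lemma setLIntegral_max_rpow_le (hn : 0 < n) (D : Set (EuclideanSpace ℝ (Fin n))) {a R V : ℝ}
    (ha : 0 < a) (haR : a ≤ R) (hD : volume D ≤ ENNReal.ofReal V) :
    ∫⁻ y in D, ENNReal.ofReal (max a ‖x - y‖ ^ (-(n : ℝ)))
      ≤ ENNReal.ofReal (n * unitBallVolume n * Real.log (R / a)) +
        ENNReal.ofReal (R ^ (-(n : ℝ)) * V) := by
  have hn' : (0 : ℝ) < n := by exact_mod_cast hn
  refine (lintegral_max_rpow_le_log x hn _ Measure.restrict_le_self ha haR).trans ?_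
  gcongr
  calc ∫⁻ r in Ioi R, ENNReal.ofReal (n * r ^ (-(n : ℝ) - 1)) *
        (volume.restrict D) (Metric.ball x r)
      ≤ ∫⁻ r in Ioi R, ENNReal.ofReal (n * r ^ (-(n : ℝ) - 1)) * ENNReal.ofReal V := by
        refine lintegral_mono fun r => mul_le_mul_right ?_ _
        exact (measure_mono (subset_univ _)).trans (by simpa using hD)
    _ = ENNReal.ofReal (R ^ (-(n : ℝ)) * V) := by
        rw [lintegral_mul_const' _ _ ENNReal.ofReal_ne_top, lintegral_Ioi_rpow_eq hn'
          (ha.trans_le haR), ENNReal.ofReal_mul (Real.rpow_nonneg (ha.le.trans haR) _)]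

/-- The integral of `|x - y|^{-β}` over a ball centred at `x`. -/
lemma setLIntegral_ball_rpow_le (hn : 0 < n) {β ρ : ℝ} (hβ : 0 < β) (hβn : β < n) (hρ : 0 < ρ) :
    ∫⁻ y in Metric.ball x ρ, ENNReal.ofReal (‖x - y‖ ^ (-β))
      ≤ ENNReal.ofReal (n / (n - β) * unitBallVolume n * ρ ^ (n - β)) := by
  have hn' : (0 : ℝ) < n := by exact_mod_cast hn
  have hκ := unitBallVolume_pos n
  have h0 : 0 < n - β := by linarith
  have h1 := lintegral_max_rpow_le (volume.restrict (Metric.ball x ρ)) x hβ le_rfl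
  simp only [max_eq_right (norm_nonneg _)] at h1
  refine h1.trans ?_
  -- The restricted measure of B(x,r) is at most κrⁿ for r ≤ ρ and at most κρⁿ afterwards; the two
  -- coefficients add up as β/(n-β) + 1 = n/(n-β).
  rw [← Ioc_union_Ioi_eq_Ioi hρ.le, lintegral_union measurableSet_Ioi (Ioc_disjoint_Ioi le_rfl)]
  have hA : ∫⁻ r in Ioc 0 ρ, ENNReal.ofReal (β * r ^ (-β - 1)) *
        (volume.restrict (Metric.ball x ρ)) (Metric.ball x r)
      ≤ ENNReal.ofReal (β * unitBallVolume n * (ρ ^ (n - β) / (n - β))) := by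
    calc ∫⁻ r in Ioc 0 ρ, ENNReal.ofReal (β * r ^ (-β - 1)) *
          (volume.restrict (Metric.ball x ρ)) (Metric.ball x r)
        ≤ ∫⁻ r in Ioc 0 ρ, ENNReal.ofReal (β * unitBallVolume n * r ^ (n - β - 1)) := by
          refine setLIntegral_mono' measurableSet_Ioc fun r hr => ?_
          have hr0 : 0 < r := hr.1
          refine (mul_le_mul_right (Measure.restrict_apply_le _ (Metric.ball x r)) _).trans
            (le_of_eq ?_)
          rw [volume_ball_eq hn x hr0.le, ← ENNReal.ofReal_mul (by positivity)]
          congr 1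
          have : r ^ (-β - 1) * r ^ (n : ℝ) = r ^ (n - β - 1) := by
            rw [← Real.rpow_add hr0]
            ring_nf
          linear_combination (β * unitBallVolume n : ℝ) * this
      _ = ENNReal.ofReal (β * unitBallVolume n * (ρ ^ (n - β) / (n - β))) := by
          have hint : IntegrableOn (fun r : ℝ => β * unitBallVolume n * r ^ (n - β - 1))
              (Ioc 0 ρ) := by
            rw [← intervalIntegrable_iff_integrableOn_Ioc_of_le hρ.le]
            exact (intervalIntegral.intervalIntegrable_rpow' (by linarith)).const_mul _
          rw [← ofReal_integral_eq_lintegral_ofReal hint]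
          · rw [integral_const_mul, ← intervalIntegral.integral_of_le hρ.le,
              integral_rpow (Or.inl (by linarith)), show n - β - 1 + 1 = n - β by ring,
              Real.zero_rpow h0.ne', sub_zero]
          · filter_upwards [ae_restrict_mem measurableSet_Ioc] with r hr
            have hr0 : 0 < r := hr.1
            positivity
  have hB : ∫⁻ r in Ioi ρ, ENNReal.ofReal (β * r ^ (-β - 1)) *
        (volume.restrict (Metric.ball x ρ)) (Metric.ball x r)
      ≤ ENNReal.ofReal (unitBallVolume n * ρ ^ (n - β)) := by
    calc ∫⁻ r in Ioi ρ, ENNReal.ofReal (β * r ^ (-β - 1)) *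
          (volume.restrict (Metric.ball x ρ)) (Metric.ball x r)
        ≤ ∫⁻ r in Ioi ρ, ENNReal.ofReal (β * r ^ (-β - 1)) *
            ENNReal.ofReal (unitBallVolume n * ρ ^ (n : ℝ)) := by
          refine lintegral_mono fun r => mul_le_mul_right ?_ _
          refine (measure_mono (subset_univ _)).trans ?_
          rw [Measure.restrict_apply_univ, volume_ball_eq hn x hρ.le]
      _ = ENNReal.ofReal (unitBallVolume n * ρ ^ (n - β)) := by
          rw [lintegral_mul_const' _ _ ENNReal.ofReal_ne_top, lintegral_Ioi_rpow_eq hβ hρ,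
            ← ENNReal.ofReal_mul (by positivity), sub_eq_add_neg, Real.rpow_add hρ]
          ring_nf
  refine (add_le_add hA hB).trans ?_
  rw [← ENNReal.ofReal_add (by positivity) (by positivity)]
  refine le_of_eq ?_
  congr 1
  field_simp
  ring

/-- If `ν` is a part of Lebesgue measure with density at least `d` at `x` on the scales between
`a` and `R`, the integral of `|x - y|^{-n}` over the shell has logarithmic size. -/
lemma log_le_lintegral_shell (hn : 0 < n) (S : Set (EuclideanSpace ℝ (Fin n))) {a R d : ℝ}
    (ha : 0 < a) (haR : a ≤ R) (hd : 0 ≤ d)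
    (hS : ∀ r, a < r → r ≤ R →
      ENNReal.ofReal (d * unitBallVolume n * r ^ (n : ℝ)) ≤ volume (S ∩ Metric.ball x r)) :
    ENNReal.ofReal (d * (n * unitBallVolume n * Real.log (R / a))) ≤
      (∫⁻ y in S ∩ (Metric.ball x R \ Metric.ball x a), ENNReal.ofReal (‖x - y‖ ^ (-(n : ℝ)))) +
        ENNReal.ofReal (unitBallVolume n) := by
  have hn' : (0 : ℝ) < n := by exact_mod_cast hn
  have hκ := unitBallVolume_pos n
  have h0 : ∫⁻ y in S ∩ (Metric.ball x R \ Metric.ball x a),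
        ENNReal.ofReal (‖x - y‖ ^ (-(n : ℝ)))
      = ∫⁻ y in S ∩ (Metric.ball x R \ Metric.ball x a),
        ENNReal.ofReal (max a ‖x - y‖ ^ (-(n : ℝ))) := by
    have hae : ∀ᵐ y ∂(volume.restrict (S ∩ (Metric.ball x R \ Metric.ball x a))),
        y ∉ Metric.ball x a := by
      rw [inter_comm]
      have := (ae_restrict_mem (μ := volume.restrict S)
        (Metric.isOpen_ball.measurableSet.diff Metric.isOpen_ball.measurableSet :
          MeasurableSet (Metric.ball x R \ Metric.ball x a)))
      rw [Measure.restrict_restrict (Metric.isOpen_ball.measurableSet.diff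
        Metric.isOpen_ball.measurableSet)] at this
      exact this.mono fun y hy => hy.2
    refine lintegral_congr_ae (hae.mono fun y hy => ?_)
    rw [Metric.mem_ball, dist_eq_norm, not_lt, norm_sub_rev] at hy
    simp only [max_eq_right hy]
  rw [h0, lintegral_max_rpow_eq _ x hn' ha]
  -- The additive κ pays for the hole: removing B(x,a) lowers each ball's measure by at most κaⁿ,
  -- which costs ∫_a^∞ n r^{-n-1} κaⁿ dr = κ.
  have h1 : ENNReal.ofReal (unitBallVolume n) =
      ∫⁻ r in Ioi a, ENNReal.ofReal (n * r ^ (-(n : ℝ) - 1)) *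
        ENNReal.ofReal (unitBallVolume n * a ^ (n : ℝ)) := by
    rw [lintegral_mul_const' _ _ ENNReal.ofReal_ne_top, lintegral_Ioi_rpow_eq hn' ha,
      ← ENNReal.ofReal_mul (by positivity)]
    congr 1
    rw [mul_left_comm, ← Real.rpow_add ha]
    simp
  rw [h1, ← lintegral_add_right _ (by fun_prop)]
  calc ENNReal.ofReal (d * (n * unitBallVolume n * Real.log (R / a)))
      = ∫⁻ r in Ioc a R, ENNReal.ofReal (d * n * unitBallVolume n * r⁻¹) := by
        have hint : IntegrableOn (fun r : ℝ => d * n * unitBallVolume n * r⁻¹) (Ioc a R) := by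
          rw [← intervalIntegrable_iff_integrableOn_Ioc_of_le haR]
          refine (ContinuousOn.intervalIntegrable ?_)
          refine continuousOn_const.mul (continuousOn_inv₀.mono ?_)
          intro r hr
          rw [uIcc_of_le haR] at hr
          exact (ha.trans_le hr.1).ne'
        rw [← ofReal_integral_eq_lintegral_ofReal hint]
        · rw [integral_const_mul, ← intervalIntegral.integral_of_le haR,
            integral_inv_of_pos ha (ha.trans_le haR)]
          ring_nf
        · filter_upwards [ae_restrict_mem measurableSet_Ioc] with r hr
          have hr0 : 0 < r := ha.trans hr.1
          positivity
    _ ≤ ∫⁻ r in Ioc a R, (ENNReal.ofReal (n * r ^ (-(n : ℝ) - 1)) *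
          (volume.restrict (S ∩ (Metric.ball x R \ Metric.ball x a))) (Metric.ball x r) +
          ENNReal.ofReal (n * r ^ (-(n : ℝ) - 1)) *
            ENNReal.ofReal (unitBallVolume n * a ^ (n : ℝ))) := by
        refine setLIntegral_mono' measurableSet_Ioc fun r hr => ?_
        have hr0 : 0 < r := ha.trans hr.1
        have h2 : ENNReal.ofReal (d * unitBallVolume n * r ^ (n : ℝ)) ≤
            (volume.restrict (S ∩ (Metric.ball x R \ Metric.ball x a))) (Metric.ball x r) +
              ENNReal.ofReal (unitBallVolume n * a ^ (n : ℝ)) := by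
          rw [Measure.restrict_apply Metric.isOpen_ball.measurableSet, ← volume_ball_eq hn x ha.le]
          refine (hS r hr.1 hr.2).trans ((measure_mono ?_).trans (measure_union_le _ _))
          intro y hy
          by_cases hya : y ∈ Metric.ball x a
          · exact Or.inr hya
          · exact Or.inl ⟨hy.2, hy.1, Metric.ball_subset_ball hr.2 hy.2, hya⟩
        rw [← mul_add]
        refine le_trans (le_of_eq ?_) (mul_le_mul_right h2 _)
        rw [← ENNReal.ofReal_mul (by positivity)]
        congr 1
        have : r ^ (-(n : ℝ) - 1) * r ^ (n : ℝ) = r⁻¹ := by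
          rw [← Real.rpow_add hr0, ← Real.rpow_neg_one]
          ring_nf
        linear_combination -(d * n * unitBallVolume n : ℝ) * this
    _ ≤ _ := lintegral_mono_set Ioc_subset_Ioi_self

end Consequences

/-! ### A discrete form of the Adams–Garsia lemma -/

lemma add_mul_le_Lp_mul_Lq {p q : ℝ} (hpq : p.HolderConjugate q) {x₁ x₂ y₁ y₂ : ℝ}
    (hx₁ : 0 ≤ x₁) (hx₂ : 0 ≤ x₂) (hy₁ : 0 ≤ y₁) (hy₂ : 0 ≤ y₂) :
    x₁ * y₁ + x₂ * y₂ ≤ (x₁ ^ p + x₂ ^ p) ^ (1 / p) * (y₁ ^ q + y₂ ^ q) ^ (1 / q) := by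
  have h := Real.inner_le_Lp_mul_Lq_of_nonneg (Finset.univ : Finset (Fin 2)) (f := ![x₁, x₂])
    (g := ![y₁, y₂]) hpq (by intro i _; fin_cases i <;> simpa) (by intro i _; fin_cases i <;> simpa)
  simpa using h

/-- Two-term Hölder raised to the power q; the exponent of the first factor is q/p = q - 1. -/
lemma rpow_le_of_le_add_mul {p q : ℝ} (hpq : p.HolderConjugate q) {v x₁ x₂ y₁ y₂ : ℝ}
    (hv : 0 ≤ v) (hx₁ : 0 ≤ x₁) (hx₂ : 0 ≤ x₂) (hy₁ : 0 ≤ y₁) (hy₂ : 0 ≤ y₂)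
    (h : v ≤ x₁ * y₁ + x₂ * y₂) :
    v ^ q ≤ (x₁ ^ p + x₂ ^ p) ^ (q - 1) * (y₁ ^ q + y₂ ^ q) := by
  have hp := hpq.pos
  have hq := hpq.symm.pos
  have hX : 0 ≤ x₁ ^ p + x₂ ^ p := by positivity
  have hY : 0 ≤ y₁ ^ q + y₂ ^ q := by positivity
  calc v ^ q ≤ ((x₁ ^ p + x₂ ^ p) ^ (1 / p) * (y₁ ^ q + y₂ ^ q) ^ (1 / q)) ^ q :=
        Real.rpow_le_rpow hv (h.trans (add_mul_le_Lp_mul_Lq hpq hx₁ hx₂ hy₁ hy₂)) hq.le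
    _ = _ := by
        rw [Real.mul_rpow (by positivity) (by positivity), ← Real.rpow_mul hX, ← Real.rpow_mul hY,
          one_div_mul_cancel hq.ne', Real.rpow_one, one_div_mul_eq_div,
          hpq.symm.div_conj_eq_sub_one]

lemma one_sub_rpow_le {r y : ℝ} (hr : 0 < r) (hy0 : 0 ≤ y) (hy1 : y ≤ 1) :
    (1 - y) ^ r ≤ 1 - min 1 r * y := by
  rcases le_total 1 r with h | h
  · rw [min_eq_left h, one_mul]
    calc (1 - y) ^ r ≤ (1 - y) ^ (1 : ℝ) :=
          Real.rpow_le_rpow_of_exponent_ge' (by linarith) (by linarith) zero_le_one h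
      _ = 1 - y := Real.rpow_one _
  · rw [min_eq_right h]
    have := rpow_one_add_le_one_add_mul_self (s := -y) (by linarith) hr.le h
    calc (1 - y) ^ r = (1 + -y) ^ r := by ring_nf
      _ ≤ _ := this
      _ = _ := by ring

lemma one_add_rpow_le {r y : ℝ} (hr : 0 < r) (hy0 : 0 ≤ y) (hy : r * y ≤ 1 / 2) :
    (1 + y) ^ r ≤ 1 + 2 * (r * y) := by
  have h0 : 0 ≤ r * y := by positivity
  calc (1 + y) ^ r ≤ (Real.exp y) ^ r :=
        Real.rpow_le_rpow (by linarith) (by linarith [Real.add_one_le_exp y]) hr.le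
    _ = Real.exp (r * y) := by rw [← Real.exp_mul, mul_comm]
    _ ≤ 1 / (1 - r * y) := Real.exp_bound_div_one_sub_of_interval h0 (by linarith)
    _ ≤ 1 + 2 * (r * y) := by
        rw [div_le_iff₀ (by linarith)]
        nlinarith

section Garsia

variable {p q C M : ℝ}

/-- The estimate between the levels `i ≤ j` for which the Adams–Garsia lemma is proved. -/
def GarsiaBound (p q C M : ℝ) (b v : ℕ → ℝ) : Prop :=
  ∀ i j : ℕ, i ≤ j → v j ≤ b i * (C * ((j : ℝ) - i + 1) ^ (1 / q)) +
    (1 - b i ^ p) ^ (1 / p) * ((i : ℝ) + M) ^ (1 / q)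

/-- The free parameter θ moves a factor from b i to C before Hölder is applied. With θ = 1 the first
factor is 1; with θ > 1 it drops below 1 in proportion to b i ^ p; a small θ makes the slope in j as
small as desired. -/
lemma GarsiaBound.rpow_le (hpq : p.HolderConjugate q) (hC : 0 ≤ C) (hM : 0 ≤ M)
    {b v : ℕ → ℝ} (hb0 : ∀ i, 0 ≤ b i) (hb1 : ∀ i, b i ≤ 1) (hv : ∀ j, 0 ≤ v j)
    (h : GarsiaBound p q C M b v) {θ : ℝ} (hθ : 0 < θ) {i j : ℕ} (hij : i ≤ j) :
    v j ^ q ≤ ((b i / θ) ^ p + (1 - b i ^ p)) ^ (q - 1) *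
      ((θ * C) ^ q * ((j : ℝ) - i + 1) + (i + M)) := by
  have hp := hpq.pos
  have hq := hpq.symm.pos
  have hji : (0 : ℝ) ≤ (j : ℝ) - i + 1 := by
    have : (i : ℝ) ≤ j := by exact_mod_cast hij
    linarith
  have hbp : 0 ≤ 1 - b i ^ p := by
    have := Real.rpow_le_one (hb0 i) (hb1 i) hp.le
    linarith
  have hiM : 0 ≤ (i : ℝ) + M := by positivity
  have hb0i := hb0 i
  have := rpow_le_of_le_add_mul hpq (v := v j) (x₁ := b i / θ)
    (y₁ := (θ * C) * ((j : ℝ) - i + 1) ^ (1 / q)) (x₂ := (1 - b i ^ p) ^ (1 / p))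
    (y₂ := ((i : ℝ) + M) ^ (1 / q)) (hv j) (by positivity) (by positivity) (by positivity)
    (by positivity) ((h i j hij).trans (le_of_eq (by field_simp)))
  rwa [Real.mul_rpow (by positivity) (by positivity), ← Real.rpow_mul hji, ← Real.rpow_mul hiM,
    ← Real.rpow_mul hbp, one_div_mul_cancel hq.ne', one_div_mul_cancel hp.ne', Real.rpow_one,
    Real.rpow_one, Real.rpow_one] at this

lemma GarsiaBound.le_add (hpq : p.HolderConjugate q) (hC : 0 ≤ C) (hM : 0 ≤ M)
    {b v : ℕ → ℝ} (hb0 : ∀ i, 0 ≤ b i) (hb1 : ∀ i, b i ≤ 1) (hv : ∀ j, 0 ≤ v j)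
    (h : GarsiaBound p q C M b v) (j : ℕ) : v j ^ q ≤ j + (C ^ q + M) := by
  have := h.rpow_le hpq hC hM hb0 hb1 hv one_pos (le_refl j)
  simp only [div_one, one_mul, add_sub_cancel, Real.one_rpow, sub_self, zero_add, mul_one] at this
  linarith

/-- Linear bookkeeping for `GarsiaBound.exists_gap`. The slope 1/4 in j grows to at most 1/2 because
z ≤ 1/2, so j - i can be absorbed on the left; the lower bound on i is what forces z ≤ 1/2. -/
lemma gap_arith {i j s z C₅ K V : ℝ} (hs : 1 ≤ s) (hM : 0 ≤ M)
    (hij : i ≤ j) (hzi : z * i ≤ C₅ * s) (hC₅ : 0 ≤ C₅) (hK : 4 + 4 * C₅ + 4 * M ≤ K)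
    (hi : K * s ≤ i) (hj : j - V ≤ s)
    (h : z ≤ 1 / 2 → V ≤ (1 + 2 * z) * (1 / 4 * (j - i + 1) + (i + M))) : j ≤ i + K * s := by
  have h7 : (4 + 4 * C₅ + 4 * M) * s ≤ K * s := mul_le_mul_of_nonneg_right hK (by linarith)
  have h8 : M ≤ M * s := le_mul_of_one_le_right hM hs
  have h9 : 0 ≤ C₅ * s := by positivity
  have hz2 : z ≤ 1 / 2 := by
    by_contra hcon
    push Not at hcon
    have : 1 / 2 * i ≤ z * i := mul_le_mul_of_nonneg_right hcon.le (by linarith)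
    linarith
  have h5 : z * (j - i + 1) ≤ 1 / 2 * (j - i + 1) := mul_le_mul_of_nonneg_right hz2 (by linarith)
  have h6 : z * M ≤ 1 / 2 * M := mul_le_mul_of_nonneg_right hz2 hM
  have h10 : (1 + 2 * z) * (1 / 4 * (j - i + 1) + (i + M)) =
    1 / 4 * (j - i + 1) + i + M + 1 / 2 * (z * (j - i + 1)) + 2 * (z * i) + 2 * (z * M) := by ring
  have := h hz2
  linarith

/-- Two levels at which the bound is nearly attained are close to each other. -/
lemma GarsiaBound.exists_gap (hpq : p.HolderConjugate q) (hC : 0 ≤ C) (hM : 0 ≤ M) :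
    ∃ K : ℕ, ∀ b v : ℕ → ℝ, (∀ i, 0 ≤ b i) → (∀ i, b i ≤ 1) → (∀ j, 0 ≤ v j) →
      GarsiaBound p q C M b v → ∀ s i j : ℕ, 1 ≤ s → i ≤ j → K * s ≤ i →
      (i : ℝ) - v i ^ q ≤ s → (j : ℝ) - v j ^ q ≤ s → j ≤ i + K * s := by
  have hp := hpq.pos
  have hq := hpq.symm.pos
  have hq1 : 0 < q - 1 := hpq.symm.sub_one_pos
  obtain ⟨c₀, hc₀, hc₀'⟩ : ∃ c₀ : ℝ, 0 < c₀ ∧ 2⁻¹ ^ p = 1 - c₀ :=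
    ⟨1 - 2⁻¹ ^ p, by
      have : (2⁻¹ : ℝ) ^ p < 1 := Real.rpow_lt_one (by norm_num) (by norm_num) hp
      linarith, by ring⟩
  have hc₀1 : c₀ ≤ 1 := by
    have : (0 : ℝ) < 2⁻¹ ^ p := by positivity
    linarith
  set c₁ := min 1 (q - 1) with hc₁
  have hc₁0 : 0 < c₁ := lt_min one_pos hq1
  set C₁ := (2 * C) ^ q + M with hC₁
  have hC₁0 : 0 ≤ C₁ := by positivity
  set C₂ := (1 + C₁) / (c₁ * c₀) with hC₂
  have hC₂0 : 0 < C₂ := by positivity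
  -- This θ serves the comparison of levels i and j: any slope well below 1 would do in place of
  -- 1/4.
  obtain ⟨θ, hθ, hθC⟩ : ∃ θ : ℝ, 0 < θ ∧ (θ * C) ^ q ≤ 1 / 4 := by
    refine ⟨(1 / 4) ^ (1 / q) / (C + 1), by positivity, ?_⟩
    calc ((1 / 4 : ℝ) ^ (1 / q) / (C + 1) * C) ^ q ≤ ((1 / 4 : ℝ) ^ (1 / q)) ^ q := by
          refine Real.rpow_le_rpow (by positivity) ?_ hq.le
          rw [div_mul_eq_mul_div, div_le_iff₀ (by positivity)]
          have : (0 : ℝ) ≤ (1 / 4) ^ (1 / q) := by positivity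
          nlinarith
      _ = 1 / 4 := by
          rw [← Real.rpow_mul (by norm_num), one_div_mul_cancel hq.ne', Real.rpow_one]
  set C₃ := (1 / θ) ^ p with hC₃
  have hC₃0 : 0 < C₃ := by positivity
  set C₅ := (q - 1) * C₃ * C₂ with hC₅
  have hC₅0 : 0 < C₅ := by positivity
  obtain ⟨K, hK⟩ := exists_nat_ge (4 + 4 * C₅ + 4 * M)
  refine ⟨K, fun b v hb0 hb1 hv h s i j hs hij hKi hi hj => ?_⟩
  have hs' : (1 : ℝ) ≤ s := by exact_mod_cast hs
  have hKi' : (K : ℝ) * s ≤ i := by exact_mod_cast hKi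
  have hij' : (i : ℝ) ≤ j := by exact_mod_cast hij
  have hi0 : (0 : ℝ) ≤ i := by positivity
  set B := b i ^ p with hB
  have hB0 : 0 ≤ B := Real.rpow_nonneg (hb0 i) _
  have hB1 : B ≤ 1 := Real.rpow_le_one (hb0 i) (hb1 i) hp.le
  -- With θ = 2 and j = i the bound reads v_i^q ≤ (1 - c₁c₀B)(i + C₁). As v_i^q is within s of i,
  -- the L^p mass B carried at level i is at most of order s/i.
  have step1 : B * i ≤ C₂ * s := by
    have h1 := h.rpow_le hpq hC hM hb0 hb1 hv (θ := 2) two_pos (le_refl i)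
    rw [div_eq_mul_inv, Real.mul_rpow (hb0 i) (by norm_num), hc₀', ← hB] at h1
    have h2 := one_sub_rpow_le hq1 (y := c₀ * B) (by positivity) (by nlinarith)
    have h3 : v i ^ q ≤ (1 - c₁ * (c₀ * B)) * (i + C₁) := by
      refine h1.trans ?_
      rw [show B * (1 - c₀) + (1 - B) = 1 - c₀ * B by ring,
        show (2 * C) ^ q * ((i : ℝ) - i + 1) + (i + M) = i + C₁ by rw [hC₁]; ring]
      exact mul_le_mul_of_nonneg_right h2 (by positivity)
    have h4 : (c₁ * c₀) * (B * i) ≤ (1 + C₁) * s := by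
      have : 0 ≤ c₁ * c₀ * B * C₁ := by positivity
      nlinarith
    rw [hC₂, div_mul_eq_mul_div, le_div_iff₀ (by positivity)]
    linarith
  set z := (q - 1) * (C₃ * B) with hz
  have hz0 : 0 ≤ z := by positivity
  have hzi : z * i ≤ C₅ * s := by
    calc z * i = (q - 1) * C₃ * (B * i) := by rw [hz]; ring
      _ ≤ (q - 1) * C₃ * (C₂ * s) := by gcongr
      _ = C₅ * s := by rw [hC₅]; ring
  suffices h4 : j ≤ i + (K : ℝ) * s by exact_mod_cast h4
  refine gap_arith hs' hM hij' hzi hC₅0.le hK hKi' hj fun hz2 => ?_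
  -- Now θ is small: since B is of order s/i, the prefactor 1 + 2z changes the term i only by a
  -- multiple of s, while the slope in j is 1/4. Hence v_j^q falls more than s short of j once j - i
  -- exceeds K s.
  have h1 := h.rpow_le hpq hC hM hb0 hb1 hv hθ hij
  have h2 : ((b i / θ) ^ p + (1 - B)) ^ (q - 1) ≤ 1 + 2 * z := by
    calc ((b i / θ) ^ p + (1 - B)) ^ (q - 1) ≤ (1 + C₃ * B) ^ (q - 1) := by
          refine Real.rpow_le_rpow ?_ ?_ hq1.le
          · have := hb0 i
            have : 0 ≤ 1 - B := by linarith
            positivity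
          · rw [div_eq_mul_one_div, Real.mul_rpow (hb0 i) (by positivity)]
            linarith
      _ ≤ _ := one_add_rpow_le hq1 (by positivity) hz2
  have hΔ0 : 0 ≤ (j : ℝ) - i + 1 := by linarith
  refine h1.trans (mul_le_mul h2 ?_ (by positivity) (by positivity))
  gcongr

/-- Levels are grouped by their deficit j - v_j^q. Deficit at most s + 1 occurs for only O(s + 1)
levels by `GarsiaBound.exists_gap`, and a term of deficit greater than s is less than e^{-s}, so the
sum converges. -/
lemma GarsiaBound.exists_tsum_le (hpq : p.HolderConjugate q) (hC : 0 ≤ C) (hM : 0 ≤ M) :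
    ∃ K : ℝ, 0 < K ∧ ∀ b v : ℕ → ℝ, (∀ i, 0 ≤ b i) → (∀ i, b i ≤ 1) → (∀ j, 0 ≤ v j) →
      GarsiaBound p q C M b v →
      ∑' j : ℕ, ENNReal.ofReal (Real.exp (v j ^ q - j)) ≤ ENNReal.ofReal K := by
  obtain ⟨K, hK⟩ := GarsiaBound.exists_gap hpq hC hM
  have hq := hpq.symm.pos
  set C₀ := C ^ q + M with hC₀
  have hC₀0 : 0 ≤ C₀ := by positivity
  set w : ℕ → ℝ := fun s => Real.exp (C₀ - s) * (2 * K * (s + 1) + 1) with hw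
  have hw0 : ∀ s, 0 < w s := fun s => by positivity
  have hsum : Summable w := by
    have h0 := Real.summable_pow_mul_exp_neg_nat_mul 0 one_pos
    have h1 := Real.summable_pow_mul_exp_neg_nat_mul 1 one_pos
    refine ((h1.mul_left (Real.exp C₀ * (2 * K))).add
      (h0.mul_left (Real.exp C₀ * (2 * K + 1)))).congr fun s => ?_
    simp only [hw, sub_eq_add_neg, Real.exp_add, pow_one, pow_zero, neg_one_mul, one_mul]
    ring
  refine ⟨∑' s, w s, hsum.tsum_pos (fun s => (hw0 s).le) 0 (hw0 0),
    fun b v hb0 hb1 hv h => ?_⟩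
  rw [ENNReal.ofReal_tsum_of_nonneg (fun s => (hw0 s).le) hsum]
  have hF := h.le_add hpq hC hM hb0 hb1 hv
  set S : ℕ → Set ℕ := fun s => {j | (j : ℝ) - v j ^ q ≤ s} with hS
  have hcard : ∀ s : ℕ, ∑' j, (S (s + 1)).indicator (1 : ℕ → ℝ≥0∞) j
      ≤ ENNReal.ofReal (2 * K * (s + 1) + 1) := by
    intro s
    obtain ⟨T, hT, hTc⟩ : ∃ T : Finset ℕ, S (s + 1) ⊆ T ∧ T.card ≤ 2 * K * (s + 1) + 1 := by
      -- Indices below K(s+1) are counted trivially; the others lie in a window of length K(s+1)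
      -- starting at the least of them.
      by_cases hne : ∃ i, i ∈ S (s + 1) ∧ K * (s + 1) ≤ i
      · classical
        obtain ⟨hi, hKi⟩ := Nat.find_spec hne
        set i := Nat.find hne with hidef
        refine ⟨Finset.range (K * (s + 1)) ∪ Finset.Icc i (i + K * (s + 1)), fun j hj => ?_, ?_⟩
        · simp only [Finset.coe_union, Finset.coe_range, Finset.coe_Icc, mem_union, mem_Iio,
            mem_Icc]
          rcases lt_or_ge j (K * (s + 1)) with hlt | hge
          · exact Or.inl hlt
          · have hij : i ≤ j := Nat.find_min' hne ⟨hj, hge⟩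
            refine Or.inr ⟨hij, hK b v hb0 hb1 hv h (s + 1) i j (by omega) hij hKi ?_ ?_⟩
            · exact hi
            · exact hj
        · refine (Finset.card_union_le _ _).trans ?_
          simp only [Finset.card_range, Nat.card_Icc]
          have : 2 * K * (s + 1) = K * (s + 1) + K * (s + 1) := by ring
          omega
      · push Not at hne
        refine ⟨Finset.range (K * (s + 1)), fun j hj => ?_, ?_⟩
        · simpa using hne j hj
        · rw [Finset.card_range]
          nlinarith
    rw [tsum_eq_sum (s := T) (fun j hj => indicator_of_notMem (fun hj' => hj (hT hj')) _)]
    calc ∑ j ∈ T, (S (s + 1)).indicator (1 : ℕ → ℝ≥0∞) j ≤ ∑ j ∈ T, 1 :=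
          Finset.sum_le_sum fun j _ => indicator_le_self' (by simp) j
      _ = (T.card : ℝ≥0∞) := by simp
      _ ≤ ((2 * K * (s + 1) + 1 : ℕ) : ℝ≥0∞) := by exact_mod_cast hTc
      _ = ENNReal.ofReal (2 * K * (s + 1) + 1) := by
          rw [← ENNReal.ofReal_natCast]
          push_cast
          rfl
  calc ∑' j : ℕ, ENNReal.ofReal (Real.exp (v j ^ q - j))
      ≤ ∑' j : ℕ, ∑' s : ℕ, ENNReal.ofReal (Real.exp (C₀ - s)) *
          (S (s + 1)).indicator (1 : ℕ → ℝ≥0∞) j := by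
        refine ENNReal.tsum_le_tsum fun j => ?_
        -- The deficit may be negative, but not below -C₀; the factor exp C₀ in the weight covers
        -- those levels with s = 0.
        rcases le_or_gt ((j : ℝ) - v j ^ q) 1 with h1 | h1
        · refine le_trans ?_ (ENNReal.le_tsum 0)
          rw [indicator_of_mem (by simpa [hS] using h1), Pi.one_apply, mul_one]
          refine ENNReal.ofReal_le_ofReal (Real.exp_le_exp.2 ?_)
          have := hF j
          push_cast
          linarith
        · have h0 : 0 < (j : ℝ) - v j ^ q := by linarith
          obtain ⟨s, hs⟩ : ∃ s, ⌈(j : ℝ) - v j ^ q⌉₊ = s + 1 :=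
            Nat.exists_eq_succ_of_ne_zero (Nat.ceil_pos.2 h0).ne'
          refine le_trans ?_ (ENNReal.le_tsum s)
          have hmem : j ∈ S (s + 1) := by
            simp only [hS, mem_ofPred_eq, ← hs]
            exact Nat.le_ceil _
          rw [indicator_of_mem hmem, Pi.one_apply, mul_one]
          refine ENNReal.ofReal_le_ofReal (Real.exp_le_exp.2 ?_)
          have := Nat.ceil_lt_add_one h0.le
          rw [hs] at this
          push_cast at this
          linarith
    _ = ∑' s : ℕ, ∑' j : ℕ, ENNReal.ofReal (Real.exp (C₀ - s)) *
          (S (s + 1)).indicator (1 : ℕ → ℝ≥0∞) j := ENNReal.tsum_comm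
    _ ≤ ∑' s : ℕ, ENNReal.ofReal (w s) := by
        refine ENNReal.tsum_le_tsum fun s => ?_
        rw [ENNReal.tsum_mul_left, hw, ENNReal.ofReal_mul (Real.exp_nonneg _)]
        exact mul_le_mul_right (hcard s) _

end Garsia

/-! ### Sets of prescribed volume -/

section Prescribed

variable {n : ℕ}

lemma measure_ball_inter_le_add (hn : 0 < n) (S : Set (EuclideanSpace ℝ (Fin n)))
    (x : EuclideanSpace ℝ (Fin n)) {s r : ℝ} (hs : 0 ≤ s) (hsr : s ≤ r) :
    volume (Metric.ball x r ∩ S) ≤ volume (Metric.ball x s ∩ S) +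
      ENNReal.ofReal (unitBallVolume n * r ^ (n : ℝ) - unitBallVolume n * s ^ (n : ℝ)) := by
  have h1 : volume (Metric.ball x r \ Metric.ball x s) =
      ENNReal.ofReal (unitBallVolume n * r ^ (n : ℝ) - unitBallVolume n * s ^ (n : ℝ)) := by
    rw [measure_sdiff (Metric.ball_subset_ball hsr) Metric.isOpen_ball.nullMeasurableSet
      measure_ball_lt_top.ne, volume_ball_eq hn x hs, volume_ball_eq hn x (hs.trans hsr),
      ENNReal.ofReal_sub _ (mul_nonneg (unitBallVolume_pos n).le (Real.rpow_nonneg hs _))]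
  rw [← h1]
  refine (measure_mono ?_).trans (measure_union_le _ _)
  intro y hy
  by_cases hys : y ∈ Metric.ball x s
  · exact Or.inl ⟨hys, hy.2⟩
  · exact Or.inr ⟨hy.1, hys⟩

/-- Intermediate value theorem: by `measure_ball_inter_le_add` the volume of the intersection varies
no faster with r than the volume of the ball. -/
lemma exists_volume_ball_inter_eq (hn : 0 < n) (S : Set (EuclideanSpace ℝ (Fin n)))
    (x : EuclideanSpace ℝ (Fin n)) {δ : ℝ≥0∞} (hδ : 0 < δ) (hδS : δ < volume S) :
    ∃ r : ℝ, 0 < r ∧ volume (Metric.ball x r ∩ S) = δ := by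
  have hδtop : δ ≠ ∞ := hδS.ne_top
  have hfin : ∀ r, volume (Metric.ball x r ∩ S) ≠ ∞ := fun r =>
    ((measure_mono inter_subset_left).trans_lt measure_ball_lt_top).ne
  obtain ⟨R, hR⟩ : ∃ R : ℕ, δ < volume (Metric.ball x R ∩ S) := by
    have hmono : Monotone fun k : ℕ => Metric.ball x (k : ℝ) ∩ S := fun i j hij =>
      inter_subset_inter_left _ (Metric.ball_subset_ball (by exact_mod_cast hij))
    have ht := tendsto_measure_iUnion_atTop (μ := volume) hmono
    rw [← iUnion_inter, Metric.iUnion_ball_nat, univ_inter] at ht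
    exact (ht.eventually (lt_mem_nhds hδS)).exists
  set g : ℝ → ℝ := fun r => (volume (Metric.ball x r ∩ S)).toReal with hg
  set h : ℝ → ℝ := fun r => unitBallVolume n * r ^ (n : ℝ) with hh
  have hle : ∀ s r : ℝ, 0 ≤ s → s ≤ r → |g r - g s| ≤ |h r - h s| := by
    intro s r hs hsr
    have h0 : g s ≤ g r := ENNReal.toReal_mono (hfin r)
      (measure_mono (inter_subset_inter_left _ (Metric.ball_subset_ball hsr)))
    have h1 : h s ≤ h r := mul_le_mul_of_nonneg_left (Real.rpow_le_rpow hs hsr (by positivity))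
      (unitBallVolume_pos n).le
    have h2 := ENNReal.toReal_mono (ENNReal.add_ne_top.2 ⟨hfin s, ENNReal.ofReal_ne_top⟩)
      (measure_ball_inter_le_add hn S x hs hsr)
    rw [ENNReal.toReal_add (hfin s) ENNReal.ofReal_ne_top,
      ENNReal.toReal_ofReal (sub_nonneg.2 h1)] at h2
    rw [abs_of_nonneg (sub_nonneg.2 h0), abs_of_nonneg (sub_nonneg.2 h1)]
    simp only [hg, hh]
    linarith
  have hcont : ContinuousOn g (Icc 0 (R : ℝ)) := by
    have hhc : Continuous h := continuous_const.mul
      (Real.continuous_rpow_const (Nat.cast_nonneg n))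
    intro s hs
    have h1 : Tendsto (fun r => |h r - h s|) (𝓝[Icc 0 (R : ℝ)] s) (𝓝 0) := by
      have : Tendsto (fun r => |h r - h s|) (𝓝 s) (𝓝 |h s - h s|) :=
        (hhc.sub continuous_const).abs.tendsto s
      rw [sub_self, abs_zero] at this
      exact this.mono_left nhdsWithin_le_nhds
    rw [ContinuousWithinAt, tendsto_iff_dist_tendsto_zero]
    refine squeeze_zero' (Eventually.of_forall fun r => dist_nonneg) ?_ h1
    filter_upwards [self_mem_nhdsWithin] with r hr
    rw [Real.dist_eq]
    rcases le_total s r with h2 | h2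
    · exact hle s r hs.1 h2
    · rw [abs_sub_comm, abs_sub_comm (h r)]
      exact hle r s hr.1 h2
  have hg0 : g 0 = 0 := by simp [hg]
  have hgR : δ.toReal < g R := (ENNReal.toReal_lt_toReal hδtop (hfin _)).2 hR
  obtain ⟨r, hr, hgr⟩ := intermediate_value_Icc (Nat.cast_nonneg R) hcont
    (show δ.toReal ∈ Icc (g 0) (g R) from ⟨by rw [hg0]; positivity, hgR.le⟩)
  refine ⟨r, lt_of_le_of_ne hr.1 ?_, (ENNReal.toReal_eq_toReal_iff' (hfin r) hδtop).1 hgr⟩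
  rintro rfl
  rw [hg0] at hgr
  exact (ENNReal.toReal_pos hδ.ne' hδtop).ne hgr

lemma volume_univ_eq_top (hn : 0 < n) :
    volume (univ : Set (EuclideanSpace ℝ (Fin n))) = ∞ := by
  have : Nonempty (Fin n) := ⟨⟨0, hn⟩⟩
  have : NoncompactSpace (EuclideanSpace ℝ (Fin n)) := NormedSpace.noncompactSpace ℝ _
  exact measure_univ_of_isAddLeftInvariant _

/-- A set of prescribed volume on which an integrable function takes its largest values. -/
lemma exists_superlevel_volume_eq (hn : 0 < n) {g : EuclideanSpace ℝ (Fin n) → ℝ≥0∞}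
    (hg : Measurable g) (hgi : ∫⁻ y, g y ≠ ∞) {τ : ℝ} (hτ : 0 < τ) :
    ∃ (m : ℝ≥0∞) (D : Set (EuclideanSpace ℝ (Fin n))), MeasurableSet D ∧
      volume D = ENNReal.ofReal τ ∧ (∀ y ∈ D, m ≤ g y) ∧ ∀ y ∉ D, g y ≤ m := by
  have hτ' : 0 < ENNReal.ofReal τ := ENNReal.ofReal_pos.2 hτ
  have hfin : ∀ u : ℝ≥0∞, u ≠ 0 → volume {y | u < g y} ≠ ∞ := by
    intro u hu
    rcases eq_or_ne u ∞ with rfl | hu'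
    · simp
    · refine ((measure_mono fun y hy => ?_).trans_lt
        ((meas_ge_le_lintegral_div hg.aemeasurable hu hu').trans_lt
          (ENNReal.div_lt_top hgi hu))).ne
      exact (le_of_lt hy : u ≤ g y)
  set A : Set ℝ≥0∞ := {u | volume {y | u < g y} ≤ ENNReal.ofReal τ} with hA
  set m := sInf A with hm
  have hAup : ∀ u, m < u → u ∈ A := by
    intro u hu
    obtain ⟨u', hu'A, hu'⟩ := sInf_lt_iff.1 hu
    exact (measure_mono fun y hy => hu'.trans hy).trans hu'A
  have hAdown : ∀ u, u < m → ENNReal.ofReal τ < volume {y | u < g y} := by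
    intro u hu
    by_contra hcon
    exact (not_lt.2 (sInf_le (show u ∈ A from not_lt.1 hcon))) hu
  have hgt : volume {y | m < g y} ≤ ENNReal.ofReal τ := by
    rcases eq_or_ne m ∞ with h | h
    · rw [h]; simp
    · obtain ⟨u, hu, hum, hut⟩ := exists_seq_strictAnti_tendsto' (lt_top_iff_ne_top.2 h)
      have hun : {y | m < g y} = ⋃ k, {y | u k < g y} := by
        ext y
        simp only [mem_ofPred_eq, mem_iUnion]
        refine ⟨fun hy => ?_, fun ⟨k, hk⟩ => (hum k).1.trans hk⟩
        exact (hut.eventually (gt_mem_nhds hy)).exists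
      have hmono : Monotone fun k => {y | u k < g y} := fun i j hij y hy =>
        (hu.antitone hij).trans_lt hy
      rw [hun]
      exact le_of_tendsto' (tendsto_measure_iUnion_atTop hmono) fun k => hAup _ (hum k).1
  have hge : ENNReal.ofReal τ ≤ volume {y | m ≤ g y} := by
    rcases eq_or_ne m 0 with h | h
    · rw [h]
      simp only [zero_le, ofPred_true]
      rw [volume_univ_eq_top hn]
      exact le_top
    · obtain ⟨u, hu, hum, hut⟩ := exists_seq_strictMono_tendsto' (pos_iff_ne_zero.2 h)
      have hun : {y | m ≤ g y} = ⋂ k, {y | u k < g y} := by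
        ext y
        simp only [mem_ofPred_eq, mem_iInter]
        refine ⟨fun hy k => (hum k).2.trans_le hy, fun hy => ?_⟩
        exact le_of_tendsto' hut fun k => (hy k).le
      have hanti : Antitone fun k => {y | u k < g y} := fun i j hij y hy =>
        (hu.monotone hij).trans_lt hy
      rw [hun]
      exact ge_of_tendsto' (tendsto_measure_iInter_atTop
        (fun k => (measurableSet_lt measurable_const hg).nullMeasurableSet) hanti
        ⟨0, hfin _ (hum 0).1.ne'⟩) fun k => (hAdown _ (hum k).2).le
  have hmeas_gt : MeasurableSet {y | m < g y} := measurableSet_lt measurable_const hg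
  have hmeas_eq : MeasurableSet {y | g y = m} := measurableSet_eq_fun hg measurable_const
  have hmeas_ge : MeasurableSet {y | m ≤ g y} := measurableSet_le measurable_const hg
  have hsplit : volume {y | m ≤ g y} = volume {y | m < g y} + volume {y | g y = m} := by
    rw [← measure_union ?_ hmeas_eq]
    · congr 1
      ext y
      simp only [mem_ofPred_eq, mem_union]
      rw [le_iff_lt_or_eq, eq_comm (a := m)]
    · refine disjoint_left.2 fun y hy hy' => ?_
      exact (ne_of_gt hy) hy'
  rcases hgt.eq_or_lt with h1 | h1
  · exact ⟨m, {y | m < g y}, hmeas_gt, h1, fun y hy => le_of_lt hy, fun y hy => not_lt.1 hy⟩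
  rcases hge.eq_or_lt with h2 | h2
  · exact ⟨m, {y | m ≤ g y}, hmeas_ge, h2.symm, fun y hy => hy,
      fun y hy => le_of_lt (not_le.1 hy)⟩
  obtain ⟨r, -, hr⟩ := exists_volume_ball_inter_eq hn {y | g y = m} 0
    (δ := ENNReal.ofReal τ - volume {y | m < g y}) (tsub_pos_of_lt h1)
    (by rw [hsplit] at h2; exact ENNReal.sub_lt_of_lt_add h1.le (by rwa [add_comm] at h2))
  refine ⟨m, {y | m < g y} ∪ (Metric.ball 0 r ∩ {y | g y = m}),
    hmeas_gt.union (Metric.isOpen_ball.measurableSet.inter hmeas_eq), ?_, ?_, ?_⟩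
  · rw [measure_union ?_ (Metric.isOpen_ball.measurableSet.inter hmeas_eq), hr,
      add_tsub_cancel_of_le h1.le]
    exact disjoint_left.2 fun y hy hy' => (ne_of_gt hy) hy'.2
  · rintro y (hy | hy)
    · exact le_of_lt hy
    · exact hy.2.ge
  · intro y hy
    exact not_lt.1 fun h => hy (Or.inl h)

end Prescribed

/-! ### Young's inequality for a kernel with finite mass -/

/-- Hölder for the splitting K = K^{1/p} K^{1/q}, then Tonelli and translation invariance. -/
lemma lintegral_conv_rpow_le {n : ℕ} {p q : ℝ} (hpq : p.HolderConjugate q)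
    {K g : EuclideanSpace ℝ (Fin n) → ℝ≥0∞} (hK : Measurable K) (hg : Measurable g) :
    ∫⁻ x, (∫⁻ y, K (x - y) * g y) ^ p ≤ (∫⁻ z, K z) ^ p * ∫⁻ y, g y ^ p := by
  have hp := hpq.pos
  have hq := hpq.symm.pos
  have hpt : ∀ x, (∫⁻ y, K (x - y) * g y) ^ p
      ≤ (∫⁻ z, K z) ^ (p / q) * ∫⁻ y, K (x - y) * g y ^ p := by
    intro x
    have hKx : Measurable fun y => K (x - y) := hK.comp (measurable_const.sub measurable_id)
    have h := ENNReal.lintegral_mul_le_Lp_mul_Lq volume hpq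
      (f := fun y => K (x - y) ^ (1 / p) * g y) (g := fun y => K (x - y) ^ (1 / q))
      ((hKx.pow_const _).mul hg).aemeasurable (hKx.pow_const _).aemeasurable
    have e1 : ∀ y, ((fun y => K (x - y) ^ (1 / p) * g y) * fun y => K (x - y) ^ (1 / q)) y
        = K (x - y) * g y := by
      intro y
      simp only [Pi.mul_apply]
      rw [mul_right_comm, ← ENNReal.rpow_add_of_nonneg _ _ (by positivity) (by positivity),
        one_div, one_div, hpq.inv_add_inv_eq_one, ENNReal.rpow_one]
    have e2 : ∀ y, (K (x - y) ^ (1 / p) * g y) ^ p = K (x - y) * g y ^ p := by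
      intro y
      rw [ENNReal.mul_rpow_of_nonneg _ _ hp.le, ← ENNReal.rpow_mul, one_div_mul_cancel hp.ne',
        ENNReal.rpow_one]
    have e3 : ∀ y, (K (x - y) ^ (1 / q)) ^ q = K (x - y) := by
      intro y
      rw [← ENNReal.rpow_mul, one_div_mul_cancel hq.ne', ENNReal.rpow_one]
    simp only [e1, e2, e3] at h
    rw [lintegral_sub_left_eq_self K x] at h
    calc (∫⁻ y, K (x - y) * g y) ^ p
        ≤ ((∫⁻ y, K (x - y) * g y ^ p) ^ (1 / p) * (∫⁻ z, K z) ^ (1 / q)) ^ p :=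
          ENNReal.rpow_le_rpow h hp.le
      _ = _ := by
          rw [ENNReal.mul_rpow_of_nonneg _ _ hp.le, ← ENNReal.rpow_mul, ← ENNReal.rpow_mul,
            one_div_mul_cancel hp.ne', ENNReal.rpow_one, one_div_mul_eq_div, mul_comm]
  have hm : Measurable fun z : EuclideanSpace ℝ (Fin n) × EuclideanSpace ℝ (Fin n) =>
      K (z.1 - z.2) * g z.2 ^ p :=
    (hK.comp (measurable_fst.sub measurable_snd)).mul ((hg.comp measurable_snd).pow_const _)
  calc ∫⁻ x, (∫⁻ y, K (x - y) * g y) ^ p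
      ≤ ∫⁻ x, (∫⁻ z, K z) ^ (p / q) * ∫⁻ y, K (x - y) * g y ^ p := lintegral_mono hpt
    _ = (∫⁻ z, K z) ^ (p / q) * ∫⁻ x, ∫⁻ y, K (x - y) * g y ^ p :=
        lintegral_const_mul _ hm.lintegral_prod_right'
    _ = (∫⁻ z, K z) ^ (p / q) * ∫⁻ y, ∫⁻ x, K (x - y) * g y ^ p := by
        rw [lintegral_lintegral_swap hm.aemeasurable]
    _ = (∫⁻ z, K z) ^ (p / q) * ((∫⁻ z, K z) * ∫⁻ y, g y ^ p) := by
        congr 1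
        rw [← lintegral_const_mul _ (hg.pow_const p)]
        refine lintegral_congr fun y => ?_
        rw [lintegral_mul_const _ (show Measurable fun x => K (x - y) from
          hK.comp (measurable_id.sub measurable_const)),
          lintegral_sub_right_eq_self K y]
    _ = _ := by
        rw [← mul_assoc, hpq.div_conj_eq_sub_one]
        congr 1
        nth_rw 2 [← ENNReal.rpow_one (∫⁻ z, K z)]
        rw [← ENNReal.rpow_add_of_nonneg _ _ hpq.sub_one_pos.le zero_le_one, sub_add_cancel]

/-! ### Pointwise bounds for Riesz potentials -/

/-- The Riesz kernel `|z|^{α-n}` with values in `[0,∞]`. -/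
noncomputable def rieszKernel {n : ℕ} (α : ℝ) (z : EuclideanSpace ℝ (Fin n)) : ℝ≥0∞ :=
  ENNReal.ofReal (‖z‖ ^ (α - (n : ℝ)))

/-- The Riesz potential of a nonnegative function, with values in `[0,∞]`. -/
noncomputable def lRiesz {n : ℕ} (α : ℝ) (g : EuclideanSpace ℝ (Fin n) → ℝ≥0∞)
    (x : EuclideanSpace ℝ (Fin n)) : ℝ≥0∞ :=
  ∫⁻ y, rieszKernel α (x - y) * g y

section Kernel

variable {n : ℕ} {α : ℝ}

@[fun_prop]
lemma measurable_rieszKernel :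
    Measurable (rieszKernel α : EuclideanSpace ℝ (Fin n) → ℝ≥0∞) := by
  unfold rieszKernel
  fun_prop

lemma measurable_lRiesz {g : EuclideanSpace ℝ (Fin n) → ℝ≥0∞} (hg : Measurable g) :
    Measurable (lRiesz α g) := by
  have : Measurable fun z : EuclideanSpace ℝ (Fin n) × EuclideanSpace ℝ (Fin n) =>
      rieszKernel α (z.1 - z.2) * g z.2 := by fun_prop
  exact this.lintegral_prod_right'

lemma holderConjugate_div (hα0 : 0 < α) (hαn : α < n) :
    ((n : ℝ) / α).HolderConjugate ((n : ℝ) / (n - α)) := by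
  rw [Real.holderConjugate_iff]
  have : 0 < (n : ℝ) - α := by linarith
  have hn : (0 : ℝ) < n := by linarith
  refine ⟨by rwa [one_lt_div hα0], ?_⟩
  field_simp
  ring

lemma rieszKernel_rpow (hαn : α < n) (z : EuclideanSpace ℝ (Fin n)) :
    rieszKernel α z ^ ((n : ℝ) / (n - α)) = ENNReal.ofReal (‖z‖ ^ (-(n : ℝ))) := by
  have : 0 < (n : ℝ) - α := by linarith
  rw [rieszKernel, ENNReal.ofReal_rpow_of_nonneg (by positivity) (by positivity),
    ← Real.rpow_mul (norm_nonneg _)]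
  congr 2
  rw [← neg_sub (n : ℝ) α]
  field_simp

lemma setLIntegral_ball_rieszKernel_le (hα0 : 0 < α) (hαn : α < n)
    (x : EuclideanSpace ℝ (Fin n)) {ρ : ℝ} (hρ : 0 < ρ) :
    ∫⁻ y in Metric.ball x ρ, rieszKernel α (x - y)
      ≤ ENNReal.ofReal (n / α * unitBallVolume n * ρ ^ α) := by
  have hn : 0 < n := by
    have : (0 : ℝ) < n := by linarith
    exact_mod_cast this
  have := setLIntegral_ball_rpow_le x hn (β := n - α) (by linarith) (by linarith) hρ
  simpa only [neg_sub, sub_sub_cancel, rieszKernel] using this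

/-- Hölder's inequality for the kernel away from its singularity. -/
lemma setLIntegral_diff_ball_le (hα0 : 0 < α) (hαn : α < n)
    {g : EuclideanSpace ℝ (Fin n) → ℝ≥0∞} (hg : Measurable g)
    (x : EuclideanSpace ℝ (Fin n)) {ρ : ℝ} {W : Set (EuclideanSpace ℝ (Fin n))}
    (hW : MeasurableSet W) :
    ∫⁻ y in W \ Metric.ball x ρ, rieszKernel α (x - y) * g y
      ≤ (∫⁻ y in W, g y ^ ((n : ℝ) / α)) ^ (1 / ((n : ℝ) / α)) *
        (∫⁻ y in W, ENNReal.ofReal (max ρ ‖x - y‖ ^ (-(n : ℝ)))) ^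
          (1 / ((n : ℝ) / (n - α))) := by
  have hpq := holderConjugate_div hα0 hαn
  have hkx : Measurable fun y => rieszKernel α (x - y) :=
    measurable_rieszKernel.comp (measurable_const.sub measurable_id)
  have h := ENNReal.lintegral_mul_le_Lp_mul_Lq (volume.restrict (W \ Metric.ball x ρ)) hpq.symm
    hkx.aemeasurable hg.aemeasurable
  simp only [Pi.mul_apply, rieszKernel_rpow hαn] at h
  refine h.trans ?_
  rw [mul_comm]
  refine mul_le_mul' (ENNReal.rpow_le_rpow (lintegral_mono_set sdiff_subset) hpq.one_div_nonneg)
    (ENNReal.rpow_le_rpow ?_ hpq.symm.one_div_nonneg)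
  refine le_trans (le_of_eq ?_) (lintegral_mono_set (sdiff_subset (t := Metric.ball x ρ)))
  refine setLIntegral_congr_fun (hW.diff Metric.isOpen_ball.measurableSet) fun y hy => ?_
  have := hy.2
  rw [Metric.mem_ball, dist_eq_norm, not_lt, norm_sub_rev] at this
  simp only [max_eq_right this]

/-- Up to the factor |B_ρ|, the p-th power of the bound for the kernel's mass on B_ρ does not depend
on ρ. Averaging over a set of volume at least |B_ρ| therefore gives constants free of ρ. -/
lemma kernelMass_rpow (hα0 : 0 < α) (hαn : α < n) {ρ : ℝ} (hρ : 0 < ρ) :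
    (n / α * unitBallVolume n * ρ ^ α) ^ ((n : ℝ) / α) =
      (unitBallVolume n * ρ ^ (n : ℝ)) *
        (n / α * unitBallVolume n ^ (1 / ((n : ℝ) / (n - α)))) ^ ((n : ℝ) / α) := by
  have hpq := holderConjugate_div hα0 hαn
  have hκ := unitBallVolume_pos n
  have hn : (0 : ℝ) < n := by linarith
  rw [Real.mul_rpow (by positivity) (by positivity), Real.mul_rpow (by positivity) (by positivity),
    Real.mul_rpow (by positivity) (by positivity), ← Real.rpow_mul hρ.le, ← Real.rpow_mul hκ.le,
    one_div_mul_eq_div, hpq.div_conj_eq_sub_one, mul_div_cancel₀ _ hα0.ne',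
    Real.rpow_sub_one hκ.ne']
  field_simp

/-- The average over a set of volume at least `|B_ρ|` controls the local part of the potential. -/
lemma exists_local_le (hα0 : 0 < α) (hαn : α < n)
    {g : EuclideanSpace ℝ (Fin n) → ℝ≥0∞} (hg : Measurable g) {ρ : ℝ} (hρ : 0 < ρ)
    {A : Set (EuclideanSpace ℝ (Fin n))}
    (hA : ENNReal.ofReal (unitBallVolume n * ρ ^ (n : ℝ)) ≤ volume A) (hA' : volume A ≠ ∞) :
    ∃ x ∈ A, ∫⁻ y in Metric.ball x ρ, rieszKernel α (x - y) * g y ≤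
      ENNReal.ofReal (n / α * unitBallVolume n ^ (1 / ((n : ℝ) / (n - α)))) *
        (∫⁻ y, g y ^ ((n : ℝ) / α)) ^ (1 / ((n : ℝ) / α)) := by
  have hpq := holderConjugate_div hα0 hαn
  have hp := hpq.pos
  have hκ := unitBallVolume_pos n
  set τ := unitBallVolume n * ρ ^ (n : ℝ) with hτ
  have hτ0 : 0 < τ := by positivity
  set K : EuclideanSpace ℝ (Fin n) → ℝ≥0∞ := (Metric.ball 0 ρ).indicator (rieszKernel α) with hK
  have hKm : Measurable K := measurable_rieszKernel.indicator Metric.isOpen_ball.measurableSet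
  have hT : ∀ x, ∫⁻ y in Metric.ball x ρ, rieszKernel α (x - y) * g y =
      ∫⁻ y, K (x - y) * g y := by
    intro x
    rw [← lintegral_indicator Metric.isOpen_ball.measurableSet]
    refine lintegral_congr fun y => ?_
    by_cases hy : y ∈ Metric.ball x ρ
    · rw [indicator_of_mem hy, hK, indicator_of_mem]
      rwa [mem_ball_zero_iff, ← dist_eq_norm, dist_comm]
    · rw [indicator_of_notMem hy, hK, indicator_of_notMem, zero_mul]
      rwa [mem_ball_zero_iff, ← dist_eq_norm, dist_comm]
  have hTm : Measurable fun x => (∫⁻ y, K (x - y) * g y) ^ ((n : ℝ) / α) := by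
    have : Measurable fun z : EuclideanSpace ℝ (Fin n) × EuclideanSpace ℝ (Fin n) =>
        K (z.1 - z.2) * g z.2 := by fun_prop
    exact this.lintegral_prod_right'.pow_const _
  -- The local part need not be bounded at every point, but some point of A does no worse than its
  -- L^p average. One point suffices when A is a level set.
  obtain ⟨x, hxA, hx⟩ := exists_le_setLAverage (μ := volume) (s := A)
    ((ENNReal.ofReal_pos.2 hτ0).trans_le hA).ne' hA' hTm.aemeasurable
  refine ⟨x, hxA, ?_⟩
  have hKint : ∫⁻ z, K z ≤ ENNReal.ofReal (n / α * unitBallVolume n * ρ ^ α) := by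
    rw [hK, lintegral_indicator Metric.isOpen_ball.measurableSet]
    have h0 := setLIntegral_ball_rieszKernel_le hα0 hαn (0 : EuclideanSpace ℝ (Fin n)) hρ
    simpa [rieszKernel] using h0
  rw [hT, ← ENNReal.rpow_le_rpow_iff hp]
  refine hx.trans ?_
  rw [setLAverage_eq, ENNReal.mul_rpow_of_nonneg _ _ hp.le, ← ENNReal.rpow_mul,
    one_div_mul_cancel hp.ne', ENNReal.rpow_one]
  refine ENNReal.div_le_of_le_mul ?_
  calc ∫⁻ x in A, (∫⁻ y, K (x - y) * g y) ^ ((n : ℝ) / α)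
      ≤ ∫⁻ x, (∫⁻ y, K (x - y) * g y) ^ ((n : ℝ) / α) := setLIntegral_le_lintegral _ _
    _ ≤ (∫⁻ z, K z) ^ ((n : ℝ) / α) * ∫⁻ y, g y ^ ((n : ℝ) / α) :=
        lintegral_conv_rpow_le hpq hKm hg
    _ ≤ ENNReal.ofReal (n / α * unitBallVolume n * ρ ^ α) ^ ((n : ℝ) / α) *
          ∫⁻ y, g y ^ ((n : ℝ) / α) := by gcongr
    _ = ENNReal.ofReal τ * ENNReal.ofReal (n / α * unitBallVolume n ^
          (1 / ((n : ℝ) / (n - α)))) ^ ((n : ℝ) / α) * ∫⁻ y, g y ^ ((n : ℝ) / α) := by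
        rw [ENNReal.ofReal_rpow_of_nonneg (by positivity) hp.le, kernelMass_rpow hα0 hαn hρ,
          ENNReal.ofReal_mul hτ0.le, ENNReal.ofReal_rpow_of_nonneg (by positivity) hp.le]
    _ ≤ volume A * ENNReal.ofReal (n / α * unitBallVolume n ^
          (1 / ((n : ℝ) / (n - α)))) ^ ((n : ℝ) / α) * ∫⁻ y, g y ^ ((n : ℝ) / α) := by gcongr
    _ = _ := by ring

/-- The potential at a suitable point of a set of volume at least `|B_ρ|`, in terms of the `L^p`
mass carried by a superlevel set `D` of volume `|B_σ|`. -/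
lemma exists_lRiesz_le (hα0 : 0 < α) (hαn : α < n) {Ω : Set (EuclideanSpace ℝ (Fin n))}
    (hΩ : MeasurableSet Ω) {g : EuclideanSpace ℝ (Fin n) → ℝ≥0∞} (hg : Measurable g)
    (hgΩ : ∀ y ∉ Ω, g y = 0) {M ρ σ : ℝ} (hρ : 0 < ρ) (hρσ : ρ ≤ σ) (hσ : σ ≤ 1)
    (hM : 0 ≤ M) {D : Set (EuclideanSpace ℝ (Fin n))} (hD : MeasurableSet D)
    (hDv : volume D = ENNReal.ofReal (unitBallVolume n * σ ^ (n : ℝ))) {m : ℝ≥0∞}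
    (hDge : ∀ y ∈ D, m ≤ g y ^ ((n : ℝ) / α)) (hDle : ∀ y ∉ D, g y ^ ((n : ℝ) / α) ≤ m)
    {A : Set (EuclideanSpace ℝ (Fin n))}
    (hA : ENNReal.ofReal (unitBallVolume n * ρ ^ (n : ℝ)) ≤ volume A) (hA' : volume A ≠ ∞)
    (hAM : ∀ x ∈ A, ENNReal.ofReal n * growthIntegral Ω x ≤ ENNReal.ofReal M) :
    ∃ x ∈ A, lRiesz α g x ≤
      (∫⁻ y in D, g y ^ ((n : ℝ) / α)) ^ (1 / ((n : ℝ) / α)) *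
        ENNReal.ofReal (2 * (n / α * unitBallVolume n ^ (1 / ((n : ℝ) / (n - α)))) +
          (n * unitBallVolume n * Real.log (σ / ρ) + unitBallVolume n) ^
            (1 / ((n : ℝ) / (n - α)))) +
      (∫⁻ y in Dᶜ, g y ^ ((n : ℝ) / α)) ^ (1 / ((n : ℝ) / α)) *
        ENNReal.ofReal ((n * unitBallVolume n * Real.log (1 / σ) + M) ^
          (1 / ((n : ℝ) / (n - α)))) := by
  have hpq := holderConjugate_div hα0 hαn
  have hp := hpq.pos
  have hq := hpq.symm.pos
  have hκ := unitBallVolume_pos n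
  have hn' : (0 : ℝ) < n := by linarith
  have hn : 0 < n := by exact_mod_cast hn'
  have hσ0 : 0 < σ := hρ.trans_le hρσ
  have hball : ∀ (x : EuclideanSpace ℝ (Fin n)) (r : ℝ), MeasurableSet (Metric.ball x r) :=
    fun x r => Metric.isOpen_ball.measurableSet
  set p := (n : ℝ) / α with hpdef
  set q := (n : ℝ) / (n - α) with hqdef
  set c := n / α * unitBallVolume n ^ (1 / q) with hc
  have hc0 : 0 ≤ c := by positivity
  set B := (∫⁻ y in D, g y ^ p) ^ (1 / p) with hB
  -- Only the part from D near x requires this choice of x; the other three parts below are bounded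
  -- at every point of A.
  obtain ⟨x, hxA, hx⟩ := exists_local_le hα0 hαn (hg.indicator hD) hρ hA hA'
  have hDind : ∫⁻ y, D.indicator g y ^ p = ∫⁻ y in D, g y ^ p := by
    rw [← lintegral_indicator hD]
    refine lintegral_congr fun y => ?_
    by_cases hy : y ∈ D <;> simp [hy, hp]
  rw [hDind, ← hB, ← hqdef, ← hc] at hx
  refine ⟨x, hxA, ?_⟩
  have t1 : ∫⁻ y in D ∩ Metric.ball x ρ, rieszKernel α (x - y) * g y ≤ ENNReal.ofReal c * B := by
    refine le_trans (le_of_eq ?_) hx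
    rw [← setLIntegral_indicator hD]
    refine lintegral_congr fun y => ?_
    by_cases hy : y ∈ D <;> simp [hy]
  have hlog1 : 0 ≤ Real.log (σ / ρ) := Real.log_nonneg (by rwa [one_le_div hρ])
  have hlog2 : 0 ≤ Real.log (1 / σ) := Real.log_nonneg (by rwa [one_le_div hσ0])
  have t2 : ∫⁻ y in D \ Metric.ball x ρ, rieszKernel α (x - y) * g y ≤
      B * ENNReal.ofReal ((n * unitBallVolume n * Real.log (σ / ρ) + unitBallVolume n) ^
        (1 / q)) := by
    refine (setLIntegral_diff_ball_le hα0 hαn hg x hD).trans (mul_le_mul_right ?_ _)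
    rw [← ENNReal.ofReal_rpow_of_nonneg (by positivity) (by positivity)]
    refine ENNReal.rpow_le_rpow ?_ (by positivity)
    refine (setLIntegral_max_rpow_le x hn D hρ hρσ hDv.le).trans ?_
    rw [← ENNReal.ofReal_add (by positivity) (by positivity), mul_left_comm,
      ← Real.rpow_add hσ0, neg_add_cancel, Real.rpow_zero, mul_one]
  -- Off D one has g^p ≤ m, and m|D| ≤ ∫_D g^p because g^p ≥ m on D. Thus the values of g off D near
  -- x are paid for by the mass on D, at the same constant c.
  have t3 : ∫⁻ y in Dᶜ ∩ Metric.ball x σ, rieszKernel α (x - y) * g y ≤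
      ENNReal.ofReal c * B := by
    have hle : ∀ y ∈ Dᶜ ∩ Metric.ball x σ, rieszKernel α (x - y) * g y ≤
        rieszKernel α (x - y) * m ^ (1 / p) := by
      intro y hy
      refine mul_le_mul_right ?_ _
      rw [← ENNReal.rpow_le_rpow_iff hp, ← ENNReal.rpow_mul, one_div_mul_cancel hp.ne',
        ENNReal.rpow_one]
      exact hDle y hy.1
    have hmB : m * ENNReal.ofReal (unitBallVolume n * σ ^ (n : ℝ)) ≤ ∫⁻ y in D, g y ^ p := by
      rw [← hDv, ← setLIntegral_const]
      exact setLIntegral_mono' hD hDge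
    calc ∫⁻ y in Dᶜ ∩ Metric.ball x σ, rieszKernel α (x - y) * g y
        ≤ ∫⁻ y in Dᶜ ∩ Metric.ball x σ, rieszKernel α (x - y) * m ^ (1 / p) :=
          setLIntegral_mono' (hD.compl.inter (hball _ _)) hle
      _ ≤ ∫⁻ y in Metric.ball x σ, rieszKernel α (x - y) * m ^ (1 / p) :=
          lintegral_mono_set inter_subset_right
      _ = (∫⁻ y in Metric.ball x σ, rieszKernel α (x - y)) * m ^ (1 / p) :=
          lintegral_mul_const _ (measurable_rieszKernel.comp (measurable_const.sub measurable_id))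
      _ ≤ ENNReal.ofReal (n / α * unitBallVolume n * σ ^ α) * m ^ (1 / p) := by
          gcongr
          exact setLIntegral_ball_rieszKernel_le hα0 hαn x hσ0
      _ ≤ ENNReal.ofReal c * B := by
          rw [← ENNReal.rpow_le_rpow_iff hp, ENNReal.mul_rpow_of_nonneg _ _ hp.le,
            ENNReal.mul_rpow_of_nonneg _ _ hp.le, hB, ← ENNReal.rpow_mul, ← ENNReal.rpow_mul,
            one_div_mul_cancel hp.ne', ENNReal.rpow_one, ENNReal.rpow_one,
            ENNReal.ofReal_rpow_of_nonneg (by positivity) hp.le,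
            ENNReal.ofReal_rpow_of_nonneg (by positivity) hp.le, hpdef,
            kernelMass_rpow hα0 hαn hσ0, ENNReal.ofReal_mul (by positivity), mul_right_comm,
            mul_comm]
          refine mul_le_mul_right ?_ _
          rwa [mul_comm]
  -- Hölder with the L^p norm off D; scales between σ and 1 give the logarithm and larger scales
  -- give M, through the growth condition.
  have t4 : ∫⁻ y in Dᶜ \ Metric.ball x σ, rieszKernel α (x - y) * g y ≤
      (∫⁻ y in Dᶜ, g y ^ p) ^ (1 / p) *
        ENNReal.ofReal ((n * unitBallVolume n * Real.log (1 / σ) + M) ^ (1 / q)) := by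
    have heq : ∫⁻ y in Dᶜ \ Metric.ball x σ, rieszKernel α (x - y) * g y =
        ∫⁻ y in (Dᶜ ∩ Ω) \ Metric.ball x σ, rieszKernel α (x - y) * g y := by
      rw [inter_comm, inter_sdiff_assoc, ← setLIntegral_indicator hΩ]
      refine lintegral_congr fun y => ?_
      by_cases hy : y ∈ Ω
      · simp [hy]
      · simp [hy, hgΩ y hy]
    rw [heq]
    refine (setLIntegral_diff_ball_le hα0 hαn hg x (hD.compl.inter hΩ)).trans
      (mul_le_mul' (ENNReal.rpow_le_rpow (lintegral_mono_set inter_subset_left)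
        (by positivity)) ?_)
    rw [← ENNReal.ofReal_rpow_of_nonneg (by positivity) (by positivity)]
    refine ENNReal.rpow_le_rpow ?_ (by positivity)
    refine (lintegral_mono_set inter_subset_right).trans ?_
    refine (lintegral_max_rpow_le_log x hn _ Measure.restrict_le_self hσ0 hσ).trans ?_
    rw [← growthIntegral_eq x hn Ω, ENNReal.ofReal_add (by positivity) hM]
    gcongr
    exact hAM x hxA
  have hsplit : lRiesz α g x =
      ((∫⁻ y in D ∩ Metric.ball x ρ, rieszKernel α (x - y) * g y) +
        ∫⁻ y in D \ Metric.ball x ρ, rieszKernel α (x - y) * g y) +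
      ((∫⁻ y in Dᶜ ∩ Metric.ball x σ, rieszKernel α (x - y) * g y) +
        ∫⁻ y in Dᶜ \ Metric.ball x σ, rieszKernel α (x - y) * g y) := by
    rw [lintegral_inter_add_sdiff _ _ (hball _ _), lintegral_inter_add_sdiff _ _ (hball _ _),
      lintegral_add_compl _ hD, lRiesz]
  rw [hsplit, ENNReal.ofReal_add (by positivity) (by positivity), two_mul,
    ENNReal.ofReal_add hc0 hc0]
  refine (add_le_add (add_le_add t1 t2) (add_le_add t3 t4)).trans (le_of_eq ?_)
  ring

end Kernel

/-! ### Exponential integrability of the potential on sets of finite volume -/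

section Levels

variable {n : ℕ} {α : ℝ}

/-- Continuity from below; it transfers the volume bound to the supremum that defines a level. -/
lemma measure_lt_le_of_forall_lt {μ : Measure (EuclideanSpace ℝ (Fin n))}
    {U : EuclideanSpace ℝ (Fin n) → ℝ≥0∞} {l : ℝ} {τ : ℝ≥0∞}
    (h : ∀ t, l < t → μ {x | ENNReal.ofReal t < U x} ≤ τ) :
    μ {x | ENNReal.ofReal l < U x} ≤ τ := by
  have hun : {x | ENNReal.ofReal l < U x} =
      ⋃ k : ℕ, {x | ENNReal.ofReal (l + 1 / ((k : ℝ) + 1)) < U x} := by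
    ext x
    simp only [mem_ofPred_eq, mem_iUnion]
    constructor
    · intro hx
      have ht : Tendsto (fun k : ℕ => ENNReal.ofReal (l + 1 / ((k : ℝ) + 1))) atTop
          (𝓝 (ENNReal.ofReal l)) := by
        refine ENNReal.tendsto_ofReal ?_
        simpa using tendsto_const_nhds.add (tendsto_one_div_add_atTop_nhds_zero_nat (𝕜 := ℝ))
      exact (ht.eventually (gt_mem_nhds hx)).exists
    · rintro ⟨k, hk⟩
      refine lt_of_le_of_lt (ENNReal.ofReal_le_ofReal ?_) hk
      have : (0 : ℝ) ≤ 1 / ((k : ℝ) + 1) := by positivity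
      linarith
  have hmono : Monotone fun k : ℕ => {x | ENNReal.ofReal (l + 1 / ((k : ℝ) + 1)) < U x} := by
    intro i j hij x hx
    refine lt_of_le_of_lt (ENNReal.ofReal_le_ofReal ?_) hx
    have := Nat.one_div_le_one_div (α := ℝ) hij
    linarith
  rw [hun]
  refine le_of_tendsto' (tendsto_measure_iUnion_atTop hmono) fun k => h _ ?_
  have : (0 : ℝ) < 1 / ((k : ℝ) + 1) := by positivity
  linarith

/-- The levels `l j` above which the potential lives on a set of volume at most `|B₁| e^{-j}`
satisfy the hypothesis of the Adams–Garsia lemma. -/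
lemma exists_levels (hα0 : 0 < α) (hαn : α < n) {M : ℝ} (hM : 0 ≤ M) :
    ∃ K : ℝ, 0 < K ∧ ∀ Ω : Set (EuclideanSpace ℝ (Fin n)), MeasurableSet Ω →
      ∀ g : EuclideanSpace ℝ (Fin n) → ℝ≥0∞, Measurable g → (∀ y ∉ Ω, g y = 0) →
      ∫⁻ y, g y ^ ((n : ℝ) / α) ≤ 1 →
      ∀ E : Set (EuclideanSpace ℝ (Fin n)), MeasurableSet E → volume E ≠ ∞ →
      (∀ x ∈ E, ENNReal.ofReal n * growthIntegral Ω x ≤ ENNReal.ofReal M) →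
      ∃ l : ℕ → ℝ, (∀ j, 0 ≤ l j) ∧
        (∀ j : ℕ, (volume.restrict E) {x | ENNReal.ofReal (l j) < lRiesz α g x} ≤
          ENNReal.ofReal (unitBallVolume n * Real.exp (-j))) ∧
        ∑' j : ℕ, ENNReal.ofReal
          (Real.exp (1 / unitBallVolume n * l j ^ ((n : ℝ) / (n - α)) - j)) ≤ ENNReal.ofReal K := by
  have hpq := holderConjugate_div hα0 hαn
  have hp := hpq.pos
  have hq := hpq.symm.pos
  have hκ := unitBallVolume_pos n
  have hn' : (0 : ℝ) < n := by linarith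
  have hn : 0 < n := by exact_mod_cast hn'
  set κ := unitBallVolume n with hκdef
  set p := (n : ℝ) / α with hpdef
  set q := (n : ℝ) / (n - α) with hqdef
  obtain ⟨K, hK0, hK⟩ := GarsiaBound.exists_tsum_le hpq (C := 2 * (n / α) + 1) (M := M / κ)
    (by positivity) (by positivity)
  refine ⟨K, hK0, fun Ω hΩ g hg hgΩ hg1 E hE hEfin hEM => ?_⟩
  have hgp : Measurable fun y => g y ^ p := hg.pow_const p
  have hgfin : ∫⁻ y, g y ^ p ≠ ∞ := (hg1.trans_lt ENNReal.one_lt_top).ne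
  -- Chosen so that |B_{σ i}| = κe^{-i}.
  set σ : ℕ → ℝ := fun i => Real.exp (-(i / n)) with hσ
  have hσ0 : ∀ i, 0 < σ i := fun i => Real.exp_pos _
  have hσ1 : ∀ i, σ i ≤ 1 := fun i => Real.exp_le_one_iff.2 (neg_nonpos.2 (by positivity))
  have hσn : ∀ i, σ i ^ (n : ℝ) = Real.exp (-i) := by
    intro i
    rw [hσ, ← Real.exp_mul, neg_mul, div_mul_cancel₀ _ hn'.ne']
  choose m D hDm hDv hDge hDle using fun i : ℕ =>
    exists_superlevel_volume_eq hn hgp hgfin (τ := κ * σ i ^ (n : ℝ))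
      (mul_pos hκ (Real.rpow_pos_of_pos (hσ0 i) _))
  set B : ℕ → ℝ≥0∞ := fun i => (∫⁻ y in D i, g y ^ p) ^ (1 / p) with hB
  have hBp : ∀ i, B i ^ p = ∫⁻ y in D i, g y ^ p := by
    intro i
    rw [hB, ← ENNReal.rpow_mul, one_div_mul_cancel hp.ne', ENNReal.rpow_one]
  have hB1 : ∀ i, B i ≤ 1 := by
    intro i
    rw [← ENNReal.rpow_le_rpow_iff hp, ENNReal.one_rpow, hBp]
    exact (setLIntegral_le_lintegral _ _).trans hg1
  have hBtop : ∀ i, B i ≠ ∞ := fun i => ((hB1 i).trans_lt ENNReal.one_lt_top).ne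
  set b : ℕ → ℝ := fun i => (B i).toReal with hb
  have hb0 : ∀ i, 0 ≤ b i := fun i => ENNReal.toReal_nonneg
  have hb1 : ∀ i, b i ≤ 1 := fun i =>
    ENNReal.toReal_le_of_le_ofReal zero_le_one (by simpa using hB1 i)
  have hBb : ∀ i, B i = ENNReal.ofReal (b i) := fun i => (ENNReal.ofReal_toReal (hBtop i)).symm
  have hbp1 : ∀ i, 0 ≤ 1 - b i ^ p := fun i =>
    sub_nonneg.2 (Real.rpow_le_one (hb0 i) (hb1 i) hp.le)
  have hcompl : ∀ i, (∫⁻ y in (D i)ᶜ, g y ^ p) ^ (1 / p) ≤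
      ENNReal.ofReal ((1 - b i ^ p) ^ (1 / p)) := by
    intro i
    rw [← ENNReal.ofReal_rpow_of_nonneg (hbp1 i) (by positivity)]
    refine ENNReal.rpow_le_rpow ?_ (by positivity)
    rw [ENNReal.ofReal_sub _ (Real.rpow_nonneg (hb0 i) _), ENNReal.ofReal_one,
      ← ENNReal.ofReal_rpow_of_nonneg (hb0 i) hp.le, ← hBb, hBp]
    refine ENNReal.le_sub_of_add_le_left
      (by rw [← hBp]; exact ENNReal.rpow_ne_top_of_nonneg hp.le (hBtop i)) ?_
    rw [lintegral_add_compl _ (hDm i)]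
    exact hg1
  -- The level l j will be the supremum of A j, which is 0 when A j is empty. A bound for every t in
  -- A j is obtained at one point of {U > t} ∩ E.
  set A : ℕ → Set ℝ := fun j => {t | 0 ≤ t ∧ ENNReal.ofReal (κ * Real.exp (-j)) ≤
    (volume.restrict E) {x | ENNReal.ofReal t < lRiesz α g x}} with hA
  have hUm : Measurable (lRiesz α g) := measurable_lRiesz hg
  have hset : ∀ t, MeasurableSet {x | ENNReal.ofReal t < lRiesz α g x} := fun t =>
    measurableSet_lt measurable_const hUm
  have hbound : ∀ i j : ℕ, i ≤ j → ∀ t ∈ A j, t ≤ κ ^ (1 / q) *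
      (b i * ((2 * (n / α) + 1) * ((j : ℝ) - i + 1) ^ (1 / q)) +
        (1 - b i ^ p) ^ (1 / p) * ((i : ℝ) + M / κ) ^ (1 / q)) := by
    rintro i j hij t ⟨ht0, ht⟩
    have hij' : (i : ℝ) ≤ j := by exact_mod_cast hij
    rw [Measure.restrict_apply (hset t)] at ht
    obtain ⟨x, hxA, hx⟩ := exists_lRiesz_le hα0 hαn hΩ hg hgΩ (hσ0 j)
      (show σ j ≤ σ i from Real.exp_le_exp.2 (neg_le_neg (by gcongr))) (hσ1 i) hM (hDm i) (hDv i)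
      (hDge i) (hDle i) (A := {x | ENNReal.ofReal t < lRiesz α g x} ∩ E)
      (by rw [hσn]; exact ht) ((measure_mono inter_subset_right).trans_lt hEfin.lt_top).ne
      (fun x hx => hEM x hx.2)
    have h1 : Real.log (σ i / σ j) = ((j : ℝ) - i) / n := by
      rw [hσ, ← Real.exp_sub, Real.log_exp]
      ring
    have h2 : Real.log (1 / σ i) = i / n := by
      rw [hσ, one_div, ← Real.exp_neg, Real.log_exp, neg_neg]
    have h3 : (n * κ * (((j : ℝ) - i) / n) + κ) = κ * ((j : ℝ) - i + 1) := by
      field_simp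
    have h4 : (n * κ * ((i : ℝ) / n) + M) = κ * (i + M / κ) := by
      field_simp
    have hji : 0 ≤ (j : ℝ) - i := by linarith
    rw [h1, h2, h3, h4, Real.mul_rpow hκ.le (by positivity), Real.mul_rpow hκ.le (by positivity)]
      at hx
    have hlt := (hxA.1 : ENNReal.ofReal t < _).le.trans (hx.trans (add_le_add
      (mul_le_mul_left (hBb i).le _) (mul_le_mul_left (hcompl i) _)))
    have hbi := hb0 i
    have hbpi := hbp1 i
    rw [← ENNReal.ofReal_mul (hb0 i), ← ENNReal.ofReal_mul (by positivity),
      ← ENNReal.ofReal_add (by positivity) (by positivity),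
      ENNReal.ofReal_le_ofReal_iff (by positivity)] at hlt
    have h5 : (1 : ℝ) ≤ ((j : ℝ) - i + 1) ^ (1 / q) :=
      Real.one_le_rpow (by linarith) (by positivity)
    simp only [← hκdef, ← hqdef] at hlt
    refine hlt.trans ?_
    -- The two local constants are absorbed into (j - i + 1)^{1/q} ≥ 1; this is the source of C =
    -- 2n/α + 1.
    have h6 : b i * (2 * (n / α * κ ^ (1 / q))) ≤
        b i * (2 * (n / α * κ ^ (1 / q))) * ((j : ℝ) - i + 1) ^ (1 / q) :=
      le_mul_of_one_le_right (by positivity) h5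
    linarith
  set l : ℕ → ℝ := fun j => sSup (A j) with hl
  have hl0 : ∀ j, 0 ≤ l j := fun j => Real.sSup_nonneg fun t ht => ht.1
  have hκq : 0 < κ ^ (1 / q) := Real.rpow_pos_of_pos hκ _
  refine ⟨l, hl0, fun j => ?_, ?_⟩
  · refine measure_lt_le_of_forall_lt fun t ht => ?_
    by_contra hcon
    push Not at hcon
    exact absurd (le_csSup ⟨_, hbound j j le_rfl⟩ ⟨(hl0 j).trans ht.le, hcon.le⟩) (not_le.2 ht)
  · have hv := hK b (fun j => l j / κ ^ (1 / q)) hb0 hb1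
      (fun j => div_nonneg (hl0 j) hκq.le) (fun i j hij => by
        rw [div_le_iff₀' hκq]
        refine Real.sSup_le (hbound i j hij) ?_
        have hij' : (i : ℝ) ≤ j := by exact_mod_cast hij
        have hji : 0 ≤ (j : ℝ) - i := by linarith
        have hbi := hb0 i
        have hbpi := hbp1 i
        positivity)
    refine le_trans (le_of_eq (tsum_congr fun j => ?_)) hv
    rw [Real.div_rpow (hl0 j) hκq.le, ← Real.rpow_mul hκ.le, one_div_mul_cancel hq.ne',
      Real.rpow_one, one_div_mul_eq_div]

/-- The sharp exponential estimate on sets of finite volume, for nonnegative functions. -/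
lemma exists_adams_bound (hα0 : 0 < α) (hαn : α < n) {M : ℝ} (hM : 0 ≤ M) :
    ∃ K : ℝ, 0 < K ∧ ∀ Ω : Set (EuclideanSpace ℝ (Fin n)), MeasurableSet Ω →
      ∀ g : EuclideanSpace ℝ (Fin n) → ℝ≥0∞, Measurable g → (∀ y ∉ Ω, g y = 0) →
      ∫⁻ y, g y ^ ((n : ℝ) / α) ≤ 1 →
      ∀ E : Set (EuclideanSpace ℝ (Fin n)), MeasurableSet E → volume E ≠ ∞ →
      (∀ x ∈ E, ENNReal.ofReal n * growthIntegral Ω x ≤ ENNReal.ofReal M) →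
      (∀ᵐ x ∂volume.restrict E, lRiesz α g x ≠ ∞) ∧
      ∀ h : EuclideanSpace ℝ (Fin n) → ℝ, (∀ x, ‖h x‖ₑ ≤ lRiesz α g x) →
        ∫⁻ x in E, ENNReal.ofReal
          (Real.exp (1 / unitBallVolume n * |h x| ^ ((n : ℝ) / (n - α)))) ≤
            ENNReal.ofReal K * (1 + volume E) := by
  obtain ⟨K, hK0, hK⟩ := exists_levels hα0 hαn hM
  have hκ := unitBallVolume_pos n
  have hq := (holderConjugate_div hα0 hαn).symm.pos
  set κ := unitBallVolume n with hκdef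
  set q := (n : ℝ) / (n - α) with hqdef
  refine ⟨K + κ * Real.exp 1 * K, by positivity,
    fun Ω hΩ g hg hgΩ hg1 E hE hEfin hEM => ?_⟩
  obtain ⟨l, hl0, hlv, hls⟩ := hK Ω hΩ g hg hgΩ hg1 E hE hEfin hEM
  set e : ℕ → ℝ≥0∞ := fun j => ENNReal.ofReal (Real.exp (1 / κ * l j ^ q)) with he
  set S : ℕ → Set (EuclideanSpace ℝ (Fin n)) :=
    fun j => {x | ENNReal.ofReal (l j) < lRiesz α g x} with hS
  have hSm : ∀ j, MeasurableSet (S j) := fun j =>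
    measurableSet_lt measurable_const (measurable_lRiesz hg)
  have hnull : ∀ᵐ x ∂volume.restrict E, ∃ j, x ∉ S j := by
    have h0 : (volume.restrict E) (⋂ j, S j) = 0 := by
      have ht : Tendsto (fun j : ℕ => ENNReal.ofReal (κ * Real.exp (-j))) atTop (𝓝 0) := by
        rw [← ENNReal.ofReal_zero]
        refine ENNReal.tendsto_ofReal ?_
        have := (Real.tendsto_exp_neg_atTop_nhds_zero.comp
          (tendsto_natCast_atTop_atTop (R := ℝ))).const_mul κ
        simpa using this
      exact le_antisymm (ge_of_tendsto' ht fun j =>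
        (measure_mono (iInter_subset _ j)).trans (hlv j)) zero_le
    rw [ae_iff]
    refine measure_mono_null (fun x hx => ?_) h0
    simpa using hx
  refine ⟨hnull.mono fun x ⟨j, hj⟩ => ?_, fun h hh => ?_⟩
  · exact ((not_lt.1 hj).trans_lt ENNReal.ofReal_lt_top).ne
  -- At the first index k with x outside S k one has |h x| ≤ l k; if k = j + 1, then x still belongs
  -- to S j, so the term of index j dominates.
  have hpt : ∀ᵐ x ∂volume.restrict E, ENNReal.ofReal (Real.exp (1 / κ * |h x| ^ q)) ≤
      e 0 + ∑' j : ℕ, e (j + 1) * (S j).indicator 1 x := by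
    filter_upwards [hnull] with x hx
    classical
    have hle : ∀ j, x ∉ S j → ENNReal.ofReal (Real.exp (1 / κ * |h x| ^ q)) ≤ e j := by
      intro j hj
      have h1 : ENNReal.ofReal |h x| ≤ ENNReal.ofReal (l j) := by
        rw [← Real.norm_eq_abs, ofReal_norm]
        exact (hh x).trans (not_lt.1 hj)
      rw [ENNReal.ofReal_le_ofReal_iff (hl0 j)] at h1
      refine ENNReal.ofReal_le_ofReal (Real.exp_le_exp.2 ?_)
      gcongr
    rcases Nat.eq_zero_or_pos (Nat.find hx) with h0 | h0
    · refine le_trans (hle 0 ?_) le_self_add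
      have := Nat.find_spec hx
      rwa [h0] at this
    · obtain ⟨j, hj⟩ := Nat.exists_eq_succ_of_ne_zero h0.ne'
      have h1 : x ∉ S (j + 1) := by
        have := Nat.find_spec hx
        rwa [hj] at this
      have h2 : x ∈ S j := by
        have := Nat.find_min hx (m := j) (by omega)
        simpa using this
      refine le_add_left (le_trans ?_ (ENNReal.le_tsum j))
      rw [indicator_of_mem h2, Pi.one_apply, mul_one]
      exact hle _ h1
  have hterm : ∀ j : ℕ, ENNReal.ofReal (Real.exp (1 / κ * l j ^ q - j)) =
      e j * ENNReal.ofReal (Real.exp (-j)) := by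
    intro j
    rw [he, ← ENNReal.ofReal_mul (Real.exp_nonneg _), ← Real.exp_add, sub_eq_add_neg]
  have he0 : e 0 ≤ ENNReal.ofReal K := by
    refine le_trans ?_ ((ENNReal.le_tsum 0).trans hls)
    rw [hterm]
    simp
  calc ∫⁻ x in E, ENNReal.ofReal (Real.exp (1 / κ * |h x| ^ q))
      ≤ ∫⁻ x in E, (e 0 + ∑' j : ℕ, e (j + 1) * (S j).indicator 1 x) := lintegral_mono_ae hpt
    _ = e 0 * volume E + ∑' j : ℕ, e (j + 1) * (volume.restrict E) (S j) := by
        rw [lintegral_add_left measurable_const, setLIntegral_const, lintegral_tsum]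
        · congr 1
          refine tsum_congr fun j => ?_
          rw [lintegral_const_mul _ (measurable_one.indicator (hSm j)),
            lintegral_indicator_one (hSm j)]
        · exact fun j => ((measurable_one.indicator (hSm j)).const_mul _).aemeasurable
    -- The exponential at level j + 1 is paired with the volume κe^{-j} at level j; the shift costs
    -- a factor e.
    _ ≤ ENNReal.ofReal K * volume E + ∑' j : ℕ, ENNReal.ofReal (κ * Real.exp 1) *
          ENNReal.ofReal (Real.exp (1 / κ * l (j + 1) ^ q - (j + 1 : ℕ))) := by
        refine add_le_add (mul_le_mul_left he0 _) (ENNReal.tsum_le_tsum fun j => ?_)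
        rw [hterm, mul_left_comm, ← ENNReal.ofReal_mul (by positivity), mul_assoc,
          ← Real.exp_add]
        refine mul_le_mul_right ((hlv j).trans (le_of_eq ?_)) _
        push_cast
        ring_nf
    _ ≤ ENNReal.ofReal K * volume E + ENNReal.ofReal (κ * Real.exp 1) * ENNReal.ofReal K := by
        rw [ENNReal.tsum_mul_left]
        gcongr
        exact (ENNReal.tsum_comp_le_tsum_of_injective (add_left_injective 1)
          (fun j : ℕ => ENNReal.ofReal (Real.exp (1 / κ * l j ^ q - j)))).trans hls
    _ ≤ ENNReal.ofReal (K + κ * Real.exp 1 * K) * (1 + volume E) := by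
        rw [ENNReal.ofReal_add (by positivity) (by positivity),
          ENNReal.ofReal_mul (p := κ * Real.exp 1) (by positivity), mul_add, mul_one, add_mul,
          add_comm]
        gcongr
        · exact le_add_self
        · exact le_self_add

end Levels

/-! ### The Adams inequality and its regularized form -/

section Adams

variable {n : ℕ} {α : ℝ} {Ω : Set (EuclideanSpace ℝ (Fin n))}

lemma growthIntegral_congr {Ω' : Set (EuclideanSpace ℝ (Fin n))} (h : Ω' =ᵐ[volume] Ω) :
    growthIntegral Ω' = growthIntegral Ω := by
  funext x
  unfold growthIntegral growth
  refine lintegral_congr fun r => ?_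
  rw [measure_congr (h.inter (ae_eq_refl (Metric.ball x r)))]

/-- A measurable, everywhere supported representative of the absolute value of a function
in `L^p(Ω)`. -/
lemma MemLpOn.exists_representative {Ω' : Set (EuclideanSpace ℝ (Fin n))}
    (hΩ' : MeasurableSet Ω') (h : Ω' =ᵐ[volume] Ω) {p : ℝ}
    {f : EuclideanSpace ℝ (Fin n) → ℝ} (hf : MemLpOn Ω p f) :
    ∃ g : EuclideanSpace ℝ (Fin n) → ℝ≥0∞, Measurable g ∧ (∀ y ∉ Ω', g y = 0) ∧
      g =ᵐ[volume] fun y => ‖f y‖ₑ := by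
  have hm : AEStronglyMeasurable f volume := hf.1.1
  refine ⟨Ω'.indicator fun y => ‖hm.mk f y‖ₑ,
    (hm.stronglyMeasurable_mk.measurable.enorm).indicator hΩ',
    fun y hy => indicator_of_notMem hy _, ?_⟩
  filter_upwards [hm.ae_eq_mk, hf.2, h.mem_iff] with y h1 h2 h3
  by_cases hy : y ∈ Ω'
  · rw [indicator_of_mem hy, h1]
  · rw [indicator_of_notMem hy, h2 (fun h => hy (h3.2 h)), enorm_zero]

lemma enorm_kernel_mul (f : EuclideanSpace ℝ (Fin n) → ℝ) (x y : EuclideanSpace ℝ (Fin n)) :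
    ‖‖x - y‖ ^ (α - (n : ℝ)) * f y‖ₑ = rieszKernel α (x - y) * ‖f y‖ₑ := by
  rw [enorm_mul, rieszKernel, Real.enorm_of_nonneg (Real.rpow_nonneg (norm_nonneg _) _)]

lemma lRiesz_congr_enorm {f : EuclideanSpace ℝ (Fin n) → ℝ}
    {g : EuclideanSpace ℝ (Fin n) → ℝ≥0∞} (hg : g =ᵐ[volume] fun y => ‖f y‖ₑ)
    (x : EuclideanSpace ℝ (Fin n)) :
    lRiesz α g x = ∫⁻ y, ‖‖x - y‖ ^ (α - (n : ℝ)) * f y‖ₑ := by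
  simp_rw [enorm_kernel_mul]
  exact lintegral_congr_ae (hg.mono fun y hy => by simp only [hy])

lemma enorm_rieszPotential_le {f : EuclideanSpace ℝ (Fin n) → ℝ}
    {g : EuclideanSpace ℝ (Fin n) → ℝ≥0∞} (hg : g =ᵐ[volume] fun y => ‖f y‖ₑ)
    (x : EuclideanSpace ℝ (Fin n)) : ‖rieszPotential α f x‖ₑ ≤ lRiesz α g x := by
  rw [lRiesz_congr_enorm hg]
  exact enorm_integral_le_lintegral_enorm _

lemma integrable_kernel_mul_of_ne_top {f : EuclideanSpace ℝ (Fin n) → ℝ}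
    (hf : AEStronglyMeasurable f volume) {g : EuclideanSpace ℝ (Fin n) → ℝ≥0∞}
    (hg : g =ᵐ[volume] fun y => ‖f y‖ₑ) {x : EuclideanSpace ℝ (Fin n)}
    (hx : lRiesz α g x ≠ ∞) : Integrable (fun y => ‖x - y‖ ^ (α - (n : ℝ)) * f y) := by
  refine ⟨AEStronglyMeasurable.mul ?_ hf, ?_⟩
  · exact (by fun_prop : Measurable fun y : EuclideanSpace ℝ (Fin n) =>
      ‖x - y‖ ^ (α - (n : ℝ))).aestronglyMeasurable
  · rw [hasFiniteIntegral_iff_enorm, ← lRiesz_congr_enorm hg]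
    exact hx.lt_top

lemma aestronglyMeasurable_rieszPotential {f : EuclideanSpace ℝ (Fin n) → ℝ}
    (hf : AEStronglyMeasurable f volume) : AEStronglyMeasurable (rieszPotential α f) volume := by
  have h : AEStronglyMeasurable
      (fun z : EuclideanSpace ℝ (Fin n) × EuclideanSpace ℝ (Fin n) =>
        ‖z.1 - z.2‖ ^ (α - (n : ℝ)) * f z.2) (volume.prod volume) := by
    refine AEStronglyMeasurable.mul ?_ hf.comp_snd
    exact (by fun_prop : Measurable
      fun z : EuclideanSpace ℝ (Fin n) × EuclideanSpace ℝ (Fin n) =>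
        ‖z.1 - z.2‖ ^ (α - (n : ℝ))).aestronglyMeasurable
  exact h.integral_prod_right'

lemma lintegral_rpow_eq_of_ae_eq {p : ℝ} (hp : 0 < p) {f : EuclideanSpace ℝ (Fin n) → ℝ}
    {g : EuclideanSpace ℝ (Fin n) → ℝ≥0∞} (hg : g =ᵐ[volume] fun y => ‖f y‖ₑ) :
    ∫⁻ y, g y ^ p = eLpNorm f (ENNReal.ofReal p) volume ^ p := by
  rw [eLpNorm_eq_lintegral_rpow_enorm_toReal (ENNReal.ofReal_pos.2 hp).ne' ENNReal.ofReal_ne_top,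
    ENNReal.toReal_ofReal hp.le, ← ENNReal.rpow_mul, one_div_mul_cancel hp.ne', ENNReal.rpow_one]
  exact lintegral_congr_ae (hg.mono fun y hy => by simp only [hy])

/-- In a subcritical set almost every point satisfies the growth bound uniformly. -/
lemma IsRieszSubcritical.exists_ae_le (h : IsRieszSubcritical Ω) :
    ∃ M : ℝ, 0 ≤ M ∧ ∀ᵐ x ∂(volume.restrict Ω),
      ENNReal.ofReal n * growthIntegral Ω x ≤ ENNReal.ofReal M := by
  refine ⟨(ENNReal.ofReal n * essSup (growthIntegral Ω) (volume.restrict Ω)).toReal,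
    ENNReal.toReal_nonneg, ?_⟩
  rw [ENNReal.ofReal_toReal (ENNReal.mul_ne_top ENNReal.ofReal_ne_top h.ne)]
  filter_upwards [ENNReal.ae_le_essSup (growthIntegral Ω)] with x hx
  gcongr

/-- The level estimate selects individual points of E, so the almost everywhere growth bound has to
hold everywhere on a measurable version of E. -/
lemma exists_good_subset {E : Set (EuclideanSpace ℝ (Fin n))} (hEΩ : E ⊆ Ω)
    (hE : NullMeasurableSet E volume) {P : EuclideanSpace ℝ (Fin n) → Prop}
    (hP : ∀ᵐ x ∂(volume.restrict Ω), P x) :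
    ∃ E' ⊆ E, MeasurableSet E' ∧ E' =ᵐ[volume] E ∧ ∀ x ∈ E', P x := by
  have hPE : ∀ᵐ x ∂(volume.restrict E), P x := ae_mono (Measure.restrict_mono_set _ hEΩ) hP
  have h1 : (E ∩ {x | P x} : Set _) =ᵐ[volume] E := by
    rw [ae_restrict_iff'₀ hE] at hPE
    filter_upwards [hPE] with x hx
    exact propext ⟨fun h => h.1, fun h => ⟨h, hx h⟩⟩
  obtain ⟨E', hE'sub, hE'm, hE'⟩ := (hE.congr h1.symm).exists_measurable_subset_ae_eq
  exact ⟨E', hE'sub.trans inter_subset_left, hE'm, hE'.trans h1, fun x hx => (hE'sub hx).2⟩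

lemma ae_integrable_of_subcritical (hα0 : 0 < α) (hαn : α < n) (hΩ : NullMeasurableSet Ω volume)
    (h : IsRieszSubcritical Ω) {f : EuclideanSpace ℝ (Fin n) → ℝ}
    (hf : MemLpOn Ω (n / α) f) :
    ∀ᵐ x ∂(volume.restrict Ω), Integrable (fun y => ‖x - y‖ ^ (α - (n : ℝ)) * f y) := by
  have hp := (holderConjugate_div hα0 hαn).pos
  obtain ⟨Ω', hΩ'sub, hΩ'm, hΩ'⟩ := hΩ.exists_measurable_subset_ae_eq
  obtain ⟨M, hM, hMΩ⟩ := h.exists_ae_le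
  obtain ⟨K, -, hK⟩ := exists_adams_bound hα0 hαn hM
  obtain ⟨g, hgm, hgΩ, hgf⟩ := hf.exists_representative hΩ'm hΩ'
  set N := ∫⁻ y, g y ^ ((n : ℝ) / α) with hN
  have hNtop : N ≠ ∞ := by
    rw [hN, lintegral_rpow_eq_of_ae_eq hp hgf]
    exact ENNReal.rpow_ne_top_of_nonneg hp.le hf.1.2.ne
  have hN1 : N + 1 ≠ ∞ := ENNReal.add_ne_top.2 ⟨hNtop, ENNReal.one_ne_top⟩
  have hN0 : N + 1 ≠ 0 := by simp
  -- Scaling into the unit ball; N + 1 rather than N avoids dividing by zero when f vanishes.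
  set c := (N + 1)⁻¹ ^ (1 / ((n : ℝ) / α)) with hc
  have hc0 : c ≠ 0 :=
    (ENNReal.rpow_pos (ENNReal.inv_pos.2 hN1) (ENNReal.inv_ne_top.2 hN0)).ne'
  have hg1 : ∫⁻ y, (c * g y) ^ ((n : ℝ) / α) ≤ 1 := by
    simp_rw [ENNReal.mul_rpow_of_nonneg _ _ hp.le]
    rw [lintegral_const_mul _ (hgm.pow_const _), ← hN, hc, ← ENNReal.rpow_mul,
      one_div_mul_cancel hp.ne', ENNReal.rpow_one]
    calc (N + 1)⁻¹ * N ≤ (N + 1)⁻¹ * (N + 1) := by gcongr; exact le_self_add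
      _ = 1 := ENNReal.inv_mul_cancel hN0 hN1
  have hcover : Ω = ⋃ k : ℕ, Ω ∩ Metric.ball 0 (k : ℝ) := by
    rw [← inter_iUnion, Metric.iUnion_ball_nat, inter_univ]
  rw [hcover, ae_restrict_iUnion_iff]
  intro k
  obtain ⟨E, hEsub, hEm, hE, hEM⟩ := exists_good_subset (inter_subset_left)
    (hΩ.inter Metric.isOpen_ball.measurableSet.nullMeasurableSet :
      NullMeasurableSet (Ω ∩ Metric.ball 0 (k : ℝ)) volume) hMΩ
  rw [← growthIntegral_congr hΩ'] at hEM
  have hEfin : volume E ≠ ∞ :=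
    ((measure_mono (hEsub.trans inter_subset_right)).trans_lt measure_ball_lt_top).ne
  rw [← Measure.restrict_congr_set hE]
  filter_upwards [(hK Ω' hΩ'm (fun y => c * g y) (hgm.const_mul c)
    (fun y hy => by rw [hgΩ y hy, mul_zero]) hg1 E hEm hEfin hEM).1] with x hx
  refine integrable_kernel_mul_of_ne_top hf.1.1 hgf fun htop => hx ?_
  have : lRiesz α (fun y => c * g y) x = c * lRiesz α g x := by
    unfold lRiesz
    rw [← lintegral_const_mul _ (by fun_prop)]
    refine lintegral_congr fun y => ?_
    ring
  rw [this, htop, ENNReal.mul_top hc0]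

lemma exists_adamsBound_of_subcritical (hα0 : 0 < α) (hαn : α < n)
    (hΩ : NullMeasurableSet Ω volume) (h : IsRieszSubcritical Ω) :
    ∃ C : ℝ, 0 < C ∧ ∀ E : Set (EuclideanSpace ℝ (Fin n)), E ⊆ Ω → NullMeasurableSet E volume →
      volume E < ∞ → AdamsBound Ω α (1 / unitBallVolume n) E C := by
  have hp := (holderConjugate_div hα0 hαn).pos
  obtain ⟨Ω', hΩ'sub, hΩ'm, hΩ'⟩ := hΩ.exists_measurable_subset_ae_eq
  obtain ⟨M, hM, hMΩ⟩ := h.exists_ae_le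
  obtain ⟨K, hK0, hK⟩ := exists_adams_bound hα0 hαn hM
  refine ⟨K, hK0, fun E hEΩ hEn hEfin f hf hf1 => ?_⟩
  obtain ⟨g, hgm, hgΩ, hgf⟩ := hf.exists_representative hΩ'm hΩ'
  obtain ⟨E', hE'sub, hE'm, hE', hE'M⟩ := exists_good_subset hEΩ hEn hMΩ
  rw [← growthIntegral_congr hΩ'] at hE'M
  have hg1 : ∫⁻ y, g y ^ ((n : ℝ) / α) ≤ 1 := by
    rw [lintegral_rpow_eq_of_ae_eq hp hgf]
    exact ENNReal.rpow_le_one hf1 hp.le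
  rw [← Measure.restrict_congr_set hE', ← measure_congr hE']
  exact (hK Ω' hΩ'm g hgm hgΩ hg1 E' hE'm ((measure_congr hE').trans_lt hEfin).ne hE'M).2 _
    (enorm_rieszPotential_le hgf)

lemma regExp_le_exp (m : ℕ) {t : ℝ} (ht : 0 ≤ t) : regExp m t ≤ Real.exp t := by
  unfold regExp
  have : 0 ≤ ∑ k ∈ Finset.range (m + 1), t ^ k / (k.factorial : ℝ) :=
    Finset.sum_nonneg fun k _ => by positivity
  linarith

lemma regExp_le_pow (m : ℕ) {t : ℝ} (ht : 0 ≤ t) :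
    regExp m t ≤ t ^ (m + 1) * Real.exp t := by
  have h := Complex.norm_exp_sub_sum_le_norm_mul_exp (t : ℂ) (m + 1)
  have h1 : Complex.exp t - ∑ k ∈ Finset.range (m + 1), (t : ℂ) ^ k / (k.factorial : ℂ)
      = ((regExp m t : ℝ) : ℂ) := by
    unfold regExp
    push_cast
    rfl
  rw [h1, Complex.norm_real, Complex.norm_real, Real.norm_of_nonneg ht] at h
  exact (le_abs_self _).trans h

/-- Where |I_α f| ≥ 1 the volume is at most ‖I_α f‖_p^p, so (1) applies there. Elsewhere the
truncated exponential is of order t^{m+1} with t = |I_α f|^q/κ, which is controlled by |I_α f|^p. -/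
lemma exists_regAdamsBound (hα0 : 0 < α) (hαn : α < n) (hΩ : NullMeasurableSet Ω volume)
    {C : ℝ} (hC : 0 < C)
    (h : ∀ E : Set (EuclideanSpace ℝ (Fin n)), E ⊆ Ω → NullMeasurableSet E volume →
      volume E < ∞ → AdamsBound Ω α (1 / unitBallVolume n) E C) :
    ∃ C' : ℝ, C ≤ C' ∧ RegAdamsBound Ω α (1 / unitBallVolume n) C' := by
  have hpq := holderConjugate_div hα0 hαn
  have hp := hpq.pos
  have hq := hpq.symm.pos
  have hκ := unitBallVolume_pos n
  set κ := unitBallVolume n with hκdef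
  set m := ⌈(n : ℝ) / α - 2⌉₊ with hm
  set G := (1 / κ) ^ (m + 1) * Real.exp (1 / κ) with hG
  have hG0 : 0 < G := by positivity
  refine ⟨C + G, by linarith, fun f hf hf1 => ?_⟩
  set u := rieszPotential α f with hu
  have hum : AEStronglyMeasurable u volume := aestronglyMeasurable_rieszPotential hf.1.1
  set N := eLpNorm u (ENNReal.ofReal (n / α)) (volume.restrict Ω) ^ ((n : ℝ) / α) with hN
  have hNint : N = ∫⁻ x in Ω, ‖u x‖ₑ ^ ((n : ℝ) / α) := by
    rw [hN, eLpNorm_eq_lintegral_rpow_enorm_toReal (ENNReal.ofReal_pos.2 hp).ne'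
      ENNReal.ofReal_ne_top, ENNReal.toReal_ofReal hp.le, ← ENNReal.rpow_mul,
      one_div_mul_cancel hp.ne', ENNReal.rpow_one]
  rcases eq_or_ne N ∞ with hNtop | hNtop
  · rw [hNtop, add_top, ENNReal.mul_top (ENNReal.ofReal_pos.2 (by linarith)).ne']
    exact le_top
  set F : Set (EuclideanSpace ℝ (Fin n)) := {x | 1 ≤ ‖u x‖ₑ} with hF
  have hFn : NullMeasurableSet F volume :=
    nullMeasurableSet_le aemeasurable_const hum.enorm
  have hFΩ : volume (F ∩ Ω) ≤ N := by
    rw [← Measure.restrict_apply₀ (hFn.mono_ac Measure.restrict_le_self.absolutelyContinuous),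
      hNint]
    have := mul_meas_ge_le_lintegral₀ (μ := volume.restrict Ω)
      ((hum.enorm.pow_const ((n : ℝ) / α)).mono_measure Measure.restrict_le_self) 1
    rw [one_mul] at this
    refine (measure_mono fun x hx => ?_).trans this
    exact ENNReal.one_le_rpow hx hp
  have hA := h (F ∩ Ω) inter_subset_right (hFn.inter hΩ) (hFΩ.trans_lt hNtop.lt_top) f hf hf1
  have hpt : ∀ x, ENNReal.ofReal (regExp m (1 / κ * |u x| ^ ((n : ℝ) / (n - α)))) ≤
      F.indicator (fun x => ENNReal.ofReal
        (Real.exp (1 / κ * |u x| ^ ((n : ℝ) / (n - α))))) x +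
      ENNReal.ofReal G * ‖u x‖ₑ ^ ((n : ℝ) / α) := by
    intro x
    by_cases hx : x ∈ F
    · rw [indicator_of_mem hx]
      exact (ENNReal.ofReal_le_ofReal (regExp_le_exp m (by positivity))).trans le_self_add
    · have hx1 : |u x| < 1 := by
        have : ‖u x‖ₑ < 1 := not_le.1 hx
        rw [Real.enorm_eq_ofReal_abs] at this
        simpa using this
      refine le_add_left ?_
      rw [Real.enorm_eq_ofReal_abs, ENNReal.ofReal_rpow_of_nonneg (abs_nonneg _) hp.le,
        ← ENNReal.ofReal_mul hG0.le]
      refine ENNReal.ofReal_le_ofReal ((regExp_le_pow m (by positivity)).trans ?_)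
      have h1 : |u x| ^ ((n : ℝ) / (n - α)) ≤ 1 :=
        Real.rpow_le_one (abs_nonneg _) hx1.le hq.le
      -- The choice of m matters here: m + 1 ≥ p - 1 and (p - 1)q = p, so the exponent q(m + 1) is
      -- at least p.
      have h2 : (|u x| ^ ((n : ℝ) / (n - α))) ^ (m + 1) ≤ |u x| ^ ((n : ℝ) / α) := by
        rw [← Real.rpow_natCast, ← Real.rpow_mul (abs_nonneg _)]
        refine Real.rpow_le_rpow_of_exponent_ge' (abs_nonneg _) hx1.le hp.le ?_
        have h3 : (n : ℝ) / α - 2 ≤ m := Nat.le_ceil _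
        have h4 := hpq.sub_one_mul_conj
        push_cast
        nlinarith
      have h5 : Real.exp (1 / κ * |u x| ^ ((n : ℝ) / (n - α))) ≤ Real.exp (1 / κ) :=
        Real.exp_le_exp.2 (mul_le_of_le_one_right (by positivity) h1)
      rw [mul_pow, hG]
      calc (1 / κ) ^ (m + 1) * (|u x| ^ ((n : ℝ) / (n - α))) ^ (m + 1) *
            Real.exp (1 / κ * |u x| ^ ((n : ℝ) / (n - α)))
          ≤ (1 / κ) ^ (m + 1) * |u x| ^ ((n : ℝ) / α) * Real.exp (1 / κ) := by gcongr
        _ = _ := by ring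
  calc ∫⁻ x in Ω, ENNReal.ofReal (regExp m (1 / κ * |u x| ^ ((n : ℝ) / (n - α))))
      ≤ ∫⁻ x in Ω, (F.indicator (fun x => ENNReal.ofReal
          (Real.exp (1 / κ * |u x| ^ ((n : ℝ) / (n - α))))) x +
          ENNReal.ofReal G * ‖u x‖ₑ ^ ((n : ℝ) / α)) := lintegral_mono hpt
    _ = (∫⁻ x in F ∩ Ω, ENNReal.ofReal
          (Real.exp (1 / κ * |u x| ^ ((n : ℝ) / (n - α))))) + ENNReal.ofReal G * N := by
        have hFr : NullMeasurableSet F (volume.restrict Ω) :=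
          hFn.mono_ac Measure.restrict_le_self.absolutelyContinuous
        rw [lintegral_add_right' _ (((hum.enorm.pow_const _).const_mul _).mono_measure
          Measure.restrict_le_self), lintegral_indicator₀ hFr, Measure.restrict_restrict₀ hFr,
          lintegral_const_mul' _ _ ENNReal.ofReal_ne_top, ← hNint]
    _ ≤ ENNReal.ofReal C * (1 + N) + ENNReal.ofReal G * (1 + N) := by
        refine add_le_add (hA.trans ?_) ?_
        · gcongr
        · gcongr
          exact le_add_self
    _ = ENNReal.ofReal (C + G) * (1 + N) := by
        rw [ENNReal.ofReal_add hC.le hG0.le, add_mul]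

end Adams

/-! ### Test functions concentrated on shells -/

/-- The function `|x - y|^{-α} w(y)` restricted to `W`. -/
noncomputable def shellFun {n : ℕ} (α : ℝ) (x : EuclideanSpace ℝ (Fin n))
    (W : Set (EuclideanSpace ℝ (Fin n))) (w : EuclideanSpace ℝ (Fin n) → ℝ) :
    EuclideanSpace ℝ (Fin n) → ℝ :=
  W.indicator fun y => ‖x - y‖ ^ (-α) * w y

section Shell

variable {n : ℕ} {α : ℝ} {x : EuclideanSpace ℝ (Fin n)} {a R G : ℝ}
  {W W₁ : Set (EuclideanSpace ℝ (Fin n))} {w : EuclideanSpace ℝ (Fin n) → ℝ}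

lemma le_norm_of_mem_shell (hWs : W ⊆ Metric.ball x R \ Metric.ball x a)
    {y : EuclideanSpace ℝ (Fin n)} (hy : y ∈ W) : a ≤ ‖x - y‖ := by
  have := (hWs hy).2
  rwa [Metric.mem_ball, dist_eq_norm, not_lt, norm_sub_rev] at this

lemma integrableOn_shell (ha : 0 < a) (hW : MeasurableSet W)
    (hWs : W ⊆ Metric.ball x R \ Metric.ball x a) :
    IntegrableOn (fun y => ‖x - y‖ ^ (-(n : ℝ))) W := by
  have hfin : volume W < ∞ :=
    (measure_mono (hWs.trans sdiff_subset)).trans_lt measure_ball_lt_top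
  refine Measure.integrableOn_of_bounded (M := a ^ (-(n : ℝ))) hfin.ne
    (by fun_prop : Measurable fun y : EuclideanSpace ℝ (Fin n) =>
      ‖x - y‖ ^ (-(n : ℝ))).aestronglyMeasurable ?_
  filter_upwards [ae_restrict_mem hW] with y hy
  rw [Real.norm_of_nonneg (by positivity)]
  exact Real.rpow_le_rpow_of_nonpos ha (le_norm_of_mem_shell hWs hy) (by simp)

lemma measurable_shellFun (hW : MeasurableSet W) (hw : Measurable w) :
    Measurable (shellFun α x W w) := by
  refine Measurable.indicator ?_ hW
  fun_prop

lemma lintegral_shellFun (hα0 : 0 < α) (hαn : α < n) (ha : 0 < a) (hW : MeasurableSet W)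
    (hWs : W ⊆ Metric.ball x R \ Metric.ball x a) :
    ∫⁻ y, ‖shellFun α x W w y‖ₑ ^ ((n : ℝ) / α) =
      ∫⁻ y in W, ENNReal.ofReal (‖x - y‖ ^ (-(n : ℝ)) * |w y| ^ ((n : ℝ) / α)) := by
  have hp := (holderConjugate_div hα0 hαn).pos
  rw [← lintegral_indicator hW]
  refine lintegral_congr fun y => ?_
  by_cases hy : y ∈ W
  · have h0 : 0 < ‖x - y‖ := ha.trans_le (le_norm_of_mem_shell hWs hy)
    rw [shellFun, indicator_of_mem hy, indicator_of_mem hy, Real.enorm_eq_ofReal_abs,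
      ENNReal.ofReal_rpow_of_nonneg (abs_nonneg _) hp.le, abs_mul,
      Real.mul_rpow (abs_nonneg _) (abs_nonneg _), abs_of_nonneg (by positivity),
      ← Real.rpow_mul h0.le]
    congr 3
    field_simp
  · rw [shellFun, indicator_of_notMem hy, indicator_of_notMem hy, enorm_zero,
      ENNReal.zero_rpow_of_pos hp]

/-- Upper and lower bounds for the norm of a test function that is `|x - y|^{-α}` on `W₁`. -/
lemma lintegral_shellFun_bounds (hα0 : 0 < α) (hαn : α < n) (ha : 0 < a)
    (hW : MeasurableSet W) (hWs : W ⊆ Metric.ball x R \ Metric.ball x a)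
    (hW₁ : MeasurableSet W₁) (hWW : W₁ ⊆ W) (hw1 : ∀ y ∈ W₁, w y = 1) (hG : 0 ≤ G)
    (hwG : ∀ y ∈ W, |w y| ≤ G) :
    ENNReal.ofReal (∫ y in W₁, ‖x - y‖ ^ (-(n : ℝ))) ≤
        ∫⁻ y, ‖shellFun α x W w y‖ₑ ^ ((n : ℝ) / α) ∧
      ∫⁻ y, ‖shellFun α x W w y‖ₑ ^ ((n : ℝ) / α) ≤
        ENNReal.ofReal ((∫ y in W₁, ‖x - y‖ ^ (-(n : ℝ))) +
          G ^ ((n : ℝ) / α) * ∫ y in W \ W₁, ‖x - y‖ ^ (-(n : ℝ))) := by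
  have hp := (holderConjugate_div hα0 hαn).pos
  have hi := integrableOn_shell ha hW hWs
  have hpos : ∀ y : EuclideanSpace ℝ (Fin n), 0 ≤ ‖x - y‖ ^ (-(n : ℝ)) := fun y => by positivity
  have e1 : ENNReal.ofReal (∫ y in W₁, ‖x - y‖ ^ (-(n : ℝ))) =
      ∫⁻ y in W₁, ENNReal.ofReal (‖x - y‖ ^ (-(n : ℝ)) * |w y| ^ ((n : ℝ) / α)) := by
    rw [ofReal_integral_eq_lintegral_ofReal (hi.mono_set hWW) (ae_of_all _ hpos)]
    refine setLIntegral_congr_fun hW₁ fun y hy => ?_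
    simp only [hw1 y hy, abs_one, Real.one_rpow, mul_one]
  have hsplit := lintegral_add_compl
    (μ := volume.restrict W) (fun y => ENNReal.ofReal (‖x - y‖ ^ (-(n : ℝ)) *
      |w y| ^ ((n : ℝ) / α))) hW₁
  rw [Measure.restrict_restrict hW₁, Measure.restrict_restrict hW₁.compl,
    inter_eq_left.2 hWW, inter_comm, ← sdiff_eq] at hsplit
  rw [lintegral_shellFun hα0 hαn ha hW hWs, ← hsplit, ← e1,
    ENNReal.ofReal_add (integral_nonneg hpos) (mul_nonneg (by positivity) (integral_nonneg hpos))]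
  refine ⟨le_self_add, add_le_add le_rfl ?_⟩
  rw [ENNReal.ofReal_mul (by positivity), ofReal_integral_eq_lintegral_ofReal
    (hi.mono_set sdiff_subset) (ae_of_all _ hpos), ← lintegral_const_mul' _ _ ENNReal.ofReal_ne_top]
  refine setLIntegral_mono' (hW.diff hW₁) fun y hy => ?_
  rw [← ENNReal.ofReal_mul (by positivity), mul_comm]
  refine ENNReal.ofReal_le_ofReal (mul_le_mul_of_nonneg_right ?_ (hpos y))
  exact Real.rpow_le_rpow (abs_nonneg _) (hwG y hy.1) hp.le

/-- A lower bound for the potential of a test function near the centre of the shell. -/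
lemma le_rieszPotential_shellFun (hαn : α < n) (ha : 0 < a)
    (hW : MeasurableSet W) (hWs : W ⊆ Metric.ball x R \ Metric.ball x a)
    (hW₁ : MeasurableSet W₁) (hWW : W₁ ⊆ W) (hw : Measurable w) (hw1 : ∀ y ∈ W₁, w y = 1)
    (hwG : ∀ y ∈ W, |w y| ≤ G) {θ : ℝ} (hθ0 : 0 ≤ θ) (hθ1 : θ < 1)
    {z : EuclideanSpace ℝ (Fin n)} (hz : ‖z - x‖ ≤ θ * a) :
    (1 + θ) ^ (α - (n : ℝ)) * (∫ y in W₁, ‖x - y‖ ^ (-(n : ℝ))) -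
        G * (1 - θ) ^ (α - (n : ℝ)) * (∫ y in W \ W₁, ‖x - y‖ ^ (-(n : ℝ))) ≤
      rieszPotential α (shellFun α x W w) z := by
  have hs : α - n ≤ 0 := by linarith
  have hi := integrableOn_shell ha hW hWs
  -- On the shell |x - y| ≥ a, so moving the centre by at most θa changes the distance to y by a
  -- factor between 1 - θ and 1 + θ.
  have hpt : ∀ y ∈ W, (1 + θ) ^ (α - (n : ℝ)) * ‖x - y‖ ^ (-(n : ℝ)) ≤
      ‖z - y‖ ^ (α - (n : ℝ)) * ‖x - y‖ ^ (-α) ∧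
      ‖z - y‖ ^ (α - (n : ℝ)) * ‖x - y‖ ^ (-α) ≤
        (1 - θ) ^ (α - (n : ℝ)) * ‖x - y‖ ^ (-(n : ℝ)) := by
    intro y hy
    have h0 := le_norm_of_mem_shell hWs hy
    have h1 : 0 < ‖x - y‖ := ha.trans_le h0
    have hza : ‖z - x‖ ≤ θ * ‖x - y‖ := hz.trans (by gcongr)
    have hup : ‖z - y‖ ≤ (1 + θ) * ‖x - y‖ := by
      have := norm_add_le (z - x) (x - y)
      rw [sub_add_sub_cancel] at this
      linarith
    have hlo : (1 - θ) * ‖x - y‖ ≤ ‖z - y‖ := by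
      have := norm_sub_le (z - y) (z - x)
      rw [sub_sub_sub_cancel_left] at this
      linarith
    have hlo0 : 0 < (1 - θ) * ‖x - y‖ := mul_pos (by linarith) h1
    have e : ∀ t : ℝ, 0 ≤ t → t ^ (α - (n : ℝ)) * ‖x - y‖ ^ (-(n : ℝ)) =
        (t * ‖x - y‖) ^ (α - (n : ℝ)) * ‖x - y‖ ^ (-α) := by
      intro t ht
      rw [Real.mul_rpow ht h1.le, mul_assoc, ← Real.rpow_add h1]
      congr 2
      ring
    rw [e _ (by linarith), e _ (by linarith)]
    constructor
    · exact mul_le_mul_of_nonneg_right (Real.rpow_le_rpow_of_nonpos (hlo0.trans_le hlo) hup hs)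
        (by positivity)
    · exact mul_le_mul_of_nonneg_right (Real.rpow_le_rpow_of_nonpos hlo0 hlo hs)
        (by positivity)
  set k : EuclideanSpace ℝ (Fin n) → ℝ :=
    fun y => ‖z - y‖ ^ (α - (n : ℝ)) * (‖x - y‖ ^ (-α) * w y) with hk
  have hkm : Measurable k := by fun_prop
  have hkabs : ∀ y ∈ W, |k y| ≤ G * (1 - θ) ^ (α - (n : ℝ)) * ‖x - y‖ ^ (-(n : ℝ)) := by
    intro y hy
    have hG : 0 ≤ G := (abs_nonneg _).trans (hwG y hy)
    rw [hk]
    simp only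
    rw [← mul_assoc, abs_mul, abs_of_nonneg (by positivity), mul_comm, mul_assoc]
    exact mul_le_mul (hwG y hy) (hpt y hy).2 (by positivity) hG
  have hki : IntegrableOn k W := by
    refine Integrable.mono' (hi.const_mul (G * (1 - θ) ^ (α - (n : ℝ))))
      hkm.aestronglyMeasurable ?_
    filter_upwards [ae_restrict_mem hW] with y hy
    exact hkabs y hy
  have hpot : rieszPotential α (shellFun α x W w) z = ∫ y in W, k y := by
    rw [rieszPotential, ← integral_indicator hW]
    refine integral_congr_ae (ae_of_all _ fun y => ?_)
    by_cases hy : y ∈ W <;> simp [shellFun, hk, hy]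
  have hWsplit : ∫ y in W, k y = (∫ y in W₁, k y) + ∫ y in W \ W₁, k y := by
    rw [← integral_inter_add_sdiff hW₁ hki, inter_eq_right.2 hWW]
  rw [hpot, hWsplit, sub_eq_add_neg]
  refine add_le_add ?_ ?_
  · rw [← integral_const_mul]
    refine setIntegral_mono_on ((hi.mono_set hWW).const_mul _) (hki.mono_set hWW) hW₁
      fun y hy => ?_
    simp only [hk, hw1 y hy, mul_one]
    exact (hpt y (hWW hy)).1
  · rw [neg_le, ← integral_neg, ← integral_const_mul]
    refine setIntegral_mono_on (hki.mono_set sdiff_subset).neg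
      ((hi.mono_set sdiff_subset).const_mul _) (hW.diff hW₁) fun y hy => ?_
    exact (neg_le_abs _).trans (hkabs y hy.1)

/-- Normalization of a function in `L^p`. -/
lemma exists_normalized {p : ℝ} (hp : 0 < p) {f : EuclideanSpace ℝ (Fin n) → ℝ}
    (hf : Measurable f) {a b : ℝ} (ha : 0 < a)
    (hfa : ENNReal.ofReal a ≤ ∫⁻ y, ‖f y‖ₑ ^ p) (hfb : ∫⁻ y, ‖f y‖ₑ ^ p ≤ ENNReal.ofReal b) :
    ∃ N : ℝ, 0 < N ∧ a ≤ N ^ p ∧ N ^ p ≤ b ∧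
      MemLp (fun y => N⁻¹ * f y) (ENNReal.ofReal p) volume ∧
      eLpNorm (fun y => N⁻¹ * f y) (ENNReal.ofReal p) volume = 1 ∧
      ∀ α z, rieszPotential α (fun y => N⁻¹ * f y) z = N⁻¹ * rieszPotential α f z := by
  have hN : eLpNorm f (ENNReal.ofReal p) volume ^ p = ∫⁻ y, ‖f y‖ₑ ^ p :=
    (lintegral_rpow_eq_of_ae_eq hp (ae_eq_refl _)).symm
  set N := eLpNorm f (ENNReal.ofReal p) volume with hNdef
  have hb : 0 ≤ b := by
    by_contra hb
    have := hfa.trans hfb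
    rw [ENNReal.ofReal_of_nonpos (not_le.1 hb).le] at this
    exact (ENNReal.ofReal_pos.2 ha).not_ge this
  have hNtop : N ≠ ∞ := by
    intro h
    rw [h, ENNReal.top_rpow_of_pos hp] at hN
    rw [← hN] at hfb
    exact ENNReal.ofReal_ne_top (top_le_iff.1 hfb)
  have hN0 : N ≠ 0 := by
    intro h
    rw [h, ENNReal.zero_rpow_of_pos hp] at hN
    rw [← hN] at hfa
    exact (ENNReal.ofReal_pos.2 ha).not_ge hfa
  have hNpos := ENNReal.toReal_pos hN0 hNtop
  have hNr : ENNReal.ofReal (N.toReal ^ p) = ∫⁻ y, ‖f y‖ₑ ^ p := by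
    rw [← hN, ← ENNReal.ofReal_rpow_of_nonneg hNpos.le hp.le, ENNReal.ofReal_toReal hNtop]
  refine ⟨N.toReal, hNpos, ?_, ?_, ?_, ?_, fun α z => ?_⟩
  · rwa [← hNr, ENNReal.ofReal_le_ofReal_iff (by positivity)] at hfa
  · rwa [← hNr, ENNReal.ofReal_le_ofReal_iff hb] at hfb
  · exact MemLp.const_mul ⟨hf.aestronglyMeasurable, hNtop.lt_top⟩ _
  · have := eLpNorm_const_smul (μ := volume) N.toReal⁻¹ f (ENNReal.ofReal p)
    simp only [Pi.smul_def, smul_eq_mul] at this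
    rw [this, ← hNdef, Real.enorm_of_nonneg (by positivity), ENNReal.ofReal_inv_of_pos hNpos,
      ENNReal.ofReal_toReal hNtop, ENNReal.inv_mul_cancel hN0 hNtop]
  · unfold rieszPotential
    rw [← integral_const_mul]
    refine integral_congr_ae (ae_of_all _ fun y => ?_)
    simp only
    ring

end Shell

/-! ### Failure of the inequality on sets that are not subcritical -/

section Converse

variable {n : ℕ} {α : ℝ} {Ω : Set (EuclideanSpace ℝ (Fin n))}

lemma exists_lt_growthIntegral (hn : 0 < n) (hΩ : NullMeasurableSet Ω volume)
    (h : ¬ IsRieszSubcritical Ω) {T : ℝ≥0∞} (hT : T ≠ ∞) :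
    ∃ x ∈ Ω, T < ENNReal.ofReal n * growthIntegral Ω x := by
  by_contra hcon
  push Not at hcon
  have hn0 : ENNReal.ofReal (n : ℝ) ≠ 0 := (ENNReal.ofReal_pos.2 (by exact_mod_cast hn)).ne'
  refine h (lt_of_le_of_lt (essSup_le_of_ae_le (T / ENNReal.ofReal n) ?_)
    (ENNReal.div_lt_top hT hn0))
  filter_upwards [ae_restrict_mem₀ hΩ] with x hx
  rw [ENNReal.le_div_iff_mul_le (Or.inl hn0) (Or.inl ENNReal.ofReal_ne_top), mul_comm]
  exact hcon x hx

/-- If Ω had finite volume, that volume would bound n times the growth integral. Infinite volume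
later provides balls that meet Ω in volume exactly 1. -/
lemma volume_eq_top_of_not_subcritical (hn : 0 < n) (hΩ : NullMeasurableSet Ω volume)
    (h : ¬ IsRieszSubcritical Ω) : volume Ω = ∞ := by
  by_contra hV
  obtain ⟨x, -, hx⟩ := exists_lt_growthIntegral hn hΩ h hV
  refine absurd hx (not_lt.2 ?_)
  rw [growthIntegral_eq x hn]
  calc ∫⁻ r in Ioi (1 : ℝ), ENNReal.ofReal (n * r ^ (-(n : ℝ) - 1)) *
        (volume.restrict Ω) (Metric.ball x r)
      ≤ ∫⁻ r in Ioi (1 : ℝ), ENNReal.ofReal (n * r ^ (-(n : ℝ) - 1)) * volume Ω := by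
        refine lintegral_mono fun r => mul_le_mul_right ?_ _
        exact (measure_mono (subset_univ _)).trans (by simp)
    _ = volume Ω := by
        rw [lintegral_mul_const' _ _ hV, lintegral_Ioi_rpow_eq (by exact_mod_cast hn) one_pos]
        simp

/-- A large growth integral produces a shell on which `|x - y|^{-n}` has a large integral. -/
lemma exists_shell_of_lt_growthIntegral (hn : 0 < n) {x : EuclideanSpace ℝ (Fin n)}
    {T : ℝ} {r : ℝ} (hr : 0 < r) (hrv : volume (Metric.ball x r ∩ Ω) = 1)
    (h : ENNReal.ofReal T + 1 < ENNReal.ofReal n * growthIntegral Ω x) :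
    ∃ R : ℝ, ENNReal.ofReal T <
      ∫⁻ y in Ω ∩ (Metric.ball x R \ Metric.ball x r), ENNReal.ofReal (‖x - y‖ ^ (-(n : ℝ))) := by
  have hn' : (0 : ℝ) < n := by exact_mod_cast hn
  set ν := volume.restrict Ω with hν
  have hb : ∀ s, MeasurableSet (Metric.ball x s) := fun s => Metric.isOpen_ball.measurableSet
  rw [growthIntegral_eq x hn, ← lintegral_max_rpow_eq _ x hn' one_pos,
    ← lintegral_add_compl _ (hb r)] at h
  -- The integrand is at most 1 and the ball meets Ω in volume 1; the extra 1 in the hypothesis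
  -- compensates for this.
  have h1 : ∫⁻ y in Metric.ball x r, ENNReal.ofReal (max 1 ‖x - y‖ ^ (-(n : ℝ))) ∂ν ≤ 1 := by
    calc ∫⁻ y in Metric.ball x r, ENNReal.ofReal (max 1 ‖x - y‖ ^ (-(n : ℝ))) ∂ν
        ≤ ∫⁻ _ in Metric.ball x r, 1 ∂ν := by
          refine lintegral_mono fun y => ENNReal.ofReal_le_one.2 ?_
          exact Real.rpow_le_one_of_one_le_of_nonpos (le_max_left _ _) (by simp)
      _ = 1 := by rw [setLIntegral_const, one_mul, hν, Measure.restrict_apply (hb r), hrv]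
  have h2 : ∫⁻ y in (Metric.ball x r)ᶜ, ENNReal.ofReal (max 1 ‖x - y‖ ^ (-(n : ℝ))) ∂ν ≤
      ∫⁻ y in (Metric.ball x r)ᶜ, ENNReal.ofReal (‖x - y‖ ^ (-(n : ℝ))) ∂ν := by
    refine setLIntegral_mono' (hb r).compl fun y hy => ENNReal.ofReal_le_ofReal ?_
    rw [mem_compl_iff, Metric.mem_ball, dist_eq_norm, not_lt, norm_sub_rev] at hy
    exact Real.rpow_le_rpow_of_nonpos (hr.trans_le hy) (le_max_right _ _) (by simp)
  have h3 : ENNReal.ofReal T <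
      ∫⁻ y in (Metric.ball x r)ᶜ, ENNReal.ofReal (‖x - y‖ ^ (-(n : ℝ))) ∂ν := by
    rw [add_comm] at h
    exact lt_of_add_lt_add_left (h.trans_le (add_le_add h1 h2))
  set μ := ν.withDensity fun y => ENNReal.ofReal (‖x - y‖ ^ (-(n : ℝ))) with hμ
  have hmono : Monotone fun k : ℕ => Metric.ball x (k : ℝ) \ Metric.ball x r := fun i j hij =>
    sdiff_subset_sdiff_left (Metric.ball_subset_ball (by exact_mod_cast hij))
  have ht := tendsto_measure_iUnion_atTop (μ := μ) hmono
  rw [← iUnion_sdiff, Metric.iUnion_ball_nat, ← compl_eq_univ_sdiff, hμ,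
    withDensity_apply _ (hb r).compl] at ht
  obtain ⟨k, hk⟩ := (ht.eventually (lt_mem_nhds h3)).exists
  refine ⟨k, ?_⟩
  simp only [Function.comp] at hk
  rwa [withDensity_apply _ ((hb _).diff (hb _)), hν,
    Measure.restrict_restrict ((hb _).diff (hb _)), inter_comm] at hk

/-- For Ψ = |x-y|^{-α} on the shell both the p-th power of the norm and the potential near x are
governed by A > T, so normalizing leaves A^{1-1/p} = A^{1/q}. -/
lemma exists_large_potential (hα0 : 0 < α) (hαn : α < n) (hΩ : NullMeasurableSet Ω volume)
    (h : ¬ IsRieszSubcritical Ω) {T : ℝ} (hT : 0 < T) :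
    ∃ (Ψ : EuclideanSpace ℝ (Fin n) → ℝ) (x : EuclideanSpace ℝ (Fin n)) (r : ℝ),
      MemLpOn Ω (n / α) Ψ ∧ eLpNorm Ψ (ENNReal.ofReal (n / α)) volume = 1 ∧ x ∈ Ω ∧ 0 < r ∧
      volume (Metric.ball x r ∩ Ω) = 1 ∧
      ∀ z ∈ Metric.ball x r, (2 : ℝ) ^ (α - (n : ℝ)) * T ^ (1 / ((n : ℝ) / (n - α))) ≤
        rieszPotential α Ψ z := by
  have hpq := holderConjugate_div hα0 hαn
  have hp := hpq.pos
  have hq := hpq.symm.pos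
  have hn' : (0 : ℝ) < n := by linarith
  have hn : 0 < n := by exact_mod_cast hn'
  obtain ⟨Ω', hΩ'sub, hΩ'm, hΩ'⟩ := hΩ.exists_measurable_subset_ae_eq
  obtain ⟨x, hxΩ, hx⟩ := exists_lt_growthIntegral hn hΩ h
    (ENNReal.add_ne_top.2 ⟨ENNReal.ofReal_ne_top (r := T), ENNReal.one_ne_top⟩)
  obtain ⟨r, hr, hrv⟩ := exists_volume_ball_inter_eq hn Ω x (δ := 1) one_pos (by
    rw [volume_eq_top_of_not_subcritical hn hΩ h]
    exact ENNReal.one_lt_top)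
  rw [← growthIntegral_congr hΩ'] at hx
  obtain ⟨R, hR⟩ := exists_shell_of_lt_growthIntegral hn hr (by
    rw [measure_congr ((ae_eq_refl (Metric.ball x r)).inter hΩ'), hrv]) hx
  set W := Ω' ∩ (Metric.ball x R \ Metric.ball x r) with hW
  have hWs : W ⊆ Metric.ball x R \ Metric.ball x r := inter_subset_right
  have hWm : MeasurableSet W :=
    hΩ'm.inter (Metric.isOpen_ball.measurableSet.diff Metric.isOpen_ball.measurableSet)
  rw [← ofReal_integral_eq_lintegral_ofReal (integrableOn_shell hr hWm hWs)
    (ae_of_all _ fun y => by positivity)] at hR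
  set A := ∫ y in W, ‖x - y‖ ^ (-(n : ℝ)) with hA
  have hTA : T < A := (ENNReal.ofReal_lt_ofReal_iff_of_nonneg hT.le).1 hR
  have hA0 : 0 < A := hT.trans hTA
  obtain ⟨hb1, hb2⟩ := lintegral_shellFun_bounds (w := fun _ => 1) (G := 1) hα0 hαn hr hWm hWs
    hWm subset_rfl (fun _ _ => rfl) zero_le_one (fun _ _ => by simp)
  obtain ⟨N, hN0, hN1, hN2, hmem, hnorm, hpot⟩ := exists_normalized hp
    (measurable_shellFun (α := α) (x := x) hWm measurable_const) hA0 hb1 hb2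
  rw [Set.sdiff_self] at hN2
  simp only [Measure.restrict_empty, integral_zero_measure, mul_zero, add_zero]
    at hN2
  have hNA : N = A ^ (1 / ((n : ℝ) / α)) := by
    rw [show A = N ^ ((n : ℝ) / α) from le_antisymm hN1 hN2, ← Real.rpow_mul hN0.le,
      mul_one_div_cancel hp.ne', Real.rpow_one]
  refine ⟨_, x, r, ⟨hmem, ae_of_all _ fun y hy => ?_⟩, hnorm, hxΩ, hr, hrv, fun z hz => ?_⟩
  · rw [shellFun, indicator_of_notMem fun hyW => hy (hΩ'sub hyW.1), mul_zero]
  · rw [hpot]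
    rw [Metric.mem_ball, dist_eq_norm] at hz
    -- Here θ depends on z; the bound stays uniform on the ball because 1 + θ ≤ 2.
    have hθ1 : ‖z - x‖ / r < 1 := (div_lt_one hr).2 hz
    have hlow := le_rieszPotential_shellFun (w := fun _ => 1) (G := 1) hαn hr hWm hWs hWm
      subset_rfl measurable_const (fun _ _ => rfl) (fun _ _ => by simp)
      (θ := ‖z - x‖ / r) (by positivity) hθ1 (z := z) (by rw [div_mul_cancel₀ _ hr.ne'])
    rw [Set.sdiff_self] at hlow
    simp only [Measure.restrict_empty, integral_zero_measure, mul_zero, sub_zero]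
      at hlow
    have h2 : (2 : ℝ) ^ (α - (n : ℝ)) ≤ (1 + ‖z - x‖ / r) ^ (α - (n : ℝ)) :=
      Real.rpow_le_rpow_of_nonpos (by positivity) (by linarith) (by linarith)
    rw [inv_mul_eq_div, le_div_iff₀ hN0]
    refine le_trans ?_ ((mul_le_mul_of_nonneg_right h2 hA0.le).trans hlow)
    rw [mul_assoc]
    refine mul_le_mul_of_nonneg_left ?_ (by positivity)
    calc T ^ (1 / ((n : ℝ) / (n - α))) * N
        ≤ A ^ (1 / ((n : ℝ) / (n - α))) * A ^ (1 / ((n : ℝ) / α)) := by rw [hNA]; gcongr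
      _ = A := by
        rw [← Real.rpow_add hA0, one_div, one_div, hpq.symm.inv_add_inv_eq_one, Real.rpow_one]

lemma not_adamsBound_of_not_subcritical (hα0 : 0 < α) (hαn : α < n)
    (hΩ : NullMeasurableSet Ω volume) (h : ¬ IsRieszSubcritical Ω) :
    ¬ ∃ C : ℝ, ∀ E : Set (EuclideanSpace ℝ (Fin n)), E ⊆ Ω → NullMeasurableSet E volume →
      volume E < ∞ → AdamsBound Ω α (1 / unitBallVolume n) E C := by
  rintro ⟨C, hC⟩
  have hq := (holderConjugate_div hα0 hαn).symm.pos
  have hκ := unitBallVolume_pos n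
  set κ := unitBallVolume n with hκdef
  set q := (n : ℝ) / (n - α) with hqdef
  set c := (2 : ℝ) ^ (α - (n : ℝ)) with hc
  have hc0 : 0 < c := by positivity
  -- Makes the exponent at least 2|C| + 1 on a set of volume 1, while the right side of (1) is at
  -- most 2|C| there.
  set T := (2 * |C| + 1) * κ / c ^ q with hT
  have hT0 : 0 < T := by positivity
  obtain ⟨Ψ, x, r, hmem, hnorm, hx, hr, hrv, hpot⟩ := exists_large_potential hα0 hαn hΩ h hT0
  set E := Metric.ball x r ∩ Ω with hE
  have hEn : NullMeasurableSet E volume :=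
    Metric.isOpen_ball.measurableSet.nullMeasurableSet.inter hΩ
  have h1 := hC E inter_subset_right hEn (by rw [hrv]; exact ENNReal.one_lt_top) Ψ hmem hnorm.le
  have h2 : ENNReal.ofReal (Real.exp (2 * |C| + 1)) ≤ ∫⁻ y in E, ENNReal.ofReal
      (Real.exp (1 / κ * |rieszPotential α Ψ y| ^ q)) := by
    calc ENNReal.ofReal (Real.exp (2 * |C| + 1))
        = ∫⁻ _ in E, ENNReal.ofReal (Real.exp (2 * |C| + 1)) := by
          rw [setLIntegral_const, hrv, mul_one]
      _ ≤ _ := by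
          refine lintegral_mono_ae ?_
          filter_upwards [ae_restrict_mem₀ hEn] with y hy
          refine ENNReal.ofReal_le_ofReal (Real.exp_le_exp.2 ?_)
          have h3 : (c * T ^ (1 / q)) ^ q ≤ |rieszPotential α Ψ y| ^ q :=
            Real.rpow_le_rpow (by positivity) ((hpot y hy.1).trans (le_abs_self _)) hq.le
          rw [Real.mul_rpow hc0.le (by positivity), ← Real.rpow_mul hT0.le,
            one_div_mul_cancel hq.ne', Real.rpow_one] at h3
          calc 2 * |C| + 1 = 1 / κ * (c ^ q * T) := by rw [hT]; field_simp
            _ ≤ _ := by gcongr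
  have h3 := h2.trans h1
  rw [hrv, show (1 : ℝ≥0∞) + 1 = ENNReal.ofReal 2 by norm_num,
    ← ENNReal.ofReal_mul' (by norm_num)] at h3
  have h4 : ENNReal.ofReal (C * 2) ≤ ENNReal.ofReal (2 * |C|) :=
    ENNReal.ofReal_le_ofReal (by linarith [le_abs_self C])
  have h5 := (ENNReal.ofReal_le_ofReal_iff (by positivity)).1 (h3.trans h4)
  linarith [Real.add_one_le_exp (2 * |C| + 1)]

lemma exists_blowup_sequence (hα0 : 0 < α) (hαn : α < n)
    (hΩ : NullMeasurableSet Ω volume) (h : ¬ IsRieszSubcritical Ω) :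
    ∃ (Ψ : ℕ → EuclideanSpace ℝ (Fin n) → ℝ) (x : ℕ → EuclideanSpace ℝ (Fin n))
      (r : ℕ → ℝ) (δ : ℝ), 0 < δ ∧
      (∀ m, MemLpOn Ω (n / α) (Ψ m) ∧
        eLpNorm (Ψ m) (ENNReal.ofReal (n / α)) volume = 1 ∧
        x m ∈ Ω ∧ 0 < r m ∧
        volume (Metric.ball (x m) (r m) ∩ Ω) = ENNReal.ofReal δ) ∧
      Tendsto (fun m => ⨅ z ∈ Metric.ball (x m) (r m) ∩ Ω, ‖rieszPotential α (Ψ m) z‖ₑ)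
        atTop (𝓝 ∞) := by
  have hq := (holderConjugate_div hα0 hαn).symm.pos
  choose Ψ x r hmem hnorm hx hr hrv hpot using fun m : ℕ =>
    exists_large_potential hα0 hαn hΩ h (T := (m : ℝ) + 1) (by positivity)
  refine ⟨Ψ, x, r, 1, one_pos, fun m => ⟨hmem m, hnorm m, hx m, hr m, by simpa using hrv m⟩, ?_⟩
  have ht : Tendsto (fun m : ℕ => ENNReal.ofReal ((2 : ℝ) ^ (α - (n : ℝ)) *
      ((m : ℝ) + 1) ^ (1 / ((n : ℝ) / (n - α))))) atTop (𝓝 ∞) := by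
    refine ENNReal.tendsto_ofReal_atTop.comp (Tendsto.const_mul_atTop (by positivity) ?_)
    exact (tendsto_rpow_atTop (by positivity)).comp
      (tendsto_atTop_add_const_right _ _ tendsto_natCast_atTop_atTop)
  refine tendsto_nhds_top_mono ht (Eventually.of_forall fun m => ?_)
  refine le_iInf₂ fun z hz => ?_
  rw [Real.enorm_eq_ofReal_abs]
  exact ENNReal.ofReal_le_ofReal ((hpot m z hz.1).trans (le_abs_self _))

end Converse

/-! ### Sharpness of the exponential constant -/

section Sharp

variable {n : ℕ} {α : ℝ}

/-- The numerical core of both sharpness proofs. L is log(1/εⁿ) for the inner radius ε, A the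
integral of |x-y|^{-n} over the shell, N the norm of the test function, v its normalized potential,
d the density and C all bounded errors. Since γκ > 1, the losses from θ, d and C still leave a
surplus δ when L is large. -/
lemma exists_sharp_parameters (hα0 : 0 < α) (hαn : α < n) {κ γ : ℝ} (hκ : 0 < κ)
    (hγ : 1 / κ < γ) :
    ∃ θ d δ : ℝ, 0 < θ ∧ θ < 1 ∧ 0 < d ∧ d < 1 ∧ 0 < δ ∧
      ∀ C, 0 ≤ C → ∃ L₀, ∀ L, L₀ ≤ L → ∀ A N v : ℝ, d * κ * L - C ≤ A → 0 < N →
        N ^ ((n : ℝ) / α) ≤ A + C → (1 + θ) ^ (α - (n : ℝ)) * A - C ≤ N * v →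
        (1 + δ) * L ≤ γ * v ^ ((n : ℝ) / (n - α)) := by
  have hpq := holderConjugate_div hα0 hαn
  have hp := hpq.pos
  have hq := hpq.symm.pos
  set p := (n : ℝ) / α
  set q := (n : ℝ) / (n - α)
  have hγ0 : 0 < γ := (by positivity : 0 < 1 / κ).trans hγ
  have hγκ : 1 < γ * κ := by rwa [div_lt_iff₀ hκ] at hγ
  obtain ⟨η, hη0, hη1, hη⟩ : ∃ η : ℝ, 0 < η ∧ η < 1 ∧
      1 < γ * κ * (((1 + η) ^ (α - (n : ℝ)) * (1 - η)) ^ q * (1 - η)) := by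
    have hcont : ContinuousAt (fun η : ℝ =>
        γ * κ * (((1 + η) ^ (α - (n : ℝ)) * (1 - η)) ^ q * (1 - η))) 0 := by
      refine ContinuousAt.mul continuousAt_const (ContinuousAt.mul ?_ (by fun_prop))
      refine ContinuousAt.rpow_const (ContinuousAt.mul ?_ (by fun_prop)) (Or.inr hq.le)
      exact ContinuousAt.rpow_const (by fun_prop) (Or.inl (by norm_num))
    have h0 : 1 < γ * κ * (((1 + (0 : ℝ)) ^ (α - (n : ℝ)) * (1 - 0)) ^ q * (1 - 0)) := by
      simpa using hγκ
    have h1 := hcont.eventually (lt_mem_nhds h0)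
    have h2 : ∀ᶠ η : ℝ in 𝓝[>] 0, 0 < η ∧ η < 1 :=
      Ioo_mem_nhdsGT (zero_lt_one (α := ℝ))
    obtain ⟨η, h3, h4⟩ := ((h1.filter_mono nhdsWithin_le_nhds).and h2).exists
    exact ⟨η, h4.1, h4.2, h3⟩
  set c := (1 + η) ^ (α - (n : ℝ)) with hc
  have hc0 : 0 < c := by positivity
  have h1η : 0 < 1 - η := by linarith
  set Q := (c * (1 - η)) ^ q with hQ
  have hQ0 : 0 < Q := by positivity
  set δ := (γ * κ * (Q * (1 - η)) - 1) / 2 with hδ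
  have hδ0 : 0 < δ := by linarith
  refine ⟨η, 1 - η, δ, hη0, hη1, h1η, by linarith, hδ0, fun C hC => ?_⟩
  -- Beyond A₀ the bounded errors cost at most a factor: cA - C ≥ c(1-η)(A + C).
  set A₀ := C * (1 + c * (1 - η)) / (c * η) with hA₀
  have hA₀0 : 0 ≤ A₀ := by positivity
  refine ⟨max ((A₀ + C + 1) / ((1 - η) * κ)) (γ * Q * C / δ), fun L hL A N v hA hN hNA hv => ?_⟩
  have hL1 : A₀ + C + 1 ≤ (1 - η) * κ * L := by
    have := (le_max_left _ _).trans hL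
    rwa [div_le_iff₀' (by positivity)] at this
  have hL2 : γ * Q * C ≤ δ * L := by
    have := (le_max_right _ _).trans hL
    rwa [div_le_iff₀' hδ0] at this
  have hAA : A₀ + 1 ≤ A := by linarith
  have hAC : 0 < A + C := by linarith
  have h1 : c * (1 - η) * (A + C) ≤ c * A - C := by
    have : C * (1 + c * (1 - η)) ≤ c * η * A := by
      rw [← div_le_iff₀' (by positivity)]
      linarith
    linarith
  have hNle : N ≤ (A + C) ^ (1 / p) := by
    have := Real.rpow_le_rpow (by positivity) hNA (by positivity : 0 ≤ 1 / p)
    rwa [← Real.rpow_mul hN.le, mul_one_div_cancel hp.ne', Real.rpow_one] at this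
  have hvlow : c * (1 - η) * (A + C) ^ (1 / q) ≤ v := by
    have h2 : N * (c * (1 - η) * (A + C) ^ (1 / q)) ≤ N * v := by
      refine le_trans ?_ (h1.trans hv)
      calc N * (c * (1 - η) * (A + C) ^ (1 / q))
          ≤ (A + C) ^ (1 / p) * (c * (1 - η) * (A + C) ^ (1 / q)) := by gcongr
        _ = c * (1 - η) * ((A + C) ^ (1 / p) * (A + C) ^ (1 / q)) := by ring
        _ = c * (1 - η) * (A + C) := by
          rw [← Real.rpow_add hAC, one_div, one_div, hpq.inv_add_inv_eq_one, Real.rpow_one]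
    exact le_of_mul_le_mul_left h2 hN
  have hvq : Q * (A + C) ≤ v ^ q := by
    have := Real.rpow_le_rpow (by positivity) hvlow hq.le
    rwa [Real.mul_rpow (by positivity) (by positivity), ← Real.rpow_mul hAC.le,
      one_div_mul_cancel hq.ne', Real.rpow_one] at this
  have hfin : γ * (Q * ((1 - η) * κ * L - C)) ≤ γ * v ^ q := by
    refine mul_le_mul_of_nonneg_left (le_trans ?_ hvq) hγ0.le
    refine mul_le_mul_of_nonneg_left ?_ hQ0.le
    linarith
  have hexp : γ * (Q * ((1 - η) * κ * L - C)) = (1 + 2 * δ) * L - γ * Q * C := by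
    rw [hδ]
    ring
  linarith

/-- Lebesgue's density theorem, passing from closed to open balls because spheres are null. -/
lemma exists_density_point (hn : 0 < n) {E : Set (EuclideanSpace ℝ (Fin n))}
    (hE : 0 < volume E) {d : ℝ} (hd1 : d < 1) :
    ∃ (x : EuclideanSpace ℝ (Fin n)) (r₁ : ℝ), 0 < r₁ ∧ ∀ r, 0 < r → r ≤ r₁ →
      ENNReal.ofReal (d * unitBallVolume n * r ^ (n : ℝ)) ≤ volume (E ∩ Metric.ball x r) := by
  have : Nonempty (Fin n) := ⟨⟨0, hn⟩⟩
  have hne : NeBot (ae (volume.restrict E)) := by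
    rw [ae_neBot, Ne, Measure.restrict_eq_zero]
    exact hE.ne'
  obtain ⟨x, hx⟩ := (Besicovitch.ae_tendsto_measure_inter_div volume E).exists
  have h1 := hx.eventually (lt_mem_nhds (show ENNReal.ofReal d < 1 by simpa using hd1))
  obtain ⟨r₁, hr₁, hr₁'⟩ := mem_nhdsGT_iff_exists_Ioc_subset.1 h1
  refine ⟨x, r₁, hr₁, fun r hr hrr => ?_⟩
  have h2 : ENNReal.ofReal d < volume (E ∩ Metric.closedBall x r) /
      volume (Metric.closedBall x r) := hr₁' ⟨hr, hrr⟩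
  have hcb : volume (Metric.closedBall x r) =
      ENNReal.ofReal (unitBallVolume n * r ^ (n : ℝ)) := by
    rw [Measure.addHaar_closedBall_eq_addHaar_ball, volume_ball_eq hn x hr.le]
  have hκ := unitBallVolume_pos n
  have hpos : 0 < unitBallVolume n * r ^ (n : ℝ) := by positivity
  rw [hcb] at h2
  have h3 := (ENNReal.lt_div_iff_mul_lt (Or.inl (ENNReal.ofReal_pos.2 hpos).ne')
    (Or.inl ENNReal.ofReal_ne_top)).1 h2
  rw [← ENNReal.ofReal_mul' hpos.le, ← mul_assoc] at h3
  refine h3.le.trans ((measure_mono ?_).trans ((measure_union_le (E ∩ Metric.ball x r)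
    (Metric.sphere x r)).trans ?_))
  · intro y hy
    rcases (Metric.mem_closedBall.1 hy.2).lt_or_eq with h | h
    · exact Or.inl ⟨hy.1, h⟩
    · exact Or.inr h
  · rw [Measure.addHaar_sphere, add_zero]

lemma exists_lt_exp_mul {c δ B L₀ : ℝ} (hc : 0 < c) (hδ : 0 < δ) :
    ∃ L, L₀ ≤ L ∧ B < c * Real.exp (-L) * Real.exp ((1 + δ) * L) := by
  have ht : Tendsto (fun L : ℝ => c * Real.exp (δ * L)) atTop atTop :=
    (Real.tendsto_exp_atTop.comp (tendsto_id.const_mul_atTop hδ)).const_mul_atTop hc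
  obtain ⟨L, hL, hL'⟩ := ((eventually_ge_atTop L₀).and (ht.eventually_gt_atTop B)).exists
  refine ⟨L, hL, ?_⟩
  rwa [mul_assoc, ← Real.exp_add, show -L + (1 + δ) * L = δ * L by ring]

/-- Sharpness of the constant in the Adams inequality on any set of positive volume. -/
lemma not_adamsBound_of_lt (hα0 : 0 < α) (hαn : α < n) {Ω : Set (EuclideanSpace ℝ (Fin n))}
    (hΩ : NullMeasurableSet Ω volume) {E : Set (EuclideanSpace ℝ (Fin n))} (hEΩ : E ⊆ Ω)
    (hEn : NullMeasurableSet E volume) (hE0 : 0 < volume E) (hE : volume E < ∞) {γ : ℝ}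
    (hγ : 1 / unitBallVolume n < γ) : ¬ ∃ C : ℝ, AdamsBound Ω α γ E C := by
  rintro ⟨B, hB⟩
  have hpq := holderConjugate_div hα0 hαn
  have hp := hpq.pos
  have hq := hpq.symm.pos
  have hn' : (0 : ℝ) < n := by linarith
  have hn : 0 < n := by exact_mod_cast hn'
  have hκ := unitBallVolume_pos n
  set κ := unitBallVolume n with hκdef
  have hγ0 : 0 < γ := (by positivity : 0 < 1 / κ).trans hγ
  obtain ⟨Ω', hΩ'sub, hΩ'm, hΩ'⟩ := hΩ.exists_measurable_subset_ae_eq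
  obtain ⟨θ, d, δ, hθ0, hθ1, hd0, hd1, hδ0, hpar⟩ := exists_sharp_parameters hα0 hαn hκ hγ
  obtain ⟨x, r₁, hr₁, hdens⟩ := exists_density_point hn hE0 hd1
  set C := |d * n * κ * Real.log r₁| + κ with hC
  have hC0 : 0 ≤ C := by positivity
  obtain ⟨L₀, hL₀⟩ := hpar C hC0
  set V := (volume E).toReal with hV
  obtain ⟨L, hL, hLB⟩ := exists_lt_exp_mul (c := d * κ * θ ^ (n : ℝ)) (δ := δ)
    (B := |B| * (1 + V)) (L₀ := max L₀ (max ((1 + C) / (d * κ)) (-(n * Real.log r₁))))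
    (by positivity) hδ0
  have hL1 : L₀ ≤ L := (le_max_left _ _).trans hL
  have hL2 : 1 ≤ d * κ * L - C := by
    have := ((le_max_left _ _).trans (le_max_right _ _)).trans hL
    rw [div_le_iff₀' (by positivity)] at this
    linarith
  have hL3 : -(n * Real.log r₁) ≤ L := ((le_max_right _ _).trans (le_max_right _ _)).trans hL
  set ε := Real.exp (-(L / n)) with hε
  have hε0 : 0 < ε := Real.exp_pos _
  have hεr : ε ≤ r₁ := by
    rw [hε, ← Real.le_log_iff_exp_le hr₁, ← neg_div, div_le_iff₀' hn']
    linarith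
  have hεn : ε ^ (n : ℝ) = Real.exp (-L) := by
    rw [hε, ← Real.exp_mul, neg_mul, div_mul_cancel₀ _ hn'.ne']
  set W := Ω' ∩ (Metric.ball x r₁ \ Metric.ball x ε) with hW
  have hWs : W ⊆ Metric.ball x r₁ \ Metric.ball x ε := inter_subset_right
  have hWm : MeasurableSet W :=
    hΩ'm.inter (Metric.isOpen_ball.measurableSet.diff Metric.isOpen_ball.measurableSet)
  set A := ∫ y in W, ‖x - y‖ ^ (-(n : ℝ)) with hA
  have hAlow : d * κ * L - C ≤ A := by
    have h1 := log_le_lintegral_shell x hn Ω' hε0 hεr hd0.le (fun r hr hr' => by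
      refine (hdens r (hε0.trans hr) hr').trans ?_
      rw [measure_congr (hΩ'.inter (ae_eq_refl (Metric.ball x r)))]
      exact measure_mono (inter_subset_inter_left _ hEΩ))
    rw [← ofReal_integral_eq_lintegral_ofReal (integrableOn_shell hε0 hWm hWs)
      (ae_of_all _ fun y => by positivity), ← hA, ← ENNReal.ofReal_add
      (integral_nonneg fun y => by positivity) hκ.le, ENNReal.ofReal_le_ofReal_iff
      (add_nonneg (integral_nonneg fun y => by positivity) hκ.le),
      Real.log_div hr₁.ne' hε0.ne', hε, Real.log_exp] at h1
    have h2 : d * (n * κ * (Real.log r₁ - -(L / n))) =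
        d * κ * L + d * n * κ * Real.log r₁ := by field_simp; ring
    have h3 := neg_abs_le (d * n * κ * Real.log r₁)
    rw [← hκdef, h2] at h1
    linarith
  have hA0 : 0 < A := by linarith
  obtain ⟨hb1, hb2⟩ := lintegral_shellFun_bounds (w := fun _ => 1) (G := 1) hα0 hαn hε0 hWm hWs
    hWm subset_rfl (fun _ _ => rfl) zero_le_one (fun _ _ => by simp)
  obtain ⟨N, hN0, hN1, hN2, hmem, hnorm, hpot⟩ := exists_normalized hp
    (measurable_shellFun (α := α) (x := x) hWm measurable_const) hA0 hb1 hb2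
  rw [Set.sdiff_self] at hN2
  simp only [Measure.restrict_empty, integral_zero_measure, mul_zero, add_zero] at hN2
  have h1 := hB _ ⟨hmem, ae_of_all _ fun y hy => by
    rw [shellFun, indicator_of_notMem fun hyW => hy (hΩ'sub hyW.1), mul_zero]⟩ hnorm.le
  -- On E ∩ B(x,θε), of volume at least dκθⁿe^{-L}, the integrand is at least e^{(1+δ)L}; the
  -- product grows like e^{δL}.
  have hlow : ENNReal.ofReal (Real.exp ((1 + δ) * L)) *
      ENNReal.ofReal (d * κ * (θ * ε) ^ (n : ℝ)) ≤ ENNReal.ofReal B * (1 + volume E) := by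
    refine le_trans ?_ h1
    calc ENNReal.ofReal (Real.exp ((1 + δ) * L)) * ENNReal.ofReal (d * κ * (θ * ε) ^ (n : ℝ))
        ≤ ENNReal.ofReal (Real.exp ((1 + δ) * L)) * volume (E ∩ Metric.ball x (θ * ε)) := by
          refine mul_le_mul_right (hdens _ (by positivity) ?_) _
          exact (mul_le_of_le_one_left hε0.le hθ1.le).trans hεr
      _ = ∫⁻ z in E ∩ Metric.ball x (θ * ε), ENNReal.ofReal (Real.exp ((1 + δ) * L)) := by
          rw [setLIntegral_const]
      _ ≤ ∫⁻ z in E ∩ Metric.ball x (θ * ε), ENNReal.ofReal (Real.exp (γ *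
            |rieszPotential α (fun y => N⁻¹ * shellFun α x W (fun _ => 1) y) z| ^
              ((n : ℝ) / (n - α)))) := by
          refine lintegral_mono_ae ?_
          filter_upwards [ae_restrict_mem₀
            (hEn.inter Metric.isOpen_ball.measurableSet.nullMeasurableSet)] with z hz
          have hz2 := hz.2
          rw [Metric.mem_ball, dist_eq_norm] at hz2
          have hl := le_rieszPotential_shellFun (w := fun _ => 1) (G := 1) hαn hε0 hWm hWs hWm
            subset_rfl measurable_const (fun _ _ => rfl) (fun _ _ => by simp) hθ0.le hθ1 hz2.le
          rw [Set.sdiff_self] at hl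
          simp only [Measure.restrict_empty, integral_zero_measure, mul_zero, sub_zero] at hl
          refine ENNReal.ofReal_le_ofReal (Real.exp_le_exp.2 ?_)
          refine hL₀ L hL1 A N _ hAlow hN0 (by linarith) ?_
          rw [hpot, abs_mul, abs_of_nonneg (inv_nonneg.2 hN0.le), mul_inv_cancel_left₀ hN0.ne']
          linarith [le_abs_self (rieszPotential α (shellFun α x W fun _ => 1) z)]
      _ ≤ _ := lintegral_mono_set inter_subset_left
  rw [← ENNReal.ofReal_mul (Real.exp_nonneg _), Real.mul_rpow hθ0.le hε0.le, hεn] at hlow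
  have hup : ENNReal.ofReal B * (1 + volume E) ≤ ENNReal.ofReal (|B| * (1 + V)) := by
    rw [ENNReal.ofReal_mul (abs_nonneg _), ENNReal.ofReal_add zero_le_one ENNReal.toReal_nonneg,
      ENNReal.ofReal_one, ENNReal.ofReal_toReal hE.ne]
    gcongr
    exact le_abs_self B
  have h2 := (ENNReal.ofReal_le_ofReal_iff (by positivity)).1 (hlow.trans hup)
  linarith

end Sharp

/-! ### Combinations of dilated kernels with fast decay -/

section Cancel

/-- Weights of total mass `1` that, after multiplication by `2^{js}`, annihilate the polynomials
of degree at most `K` on the powers of two. -/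
lemma exists_annihilating_weights {s : ℝ} (hs : 0 < s) (K : ℕ) :
    ∃ b : ℕ → ℝ, ∑ j ∈ Finset.range (K + 2), b j = 1 ∧
      ∀ p : Polynomial ℝ, p.natDegree ≤ K →
        ∑ j ∈ Finset.range (K + 2), b j * ((2 : ℝ) ^ j) ^ s * p.eval (2 ^ j) = 0 := by
  -- The weights are the coefficients of P times 2^{-sj}, divided by P(2^{-s}). Multiplication by
  -- 2^{js} undoes the twist, so the k-th moment is a multiple of P(2^k) = 0. The total mass can be
  -- normalized because 2^{-s} < 1 is not a root of P.
  set P : Polynomial ℝ :=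
    ∏ k ∈ Finset.range (K + 1), (Polynomial.X - Polynomial.C ((2 : ℝ) ^ k)) with hP
  have hdeg : P.natDegree < K + 2 := by
    rw [hP, Polynomial.natDegree_finsetProd_X_sub_C_eq_card, Finset.card_range]
    omega
  have hev : ∀ x, P.eval x = ∏ k ∈ Finset.range (K + 1), (x - 2 ^ k) := by
    intro x
    simp [hP, Polynomial.eval_prod]
  have hx1 : (2 : ℝ) ^ (-s) < 1 := Real.rpow_lt_one_of_one_lt_of_neg (by norm_num) (by linarith)
  have hc : P.eval ((2 : ℝ) ^ (-s)) ≠ 0 := by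
    rw [hev, Finset.prod_ne_zero_iff]
    intro k _
    have : (1 : ℝ) ≤ 2 ^ k := one_le_pow₀ (by norm_num)
    linarith
  refine ⟨fun j => (P.eval ((2 : ℝ) ^ (-s)))⁻¹ * (P.coeff j * ((2 : ℝ) ^ (-s)) ^ j), ?_, ?_⟩
  · rw [← Finset.mul_sum, ← Polynomial.eval_eq_sum_range' hdeg, inv_mul_cancel₀ hc]
  · intro p hp
    have hpow : ∀ j : ℕ, ((2 : ℝ) ^ (-s)) ^ j * ((2 : ℝ) ^ j) ^ s = 1 := by
      intro j
      rw [← Real.rpow_natCast, ← Real.rpow_natCast, ← Real.rpow_mul two_pos.le,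
        ← Real.rpow_mul two_pos.le, ← Real.rpow_add two_pos]
      rw [show -s * (j : ℝ) + j * s = 0 by ring, Real.rpow_zero]
    have hterm : ∀ j ∈ Finset.range (K + 2),
        (P.eval ((2 : ℝ) ^ (-s)))⁻¹ * (P.coeff j * ((2 : ℝ) ^ (-s)) ^ j) * ((2 : ℝ) ^ j) ^ s *
          p.eval (2 ^ j) = (P.eval ((2 : ℝ) ^ (-s)))⁻¹ *
            ∑ k ∈ Finset.range (K + 1), p.coeff k * (P.coeff j * ((2 : ℝ) ^ k) ^ j) := by
      intro j _
      rw [Polynomial.eval_eq_sum_range' (Nat.lt_succ_of_le hp), mul_assoc, mul_assoc, mul_assoc,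
        ← mul_assoc _ _ (∑ i ∈ _, _), hpow, one_mul, Finset.mul_sum]
      congr 1
      refine Finset.sum_congr rfl fun k _ => ?_
      rw [← pow_mul, ← pow_mul, mul_comm j k]
      ring
    rw [Finset.sum_congr rfl hterm, ← Finset.mul_sum, Finset.sum_comm]
    refine mul_eq_zero_of_right _ (Finset.sum_eq_zero fun k hk => ?_)
    rw [← Finset.mul_sum, ← Polynomial.eval_eq_sum_range' hdeg, hev,
      Finset.prod_eq_zero hk (sub_self _), mul_zero]

/-- The Taylor approximation of `(1 + u)^r` at `0`. -/
lemma exists_taylor_one_add_rpow (r : ℝ) (N : ℕ) :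
    ∃ (q : ℕ → ℝ) (ε M : ℝ), 0 < ε ∧ ε ≤ 1 / 2 ∧ 0 ≤ M ∧ ∀ u : ℝ, |u| ≤ ε →
      |(1 + u) ^ r - ∑ k ∈ Finset.range N, q k * u ^ k| ≤ M * |u| ^ N := by
  have h := (Real.one_add_rpow_hasFPowerSeriesAt_zero (a := r)).isBigO_sub_partialSum_pow N
  obtain ⟨M, hM, hb⟩ := h.exists_nonneg
  obtain ⟨ε, hε, hε'⟩ := Metric.eventually_nhds_iff.1 hb.bound
  refine ⟨(binomialSeries ℝ r).coeff, min (ε / 2) (1 / 2), M, by positivity, min_le_right _ _, hM,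
    fun u hu => ?_⟩
  have h1 := @hε' u (by
    rw [dist_zero_right, Real.norm_eq_abs]
    linarith [min_le_left (ε / 2) (1 / 2 : ℝ)])
  simp only [FormalMultilinearSeries.partialSum, FormalMultilinearSeries.apply_eq_pow_smul_coeff,
    smul_eq_mul, zero_add, Real.norm_eq_abs, abs_pow, abs_abs] at h1
  simpa only [mul_comm] using h1

variable {E : Type*} [NormedAddCommGroup E] [InnerProductSpace ℝ E]

/-- Decay of a combination of dilated kernels whose moments vanish. -/
lemma exists_sum_rpow_le (s : ℝ) (N J : ℕ) (t c : ℕ → ℝ)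
    (hc : ∀ p : Polynomial ℝ, p.natDegree ≤ 2 * N →
      ∑ j ∈ Finset.range J, c j * p.eval (t j) = 0) {T ρ : ℝ} (hρ : 0 < ρ) (hT : 0 < T)
    (ht : ∀ j ∈ Finset.range J, |t j| ≤ T) :
    ∃ R M : ℝ, T * ρ < R ∧ 0 ≤ M ∧ ∀ h v : E, R ≤ ‖h‖ → ‖v‖ ≤ ρ →
      |∑ j ∈ Finset.range J, c j * ‖h - t j • v‖ ^ (-s)| ≤ M * ‖h‖ ^ (-s - N) := by
  obtain ⟨q, ε, M, hε, hε1, hM, hq⟩ := exists_taylor_one_add_rpow (-s / 2) N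
  refine ⟨3 * T * ρ / ε, (∑ j ∈ Finset.range J, |c j|) * (M * (3 * T * ρ) ^ N), ?_, by positivity,
    fun h v hh hv => ?_⟩
  · rw [lt_div_iff₀ hε]
    nlinarith [mul_pos hT hρ]
  have hTρ : 0 < T * ρ := mul_pos hT hρ
  have hh0 : 0 < ‖h‖ := (by positivity : 0 < 3 * T * ρ / ε).trans_le hh
  have hhT : T * ρ ≤ ‖h‖ := by
    refine le_trans ?_ hh
    rw [le_div_iff₀ hε]
    nlinarith
  set a := ‖v‖ ^ 2 / ‖h‖ ^ 2 with ha
  set b := 2 * inner ℝ h v / ‖h‖ ^ 2 with hb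
  -- ‖h - t v‖² = ‖h‖²(1 + U(t)) with U quadratic in t and of size O(1/‖h‖). A Taylor polynomial in
  -- U is then a polynomial in t, annihilated by the weights, and only the remainder O(‖h‖^{-N})
  -- survives.
  set U : Polynomial ℝ := Polynomial.C a * Polynomial.X ^ 2 - Polynomial.C b * Polynomial.X with hU
  have hUdeg : U.natDegree ≤ 2 := by
    rw [hU]
    compute_degree
  have hUe : ∀ x, U.eval x = a * x ^ 2 - b * x := fun x => by simp [hU]
  have hnorm : ∀ x : ℝ, ‖h - x • v‖ ^ 2 = ‖h‖ ^ 2 * (1 + U.eval x) := by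
    intro x
    rw [norm_sub_sq_real, inner_smul_right, norm_smul, hUe, ha, hb, mul_pow, Real.norm_eq_abs,
      sq_abs]
    field_simp
    ring
  have hUle : ∀ j ∈ Finset.range J, |U.eval (t j)| ≤ 3 * T * ρ / ‖h‖ := by
    intro j hj
    have h1 : |a * t j ^ 2| ≤ T * ρ / ‖h‖ := by
      rw [ha, abs_mul, abs_of_nonneg (by positivity), abs_of_nonneg (by positivity),
        div_mul_eq_mul_div, div_le_div_iff₀ (by positivity) hh0, ← sq_abs (t j), ← mul_pow]
      have : ‖v‖ * |t j| ≤ T * ρ := by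
        rw [mul_comm]
        exact mul_le_mul (ht j hj) hv (norm_nonneg _) hT.le
      calc (‖v‖ * |t j|) ^ 2 * ‖h‖ ≤ (T * ρ) ^ 2 * ‖h‖ := by gcongr
        _ = T * ρ * (T * ρ * ‖h‖) := by ring
        _ ≤ T * ρ * (‖h‖ * ‖h‖) := by gcongr
        _ = _ := by ring
    have h2 : |b * t j| ≤ 2 * T * ρ / ‖h‖ := by
      rw [hb, abs_mul, abs_div, abs_mul, abs_of_nonneg (by positivity : (0 : ℝ) ≤ ‖h‖ ^ 2), abs_two,
        div_mul_eq_mul_div, div_le_div_iff₀ (by positivity) hh0]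
      calc 2 * |inner ℝ h v| * |t j| * ‖h‖ ≤ 2 * (‖h‖ * ρ) * T * ‖h‖ := by
            gcongr
            · exact (abs_real_inner_le_norm h v).trans (by gcongr)
            · exact ht j hj
        _ = _ := by ring
    rw [hUe]
    calc |a * t j ^ 2 - b * t j| ≤ |a * t j ^ 2| + |b * t j| := abs_sub _ _
      _ ≤ T * ρ / ‖h‖ + 2 * T * ρ / ‖h‖ := add_le_add h1 h2
      _ = _ := by ring
  have hUε : ∀ j ∈ Finset.range J, |U.eval (t j)| ≤ ε := by
    intro j hj
    refine (hUle j hj).trans ?_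
    rwa [div_le_comm₀ hh0 hε]
  have hker : ∀ j ∈ Finset.range J,
      ‖h - t j • v‖ ^ (-s) = ‖h‖ ^ (-s) * (1 + U.eval (t j)) ^ (-s / 2) := by
    intro j hj
    have hpos : 0 ≤ 1 + U.eval (t j) := by linarith [neg_abs_le (U.eval (t j)), hUε j hj]
    have e : ∀ x : ℝ, 0 ≤ x → x ^ (-s) = (x ^ 2) ^ (-s / 2) := by
      intro x hx
      rw [← Real.rpow_natCast, ← Real.rpow_mul hx]
      congr 1
      push_cast
      ring
    rw [e _ (norm_nonneg _), hnorm, Real.mul_rpow (by positivity) hpos, ← e _ (norm_nonneg _)]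
  have hzero : ∑ j ∈ Finset.range J,
      c j * ∑ k ∈ Finset.range N, q k * U.eval (t j) ^ k = 0 := by
    have := hc (∑ k ∈ Finset.range N, Polynomial.C (q k) * U ^ k) (by
      refine Polynomial.natDegree_sum_le_of_forall_le _ _ fun k hk => ?_
      refine (Polynomial.natDegree_C_mul_le _ _).trans (Polynomial.natDegree_pow_le.trans ?_)
      rw [Finset.mem_range] at hk
      nlinarith)
    simpa [Polynomial.eval_finsetSum] using this
  have hsum : ∑ j ∈ Finset.range J, c j * ‖h - t j • v‖ ^ (-s) =
      ‖h‖ ^ (-s) * ∑ j ∈ Finset.range J, c j * ((1 + U.eval (t j)) ^ (-s / 2) -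
        ∑ k ∈ Finset.range N, q k * U.eval (t j) ^ k) := by
    simp only [mul_sub, Finset.sum_sub_distrib]
    rw [hzero, mul_zero, sub_zero, Finset.mul_sum]
    refine Finset.sum_congr rfl fun j hj => ?_
    rw [hker j hj]
    ring
  rw [hsum, abs_mul, abs_of_nonneg (by positivity)]
  calc ‖h‖ ^ (-s) * |∑ j ∈ Finset.range J, c j * ((1 + U.eval (t j)) ^ (-s / 2) -
        ∑ k ∈ Finset.range N, q k * U.eval (t j) ^ k)|
      ≤ ‖h‖ ^ (-s) * ∑ j ∈ Finset.range J, |c j| * (M * (3 * T * ρ / ‖h‖) ^ N) := by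
        gcongr
        refine (Finset.abs_sum_le_sum_abs _ _).trans (Finset.sum_le_sum fun j hj => ?_)
        rw [abs_mul]
        gcongr
        refine (hq _ (hUε j hj)).trans ?_
        gcongr
        exact hUle j hj
    _ = _ := by
        rw [← Finset.sum_mul, div_pow, Real.rpow_sub hh0, Real.rpow_natCast]
        field_simp

end Cancel

/-! ### A test function whose potential decays fast -/

/-- The step function of `|x - y|` with weight `b j` on the shell `2^j a ≤ |x - y| < 2^j ρ`. -/
noncomputable def dyadicWeight {n : ℕ} (x : EuclideanSpace ℝ (Fin n)) (a ρ : ℝ) (J : ℕ) (b : ℕ → ℝ)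
    (y : EuclideanSpace ℝ (Fin n)) : ℝ :=
  ∑ j ∈ Finset.range J, b j *
    (Metric.ball x (2 ^ j * ρ) \ Metric.ball x (2 ^ j * a)).indicator (fun _ => 1) y

section Decay

variable {n : ℕ} {α : ℝ} {x : EuclideanSpace ℝ (Fin n)} {a ρ : ℝ} {J : ℕ} {b : ℕ → ℝ}

lemma measurable_dyadicWeight : Measurable (dyadicWeight x a ρ J b) := by
  unfold dyadicWeight
  refine Finset.measurable_sum _ fun j _ => Measurable.const_mul ?_ _
  exact measurable_const.indicator
    (Metric.isOpen_ball.measurableSet.diff Metric.isOpen_ball.measurableSet)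

lemma abs_dyadicWeight_le (y : EuclideanSpace ℝ (Fin n)) :
    |dyadicWeight x a ρ J b y| ≤ ∑ j ∈ Finset.range J, |b j| := by
  refine (Finset.abs_sum_le_sum_abs _ _).trans (Finset.sum_le_sum fun j _ => ?_)
  rw [abs_mul]
  refine mul_le_of_le_one_right (abs_nonneg _) ?_
  by_cases hy : y ∈ Metric.ball x (2 ^ j * ρ) \ Metric.ball x (2 ^ j * a)
  · rw [indicator_of_mem hy, abs_one]
  · rw [indicator_of_notMem hy, abs_zero]
    exact zero_le_one

lemma two_pow_mul_le (ha : 0 ≤ a) {j : ℕ} (hj : j ∈ Finset.range J) :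
    2 ^ j * a ≤ 2 ^ J * a := by
  rw [Finset.mem_range] at hj
  exact mul_le_mul_of_nonneg_right (pow_le_pow_right₀ one_le_two hj.le) ha

lemma le_two_pow_mul (ha : 0 ≤ a) (j : ℕ) : a ≤ 2 ^ j * a :=
  le_mul_of_one_le_left ha (one_le_pow₀ one_le_two)

/-- This region belongs to every dilated shell. With weights of total mass 1, the modified test
function agrees there with |x-y|^{-α}. -/
lemma dyadicWeight_eq (ha : 0 ≤ a) (hρ : 0 ≤ ρ) {y : EuclideanSpace ℝ (Fin n)}
    (hy : y ∈ Metric.ball x ρ \ Metric.ball x (2 ^ J * a)) :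
    dyadicWeight x a ρ J b y = ∑ j ∈ Finset.range J, b j := by
  refine Finset.sum_congr rfl fun j hj => ?_
  rw [indicator_of_mem, mul_one]
  exact ⟨Metric.ball_subset_ball (le_two_pow_mul hρ j) hy.1,
    fun h => hy.2 (Metric.ball_subset_ball (two_pow_mul_le ha hj) h)⟩

lemma shellFun_dyadicWeight (ha : 0 ≤ a) (hρ : 0 ≤ ρ) (y : EuclideanSpace ℝ (Fin n)) :
    shellFun α x (Metric.ball x (2 ^ J * ρ) \ Metric.ball x a) (dyadicWeight x a ρ J b) y =
      ∑ j ∈ Finset.range J, b j *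
        shellFun α x (Metric.ball x (2 ^ j * ρ) \ Metric.ball x (2 ^ j * a)) (fun _ => 1) y := by
  have hsub : ∀ j ∈ Finset.range J, Metric.ball x (2 ^ j * ρ) \ Metric.ball x (2 ^ j * a) ⊆
      Metric.ball x (2 ^ J * ρ) \ Metric.ball x a := fun j hj =>
    sdiff_subset_sdiff (Metric.ball_subset_ball (two_pow_mul_le hρ hj))
      (Metric.ball_subset_ball (le_two_pow_mul ha j))
  by_cases hy : y ∈ Metric.ball x (2 ^ J * ρ) \ Metric.ball x a
  · rw [shellFun, indicator_of_mem hy, dyadicWeight, Finset.mul_sum]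
    refine Finset.sum_congr rfl fun j _ => ?_
    rw [shellFun]
    by_cases hyj : y ∈ Metric.ball x (2 ^ j * ρ) \ Metric.ball x (2 ^ j * a)
    · simp only [indicator_of_mem hyj]
      ring
    · simp only [indicator_of_notMem hyj, mul_zero]
  · rw [shellFun, indicator_of_notMem hy]
    refine (Finset.sum_eq_zero fun j hj => ?_).symm
    rw [shellFun, indicator_of_notMem fun h => hy (hsub j hj h), mul_zero]

lemma integrable_mul_shellFun (ha : 0 < a) {R : ℝ} {z : EuclideanSpace ℝ (Fin n)} (hαn : α < n)
    (hα0 : 0 < α) (hz : R < ‖z - x‖) :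
    Integrable fun y => ‖z - y‖ ^ (α - (n : ℝ)) *
      shellFun α x (Metric.ball x R \ Metric.ball x a) (fun _ => 1) y := by
  have hW : MeasurableSet (Metric.ball x R \ Metric.ball x a) :=
    Metric.isOpen_ball.measurableSet.diff Metric.isOpen_ball.measurableSet
  have hfin : volume (Metric.ball x R \ Metric.ball x a) < ∞ :=
    (measure_mono sdiff_subset).trans_lt measure_ball_lt_top
  have heq : (fun y => ‖z - y‖ ^ (α - (n : ℝ)) *
      shellFun α x (Metric.ball x R \ Metric.ball x a) (fun _ => 1) y) =
      (Metric.ball x R \ Metric.ball x a).indicator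
        fun y => ‖z - y‖ ^ (α - (n : ℝ)) * ‖x - y‖ ^ (-α) := by
    ext y
    by_cases hy : y ∈ Metric.ball x R \ Metric.ball x a <;> simp only [shellFun, hy,
      indicator_of_mem, indicator_of_notMem, not_false_eq_true, mul_one, mul_zero]
  rw [heq, integrable_indicator_iff hW]
  refine Measure.integrableOn_of_bounded (M := (‖z - x‖ - R) ^ (α - (n : ℝ)) * a ^ (-α)) hfin.ne
    (by fun_prop : Measurable fun y : EuclideanSpace ℝ (Fin n) =>
      ‖z - y‖ ^ (α - (n : ℝ)) * ‖x - y‖ ^ (-α)).aestronglyMeasurable ?_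
  filter_upwards [ae_restrict_mem hW] with y hy
  rw [Real.norm_of_nonneg (by positivity)]
  have h1 := le_norm_of_mem_shell subset_rfl hy
  have h2 : ‖z - x‖ - R ≤ ‖z - y‖ := by
    have h3 := hy.1
    rw [Metric.mem_ball, dist_eq_norm] at h3
    have := norm_add_le (z - y) (y - x)
    rw [sub_add_sub_cancel] at this
    linarith
  gcongr ?_ * ?_
  · exact Real.rpow_le_rpow_of_nonpos (by linarith) h2 (by linarith)
  · exact Real.rpow_le_rpow_of_nonpos ha h1 (by linarith)

/-- The potential of a dilated shell function in terms of the undilated one. -/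
lemma integral_mul_shellFun_dilate {t : ℝ} (ht : 0 < t) (z : EuclideanSpace ℝ (Fin n)) :
    ∫ y, ‖z - y‖ ^ (α - (n : ℝ)) *
        shellFun α x (Metric.ball x (t * ρ) \ Metric.ball x (t * a)) (fun _ => 1) y =
      t ^ ((n : ℝ) - α) * ∫ v, ‖z - x - t • v‖ ^ (α - (n : ℝ)) *
        shellFun α 0 (Metric.ball 0 ρ \ Metric.ball 0 a) (fun _ => 1) v := by
  set F : EuclideanSpace ℝ (Fin n) → ℝ := fun y => ‖z - y‖ ^ (α - (n : ℝ)) *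
        shellFun α x (Metric.ball x (t * ρ) \ Metric.ball x (t * a)) (fun _ => 1) y with hF
  have h1 : ∫ y, F y = t ^ n * ∫ v, F (x + t • v) := by
    have h2 := Measure.integral_comp_smul volume (fun y => F (x + y)) t
    rw [integral_add_left_eq_self, finrank_euclideanSpace, Fintype.card_fin, smul_eq_mul,
      abs_of_nonneg (by positivity)] at h2
    rw [h2, mul_inv_cancel_left₀ (by positivity)]
  have hmem : ∀ (v : EuclideanSpace ℝ (Fin n)) (r : ℝ),
      x + t • v ∈ Metric.ball x (t * r) ↔ v ∈ Metric.ball 0 r := by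
    intro v r
    rw [Metric.mem_ball, dist_eq_norm, add_sub_cancel_left, norm_smul, Real.norm_of_nonneg ht.le,
      mem_ball_zero_iff, mul_lt_mul_iff_right₀ ht]
  have h3 : ∀ v, F (x + t • v) = t ^ (-α) * (‖z - x - t • v‖ ^ (α - (n : ℝ)) *
      shellFun α 0 (Metric.ball 0 ρ \ Metric.ball 0 a) (fun _ => 1) v) := by
    intro v
    have hiff : x + t • v ∈ Metric.ball x (t * ρ) \ Metric.ball x (t * a) ↔
        v ∈ Metric.ball (0 : EuclideanSpace ℝ (Fin n)) ρ \ Metric.ball 0 a := by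
      rw [Set.mem_sdiff, Set.mem_sdiff, hmem, hmem]
    simp only [hF, shellFun]
    rw [← sub_sub]
    by_cases hv : v ∈ Metric.ball (0 : EuclideanSpace ℝ (Fin n)) ρ \ Metric.ball 0 a
    · rw [indicator_of_mem hv, indicator_of_mem (hiff.2 hv), sub_add_cancel_left, norm_neg,
        norm_smul, Real.norm_of_nonneg ht.le, Real.mul_rpow ht.le (norm_nonneg _), zero_sub,
        norm_neg]
      ring
    · rw [indicator_of_notMem hv, indicator_of_notMem fun h => hv (hiff.1 h)]
      ring
  -- The Jacobian tⁿ and the homogeneity t^{-α} combine to t^{n-α}, the factor (2^j)^s for which the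
  -- weights were designed.
  rw [h1, integral_congr_ae (ae_of_all _ h3), integral_const_mul, ← mul_assoc,
    ← Real.rpow_natCast, ← Real.rpow_add ht, ← sub_eq_add_neg]

/-- For suitable weights, the potential of a test function decays fast away from its support,
uniformly in the inner radius. -/
lemma exists_decay (hα0 : 0 < α) (hαn : α < n) (N : ℕ) (hρ : 0 < ρ) (J : ℕ) (b : ℕ → ℝ)
    (hb : ∀ p : Polynomial ℝ, p.natDegree ≤ 2 * N →
      ∑ j ∈ Finset.range J, b j * ((2 : ℝ) ^ j) ^ ((n : ℝ) - α) * p.eval (2 ^ j) = 0) :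
    ∃ R D : ℝ, 2 ^ J * ρ < R ∧ 0 ≤ D ∧ ∀ (x z : EuclideanSpace ℝ (Fin n)) (a : ℝ), 0 < a →
      R ≤ ‖z - x‖ →
      |rieszPotential α (shellFun α x (Metric.ball x (2 ^ J * ρ) \ Metric.ball x a)
        (dyadicWeight x a ρ J b)) z| ≤ D * ‖z - x‖ ^ (α - n - N) := by
  have hn' : (0 : ℝ) < n := by linarith
  have hn : 0 < n := by exact_mod_cast hn'
  have hκ := unitBallVolume_pos n
  obtain ⟨R, M, hR, hM, hRM⟩ := exists_sum_rpow_le (E := EuclideanSpace ℝ (Fin n))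
    ((n : ℝ) - α) N J (fun j => 2 ^ j) _ hb (T := 2 ^ J) hρ (by positivity) (fun j hj => by
      rw [abs_of_nonneg (by positivity)]
      simpa using two_pow_mul_le (a := 1) zero_le_one hj)
  set I := n / (n - α) * unitBallVolume n * ρ ^ ((n : ℝ) - α) with hI
  have hnα : 0 < (n : ℝ) - α := by linarith
  have hI0 : 0 ≤ I := by positivity
  refine ⟨R, M * I, hR, by positivity, fun x z a ha hz => ?_⟩
  set φ : EuclideanSpace ℝ (Fin n) → ℝ :=
    shellFun α 0 (Metric.ball 0 ρ \ Metric.ball 0 a) (fun _ => 1) with hφ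
  have hφm : Measurable φ := measurable_shellFun
    (Metric.isOpen_ball.measurableSet.diff Metric.isOpen_ball.measurableSet) measurable_const
  have hφ0 : ∀ v, 0 ≤ φ v := fun v => by
    rw [hφ, shellFun]
    exact indicator_nonneg (fun v _ => by positivity) v
  -- Since α < n, |v|^{-α} is integrable at the origin; this makes the decay constant independent of
  -- the inner radius a.
  have hφI : ∫⁻ v, ENNReal.ofReal (φ v) ≤ ENNReal.ofReal I := by
    refine le_trans ?_ (setLIntegral_ball_rpow_le 0 hn hα0 hαn hρ)
    rw [← lintegral_indicator Metric.isOpen_ball.measurableSet]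
    refine lintegral_mono fun v => ?_
    by_cases hv : v ∈ Metric.ball (0 : EuclideanSpace ℝ (Fin n)) ρ \ Metric.ball 0 a
    · rw [hφ, shellFun, indicator_of_mem hv, indicator_of_mem hv.1, mul_one]
    · rw [hφ, shellFun, indicator_of_notMem hv, ENNReal.ofReal_zero]
      exact zero_le
  have hφi : Integrable φ := by
    refine ⟨hφm.aestronglyMeasurable, ?_⟩
    rw [hasFiniteIntegral_iff_ofReal (ae_of_all _ hφ0)]
    exact hφI.trans_lt ENNReal.ofReal_lt_top
  have hφI' : ∫ v, φ v ≤ I := by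
    rw [integral_eq_lintegral_of_nonneg_ae (ae_of_all _ hφ0) hφm.aestronglyMeasurable]
    exact ENNReal.toReal_le_of_le_ofReal hI0 hφI
  have hint : ∀ j ∈ Finset.range J, Integrable fun v : EuclideanSpace ℝ (Fin n) =>
      b j * ((2 : ℝ) ^ j) ^ ((n : ℝ) - α) * (‖z - x - (2 : ℝ) ^ j • v‖ ^ (α - (n : ℝ)) * φ v) := by
    intro j hj
    refine Integrable.const_mul ?_ _
    have h1 : ∀ v ∈ Metric.ball (0 : EuclideanSpace ℝ (Fin n)) ρ,
        R - 2 ^ J * ρ ≤ ‖z - x - (2 : ℝ) ^ j • v‖ := by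
      intro v hv
      rw [mem_ball_zero_iff] at hv
      have h2 := norm_sub_norm_le (z - x) ((2 : ℝ) ^ j • v)
      rw [norm_smul, Real.norm_of_nonneg (by positivity)] at h2
      have h3 : (2 : ℝ) ^ j * ‖v‖ ≤ 2 ^ J * ρ :=
        (mul_le_mul_of_nonneg_left hv.le (by positivity)).trans (two_pow_mul_le hρ.le hj)
      linarith
    refine Integrable.mono' (hφi.const_mul ((R - 2 ^ J * ρ) ^ (α - (n : ℝ)))) ?_
      (ae_of_all _ fun v => ?_)
    · exact (by fun_prop : Measurable fun v : EuclideanSpace ℝ (Fin n) =>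
        ‖z - x - (2 : ℝ) ^ j • v‖ ^ (α - (n : ℝ)) * φ v).aestronglyMeasurable
    · rw [Real.norm_of_nonneg (mul_nonneg (by positivity) (hφ0 v))]
      by_cases hv : v ∈ Metric.ball (0 : EuclideanSpace ℝ (Fin n)) ρ
      · exact mul_le_mul_of_nonneg_right (Real.rpow_le_rpow_of_nonpos (by linarith) (h1 v hv)
          (by linarith)) (hφ0 v)
      · have : φ v = 0 := by rw [hφ, shellFun, indicator_of_notMem fun h => hv h.1]
        rw [this, mul_zero, mul_zero]
  have hpot : rieszPotential α (shellFun α x (Metric.ball x (2 ^ J * ρ) \ Metric.ball x a)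
        (dyadicWeight x a ρ J b)) z =
      ∫ v, (∑ j ∈ Finset.range J, b j * ((2 : ℝ) ^ j) ^ ((n : ℝ) - α) *
        ‖z - x - (2 : ℝ) ^ j • v‖ ^ (-((n : ℝ) - α))) * φ v := by
    simp only [rieszPotential, shellFun_dyadicWeight ha.le hρ.le, Finset.mul_sum, Finset.sum_mul,
      neg_sub]
    rw [integral_finsetSum, integral_finsetSum]
    · refine Finset.sum_congr rfl fun j _ => ?_
      simp only [mul_assoc, mul_left_comm _ (b j)]
      rw [integral_const_mul, integral_const_mul, integral_const_mul,
        integral_mul_shellFun_dilate (by positivity)]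
    · intro j hj
      simpa only [mul_assoc] using hint j hj
    · intro j hj
      simp only [mul_left_comm _ (b j)]
      refine Integrable.const_mul (integrable_mul_shellFun (by positivity) hαn hα0 ?_) _
      exact ((two_pow_mul_le hρ.le hj).trans_lt hR).trans_le hz
  rw [hpot]
  calc |∫ v, (∑ j ∈ Finset.range J, b j * ((2 : ℝ) ^ j) ^ ((n : ℝ) - α) *
        ‖z - x - (2 : ℝ) ^ j • v‖ ^ (-((n : ℝ) - α))) * φ v|
      ≤ ∫ v, M * ‖z - x‖ ^ (-((n : ℝ) - α) - N) * φ v := by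
        rw [← Real.norm_eq_abs]
        refine norm_integral_le_of_norm_le (hφi.const_mul _) (ae_of_all _ fun v => ?_)
        rw [norm_mul, Real.norm_of_nonneg (hφ0 v)]
        by_cases hv : v ∈ Metric.ball (0 : EuclideanSpace ℝ (Fin n)) ρ
        · exact mul_le_mul_of_nonneg_right (hRM _ v hz (mem_ball_zero_iff.1 hv).le) (hφ0 v)
        · have : φ v = 0 := by rw [hφ, shellFun, indicator_of_notMem fun h => hv h.1]
          rw [this, mul_zero, mul_zero]
    _ = M * ‖z - x‖ ^ (-((n : ℝ) - α) - N) * ∫ v, φ v := integral_const_mul _ _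
    _ ≤ M * ‖z - x‖ ^ (-((n : ℝ) - α) - N) * I := by gcongr
    _ = _ := by
      rw [neg_sub]
      ring

lemma lintegral_max_rpow_lt_top (x : EuclideanSpace ℝ (Fin n)) (hn : 0 < n) {β a : ℝ}
    (hβ : n < β) (ha : 0 < a) : ∫⁻ y, ENNReal.ofReal (max a ‖x - y‖ ^ (-β)) < ∞ := by
  have hβ0 : 0 < β := by
    have : (0 : ℝ) ≤ n := n.cast_nonneg
    linarith
  have hκ := unitBallVolume_pos n
  have h0 : 0 < β - n := by linarith
  rw [lintegral_max_rpow_eq _ x hβ0 ha]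
  calc ∫⁻ r in Ioi a, ENNReal.ofReal (β * r ^ (-β - 1)) * volume (Metric.ball x r)
      = ∫⁻ r in Ioi a, ENNReal.ofReal (β * unitBallVolume n / (β - n)) *
          ENNReal.ofReal ((β - n) * r ^ (-(β - n) - 1)) := by
        refine setLIntegral_congr_fun measurableSet_Ioi fun r hr => ?_
        have hr0 : 0 < r := ha.trans hr
        rw [volume_ball_eq hn x hr0.le, ← ENNReal.ofReal_mul (by positivity),
          ← ENNReal.ofReal_mul (by positivity), show -(β - n) - 1 = (-β - 1) + n by ring,
          Real.rpow_add hr0]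
        congr 1
        field_simp
    _ < ∞ := by
        rw [lintegral_const_mul' _ _ ENNReal.ofReal_ne_top, lintegral_Ioi_rpow_eq h0 ha]
        exact ENNReal.mul_lt_top ENNReal.ofReal_lt_top ENNReal.ofReal_lt_top

/-- Local boundedness of the potential operator on `L^p`. -/
lemma setLIntegral_lRiesz_rpow_le (hα0 : 0 < α) (hαn : α < n) {p q : ℝ}
    (hpq : p.HolderConjugate q) {g : EuclideanSpace ℝ (Fin n) → ℝ≥0∞} (hg : Measurable g)
    {R : ℝ} (hR : 0 < R) (hgR : ∀ y ∉ Metric.ball x R, g y = 0) :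
    ∫⁻ z in Metric.ball x R, lRiesz α g z ^ p ≤
      ENNReal.ofReal ((n / α * unitBallVolume n * (2 * R) ^ α) ^ p) * ∫⁻ y, g y ^ p := by
  have hκ := unitBallVolume_pos n
  have hn' : (0 : ℝ) < n := by linarith
  set K : EuclideanSpace ℝ (Fin n) → ℝ≥0∞ :=
    (Metric.ball 0 (2 * R)).indicator (rieszKernel α) with hK
  have hKm : Measurable K := measurable_rieszKernel.indicator Metric.isOpen_ball.measurableSet
  have hKint : ∫⁻ z, K z ≤ ENNReal.ofReal (n / α * unitBallVolume n * (2 * R) ^ α) := by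
    rw [hK, lintegral_indicator Metric.isOpen_ball.measurableSet]
    have h0 := setLIntegral_ball_rieszKernel_le hα0 hαn (0 : EuclideanSpace ℝ (Fin n))
      (ρ := 2 * R) (by positivity)
    simpa [rieszKernel] using h0
  calc ∫⁻ z in Metric.ball x R, lRiesz α g z ^ p
      ≤ ∫⁻ z in Metric.ball x R, (∫⁻ y, K (z - y) * g y) ^ p := by
        refine setLIntegral_mono' Metric.isOpen_ball.measurableSet fun z hz => ?_
        refine ENNReal.rpow_le_rpow (lintegral_mono fun y => ?_) hpq.nonneg
        by_cases hy : y ∈ Metric.ball x R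
        · rw [hK, indicator_of_mem]
          rw [mem_ball_zero_iff, ← dist_eq_norm, two_mul]
          exact (dist_triangle_right z y x).trans_lt (add_lt_add hz hy)
        · rw [hgR y hy, mul_zero, mul_zero]
    _ ≤ ∫⁻ z, (∫⁻ y, K (z - y) * g y) ^ p := setLIntegral_le_lintegral _ _
    _ ≤ (∫⁻ z, K z) ^ p * ∫⁻ y, g y ^ p := lintegral_conv_rpow_le hpq hKm hg
    _ ≤ _ := by
        rw [← ENNReal.ofReal_rpow_of_nonneg (by positivity) hpq.nonneg]
        gcongr
        exact hpq.nonneg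

/-- Lets the truncated exponential replace the full one, up to a factor 2, where the potential is
large. -/
lemma eventually_exp_le_regExp (m : ℕ) :
    ∀ᶠ t in atTop, Real.exp t / 2 ≤ regExp m t := by
  have h : Tendsto (fun t : ℝ => ∑ k ∈ Finset.range (m + 1),
      ((k.factorial : ℝ))⁻¹ * (t ^ k * Real.exp (-t))) atTop
      (𝓝 (∑ k ∈ Finset.range (m + 1), ((k.factorial : ℝ))⁻¹ * 0)) :=
    tendsto_finsetSum _ fun k _ =>
      (Real.tendsto_pow_mul_exp_neg_atTop_nhds_zero k).const_mul _
  simp only [mul_zero, Finset.sum_const_zero] at h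
  filter_upwards [h.eventually (gt_mem_nhds (show (0 : ℝ) < 1 / 2 by norm_num))] with t ht
  have h1 : ∑ k ∈ Finset.range (m + 1), ((k.factorial : ℝ))⁻¹ * (t ^ k * Real.exp (-t)) =
      (∑ k ∈ Finset.range (m + 1), t ^ k / (k.factorial : ℝ)) * Real.exp (-t) := by
    rw [Finset.sum_mul]
    exact Finset.sum_congr rfl fun k _ => by ring
  rw [h1, Real.exp_neg, ← div_eq_mul_inv, div_lt_iff₀ (Real.exp_pos t)] at ht
  rw [regExp]
  linarith

end Decay

/-! ### Sharpness of the constant in the regularized inequality -/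

section RegSharp

variable {n : ℕ} {α : ℝ}

/-- Functions in the unit ball of `L^{n/α}` supported in a fixed ball whose potentials decay fast
have potentials bounded in `L^{n/α}`. -/
lemma exists_eLpNorm_potential_le (hα0 : 0 < α) (hαn : α < n) (x : EuclideanSpace ℝ (Fin n))
    {R : ℝ} (hR : 0 < R) (D : ℝ) :
    ∃ T : ℝ, 0 ≤ T ∧ ∀ f : EuclideanSpace ℝ (Fin n) → ℝ, Measurable f →
      eLpNorm f (ENNReal.ofReal (n / α)) volume ≤ 1 → (∀ y ∉ Metric.ball x R, f y = 0) →
      (∀ z, R ≤ ‖z - x‖ → |rieszPotential α f z| ≤ D * ‖z - x‖ ^ (α - n - n)) →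
      eLpNorm (rieszPotential α f) (ENNReal.ofReal (n / α)) volume ^ ((n : ℝ) / α) ≤
        ENNReal.ofReal T := by
  have hpq := holderConjugate_div hα0 hαn
  have hp := hpq.pos
  have hκ := unitBallVolume_pos n
  have hn' : (0 : ℝ) < n := by linarith
  have hn : 0 < n := by exact_mod_cast hn'
  have hp1 : 1 < (n : ℝ) / α := hpq.lt
  -- Decay of order 2n - α > n, raised to the power p > 1, is integrable at infinity; this is why n
  -- extra orders of decay suffice for every α.
  have hβ : (n : ℝ) < (2 * n - α) * (n / α) := by nlinarith
  set p := (n : ℝ) / α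
  set Z := (∫⁻ y, ENNReal.ofReal (max R ‖x - y‖ ^ (-((2 * n - α) * p)))).toReal with hZ
  have hZ' : ∫⁻ y, ENNReal.ofReal (max R ‖x - y‖ ^ (-((2 * n - α) * p))) = ENNReal.ofReal Z :=
    (ENNReal.ofReal_toReal (lintegral_max_rpow_lt_top x hn hβ hR).ne).symm
  have hZ0 : 0 ≤ Z := ENNReal.toReal_nonneg
  have hD0 : 0 ≤ |D| ^ p := by positivity
  refine ⟨(n / α * unitBallVolume n * (2 * R) ^ α) ^ p + |D| ^ p * Z, by positivity,
    fun f hf hfn hfR hfD => ?_⟩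
  rw [← lintegral_rpow_eq_of_ae_eq hp (ae_eq_refl _),
    ← lintegral_add_compl _ (Metric.isOpen_ball.measurableSet : MeasurableSet (Metric.ball x R)),
    ENNReal.ofReal_add (by positivity) (by positivity)]
  refine add_le_add ?_ ?_
  · calc ∫⁻ z in Metric.ball x R, ‖rieszPotential α f z‖ₑ ^ p
        ≤ ∫⁻ z in Metric.ball x R, lRiesz α (fun y => ‖f y‖ₑ) z ^ p :=
          lintegral_mono fun z =>
            ENNReal.rpow_le_rpow (enorm_rieszPotential_le (ae_eq_refl _) z) hp.le
      _ ≤ ENNReal.ofReal ((n / α * unitBallVolume n * (2 * R) ^ α) ^ p) * ∫⁻ y, ‖f y‖ₑ ^ p :=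
          setLIntegral_lRiesz_rpow_le hα0 hαn hpq hf.enorm hR fun y hy => by
            rw [hfR y hy, enorm_zero]
      _ ≤ ENNReal.ofReal ((n / α * unitBallVolume n * (2 * R) ^ α) ^ p) * 1 := by
          gcongr
          rw [lintegral_rpow_eq_of_ae_eq hp (ae_eq_refl _)]
          exact ENNReal.rpow_le_one hfn hp.le
      _ = _ := mul_one _
  · rw [ENNReal.ofReal_mul hD0, ← hZ', ← lintegral_const_mul' _ _ ENNReal.ofReal_ne_top]
    refine (setLIntegral_mono' Metric.isOpen_ball.measurableSet.compl fun z hz => ?_).trans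
      (setLIntegral_le_lintegral _ _)
    rw [mem_compl_iff, Metric.mem_ball, dist_eq_norm, not_lt] at hz
    rw [← ENNReal.ofReal_mul hD0, Real.enorm_eq_ofReal_abs,
      ENNReal.ofReal_rpow_of_nonneg (abs_nonneg _) hp.le, norm_sub_rev x z, max_eq_right hz]
    refine ENNReal.ofReal_le_ofReal ?_
    have h1 : |rieszPotential α f z| ≤ |D| * ‖z - x‖ ^ (α - n - n) :=
      (hfD z hz).trans (mul_le_mul_of_nonneg_right (le_abs_self D) (by positivity))
    refine (Real.rpow_le_rpow (abs_nonneg _) h1 hp.le).trans (le_of_eq ?_)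
    rw [Real.mul_rpow (abs_nonneg _) (by positivity), ← Real.rpow_mul (norm_nonneg _)]
    congr 2
    ring

lemma setIntegral_shell_le (hn : 0 < n) (x : EuclideanSpace ℝ (Fin n)) {a c : ℝ} (ha : 0 < a)
    (hc : 0 ≤ c) :
    ∫ y in Metric.ball x (c * a) \ Metric.ball x a, ‖x - y‖ ^ (-(n : ℝ)) ≤
      unitBallVolume n * c ^ (n : ℝ) := by
  have hκ := unitBallVolume_pos n
  have hfin : volume (Metric.ball x (c * a) \ Metric.ball x a) < ∞ :=
    (measure_mono sdiff_subset).trans_lt measure_ball_lt_top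
  have hW : MeasurableSet (Metric.ball x (c * a) \ Metric.ball x a) :=
    Metric.isOpen_ball.measurableSet.diff Metric.isOpen_ball.measurableSet
  calc ∫ y in Metric.ball x (c * a) \ Metric.ball x a, ‖x - y‖ ^ (-(n : ℝ))
      ≤ ∫ _ in Metric.ball x (c * a) \ Metric.ball x a, a ^ (-(n : ℝ)) := by
        refine setIntegral_mono_on (integrableOn_shell ha hW subset_rfl)
          (integrableOn_const hfin.ne) hW fun y hy => ?_
        exact Real.rpow_le_rpow_of_nonpos ha (le_norm_of_mem_shell subset_rfl hy) (by simp)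
    _ = volume.real (Metric.ball x (c * a) \ Metric.ball x a) * a ^ (-(n : ℝ)) := by
        rw [setIntegral_const, smul_eq_mul]
    _ ≤ unitBallVolume n * (c * a) ^ (n : ℝ) * a ^ (-(n : ℝ)) := by
        gcongr
        refine ENNReal.toReal_le_of_le_ofReal (by positivity) ?_
        rw [← volume_ball_eq hn x (by positivity)]
        exact measure_mono sdiff_subset
    _ = _ := by
        rw [Real.mul_rpow hc ha.le, mul_assoc, mul_assoc, ← Real.rpow_add ha, add_neg_cancel,
          Real.rpow_zero, mul_one]

/-- Sharpness of the constant in the regularized inequality on a set containing a ball. -/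
lemma not_regAdamsBound_of_lt (hα0 : 0 < α) (hαn : α < n) {Ω : Set (EuclideanSpace ℝ (Fin n))}
    (hΩ : NullMeasurableSet Ω volume) {x : EuclideanSpace ℝ (Fin n)} {r₀ : ℝ} (hr₀ : 0 < r₀)
    (hx : volume (Ω ∩ Metric.ball x r₀) = volume (Metric.ball x r₀)) {γ : ℝ}
    (hγ : 1 / unitBallVolume n < γ) : ¬ ∃ C : ℝ, RegAdamsBound Ω α γ C := by
  rintro ⟨B, hB⟩
  have hpq := holderConjugate_div hα0 hαn
  have hp := hpq.pos
  have hq := hpq.symm.pos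
  have hn' : (0 : ℝ) < n := by linarith
  have hn : 0 < n := by exact_mod_cast hn'
  have hκ := unitBallVolume_pos n
  have hb : ∀ r, MeasurableSet (Metric.ball x r) := fun r => Metric.isOpen_ball.measurableSet
  have hnull : volume (Metric.ball x r₀ \ Ω) = 0 := by
    have h1 := measure_inter_add_sdiff₀ (Metric.ball x r₀) hΩ (μ := volume)
    rw [inter_comm, hx] at h1
    exact (ENNReal.add_right_inj measure_ball_lt_top.ne).1 (h1.trans (add_zero _).symm)
  have hae : ∀ᵐ y, y ∈ Metric.ball x r₀ → y ∈ Ω := by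
    rw [ae_iff]
    convert hnull using 2
    ext y
    simp
  set κ := unitBallVolume n with hκdef
  have hγ0 : 0 < γ := (by positivity : 0 < 1 / κ).trans hγ
  obtain ⟨θ, d, δ, hθ0, hθ1, hd0, hd1, hδ0, hpar⟩ := exists_sharp_parameters hα0 hαn hκ hγ
  obtain ⟨b, hb1, hbK⟩ := exists_annihilating_weights (s := (n : ℝ) - α) (by linarith) (2 * n)
  set J := 2 * n + 2 with hJ
  have h2J : (1 : ℝ) ≤ 2 ^ J := one_le_pow₀ one_le_two
  -- The largest dilate of the shell then still fits into B(x,r₀), which Ω fills up to a null set.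
  set ρ := r₀ / 2 ^ J with hρ
  have hρ0 : 0 < ρ := by positivity
  have hρr : 2 ^ J * ρ = r₀ := mul_div_cancel₀ _ (by positivity)
  obtain ⟨R, D, hR, hD0, hdecay⟩ := exists_decay hα0 hαn n hρ0 J b hbK
  rw [hρr] at hR
  simp only [hρr] at hdecay
  obtain ⟨T, hT0, hT⟩ := exists_eLpNorm_potential_le hα0 hαn x (hr₀.trans hR) D
  set G := ∑ j ∈ Finset.range J, |b j| with hG
  have hG0 : 0 ≤ G := Finset.sum_nonneg fun j _ => abs_nonneg _
  -- The weight may differ from 1 only near the two ends of the shell, in two shells of ratio 2^J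
  -- whose integrals are bounded independently of ε.
  set A₂ := 2 * (κ * ((2 : ℝ) ^ J) ^ (n : ℝ)) with hA₂
  have hA₂0 : 0 ≤ A₂ := by positivity
  have h1θ : 0 < 1 - θ := by linarith
  set C := G ^ ((n : ℝ) / α) * A₂ + G * (1 - θ) ^ (α - (n : ℝ)) * A₂ +
    |d * n * κ * Real.log (ρ / 2 ^ J)| + κ with hC
  have hC1 : 0 ≤ G ^ ((n : ℝ) / α) * A₂ := by positivity
  have hC2 : 0 ≤ G * (1 - θ) ^ (α - (n : ℝ)) * A₂ := by positivity
  have hC3 := abs_nonneg (d * n * κ * Real.log (ρ / 2 ^ J))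
  have hC0 : 0 ≤ C := by positivity
  obtain ⟨L₀, hL₀⟩ := hpar C hC0
  obtain ⟨t₀, ht₀⟩ := eventually_atTop.1 (eventually_exp_le_regExp ⌈(n : ℝ) / α - 2⌉₊)
  obtain ⟨L, hL, hLB⟩ := exists_lt_exp_mul (c := κ * θ ^ (n : ℝ) / 2) (δ := δ)
    (B := |B| * (1 + T)) (L₀ := max (max L₀ (t₀ / (1 + δ)))
      (max ((1 + C) / (d * κ)) (-(n * Real.log (ρ / 2 ^ J))))) (by positivity) hδ0
  have hL1 : L₀ ≤ L := ((le_max_left _ _).trans (le_max_left _ _)).trans hL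
  have hL2 : 1 ≤ d * κ * L - C := by
    have := ((le_max_left _ _).trans (le_max_right _ _)).trans hL
    rw [div_le_iff₀' (by positivity)] at this
    linarith
  have hL3 : -(n * Real.log (ρ / 2 ^ J)) ≤ L :=
    ((le_max_right _ _).trans (le_max_right _ _)).trans hL
  have hL4 : t₀ ≤ (1 + δ) * L := by
    have := ((le_max_right _ _).trans (le_max_left _ _)).trans hL
    rwa [div_le_iff₀' (by positivity)] at this
  set ε := Real.exp (-(L / n)) with hε
  have hε0 : 0 < ε := Real.exp_pos _
  have hερ : ε ≤ ρ / 2 ^ J := by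
    rw [hε, ← Real.le_log_iff_exp_le (by positivity), ← neg_div, div_le_iff₀' hn']
    linarith
  have hερ' : 2 ^ J * ε ≤ ρ := by rwa [le_div_iff₀' (by positivity)] at hερ
  have hε1 : ε ≤ 2 ^ J * ε := le_two_pow_mul hε0.le J
  have hρ1 : ρ ≤ r₀ := (le_two_pow_mul hρ0.le J).trans hρr.le
  have hεn : ε ^ (n : ℝ) = Real.exp (-L) := by
    rw [hε, ← Real.exp_mul, neg_mul, div_mul_cancel₀ _ hn'.ne']
  set W := Metric.ball x r₀ \ Metric.ball x ε with hW
  set W₁ := Metric.ball x ρ \ Metric.ball x (2 ^ J * ε) with hW₁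
  set w := dyadicWeight x ε ρ J b with hw
  have hWs : W ⊆ Metric.ball x r₀ \ Metric.ball x ε := subset_rfl
  have hWm : MeasurableSet W := (hb _).diff (hb _)
  have hW₁m : MeasurableSet W₁ := (hb _).diff (hb _)
  have hWW : W₁ ⊆ W :=
    sdiff_subset_sdiff (Metric.ball_subset_ball hρ1) (Metric.ball_subset_ball hε1)
  have hw1 : ∀ y ∈ W₁, w y = 1 := fun y hy => by
    rw [hw, dyadicWeight_eq hε0.le hρ0.le hy, hb1]
  have hwG : ∀ y ∈ W, |w y| ≤ G := fun y _ => abs_dyadicWeight_le y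
  have hwm : Measurable w := measurable_dyadicWeight
  have hpos : ∀ y : EuclideanSpace ℝ (Fin n), 0 ≤ ‖x - y‖ ^ (-(n : ℝ)) := fun y => by positivity
  set A := ∫ y in W₁, ‖x - y‖ ^ (-(n : ℝ)) with hA
  have hAint : 0 ≤ A := integral_nonneg hpos
  have hA₂le : ∫ y in W \ W₁, ‖x - y‖ ^ (-(n : ℝ)) ≤ A₂ := by
    have hsub : W \ W₁ ⊆ (Metric.ball x (2 ^ J * ρ) \ Metric.ball x ρ) ∪
        (Metric.ball x (2 ^ J * ε) \ Metric.ball x ε) := by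
      rw [hρr]
      intro y hy
      by_cases hyρ : y ∈ Metric.ball x ρ
      · refine Or.inr ⟨?_, hy.1.2⟩
        by_contra h
        exact hy.2 ⟨hyρ, h⟩
      · exact Or.inl ⟨hy.1.1, hyρ⟩
    have hi1 := integrableOn_shell hρ0 ((hb (2 ^ J * ρ)).diff (hb ρ)) subset_rfl
    have hi2 := integrableOn_shell hε0 ((hb (2 ^ J * ε)).diff (hb ε)) subset_rfl
    calc ∫ y in W \ W₁, ‖x - y‖ ^ (-(n : ℝ))
        ≤ ∫ y in (Metric.ball x (2 ^ J * ρ) \ Metric.ball x ρ) ∪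
            (Metric.ball x (2 ^ J * ε) \ Metric.ball x ε), ‖x - y‖ ^ (-(n : ℝ)) :=
          setIntegral_mono_set (hi1.union hi2) (ae_of_all _ hpos)
            (ae_of_all _ hsub)
      _ = (∫ y in Metric.ball x (2 ^ J * ρ) \ Metric.ball x ρ, ‖x - y‖ ^ (-(n : ℝ))) +
            ∫ y in Metric.ball x (2 ^ J * ε) \ Metric.ball x ε, ‖x - y‖ ^ (-(n : ℝ)) := by
          refine setIntegral_union ?_ ((hb _).diff (hb _)) hi1 hi2
          refine Set.disjoint_left.2 fun y hy hy' => hy.2 ?_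
          exact Metric.ball_subset_ball hερ' hy'.1
      _ ≤ A₂ := by
          rw [hA₂, two_mul]
          exact add_le_add (setIntegral_shell_le hn x hρ0 (by positivity))
            (setIntegral_shell_le hn x hε0 (by positivity))
  have hAlow : d * κ * L - C ≤ A := by
    have h1 := log_le_lintegral_shell x hn univ (by positivity : 0 < 2 ^ J * ε) hερ' hd0.le
      (fun r hr hr' => by
        have hr0 : 0 < r := (by positivity : 0 < 2 ^ J * ε).trans hr
        rw [univ_inter, volume_ball_eq hn x hr0.le]
        refine ENNReal.ofReal_le_ofReal ?_
        rw [mul_assoc]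
        exact mul_le_of_le_one_left (by positivity) hd1.le)
    rw [univ_inter, ← hW₁, ← ofReal_integral_eq_lintegral_ofReal
      ((integrableOn_shell hε0 hWm hWs).mono_set hWW) (ae_of_all _ hpos), ← hA,
      ← ENNReal.ofReal_add hAint hκ.le, ENNReal.ofReal_le_ofReal_iff (add_nonneg hAint hκ.le),
      ← div_div, Real.log_div (by positivity) hε0.ne', hε, Real.log_exp] at h1
    have h2 : d * (n * κ * (Real.log (ρ / 2 ^ J) - -(L / n))) =
        d * κ * L + d * n * κ * Real.log (ρ / 2 ^ J) := by field_simp; ring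
    have h3 := neg_abs_le (d * n * κ * Real.log (ρ / 2 ^ J))
    rw [← hκdef, h2] at h1
    linarith
  have hA1 : 1 ≤ A := hL2.trans hAlow
  obtain ⟨hbd1, hbd2⟩ := lintegral_shellFun_bounds hα0 hαn hε0 hWm hWs hW₁m hWW hw1 hG0 hwG
  have hfm : Measurable (shellFun α x W w) := measurable_shellFun hWm hwm
  obtain ⟨N, hN0, hN1, hN2, hmem, hnorm, hpot⟩ := exists_normalized hp hfm
    (zero_lt_one.trans_le hA1) hbd1 hbd2
  have hN2' : N ^ ((n : ℝ) / α) ≤ A + C := by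
    have := mul_le_mul_of_nonneg_left hA₂le (by positivity : 0 ≤ G ^ ((n : ℝ) / α))
    linarith
  -- Division by N ≥ 1 keeps the decay bound, so the normalized potentials stay bounded in L^p as ε
  -- → 0.
  have hNone : 1 ≤ N := by
    by_contra h
    exact absurd (hA1.trans hN1) (not_le.2 (Real.rpow_lt_one hN0.le (not_le.1 h) hp))
  have hzero : ∀ y ∉ Metric.ball x r₀, N⁻¹ * shellFun α x W w y = 0 := fun y hy => by
    rw [shellFun, indicator_of_notMem fun h => hy h.1, mul_zero]
  have h1 := hB _ ⟨hmem, by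
    filter_upwards [hae] with y hy hyΩ
    exact hzero y fun h => hyΩ (hy h)⟩ hnorm.le
  have h2 := hT _ (hfm.const_mul N⁻¹) hnorm.le
    (fun y hy => hzero y fun h => hy (Metric.ball_subset_ball hR.le h)) (fun z hz => by
      rw [hpot, abs_mul, abs_of_nonneg (inv_nonneg.2 hN0.le)]
      exact (mul_le_of_le_one_left (abs_nonneg _) (inv_le_one_of_one_le₀ hNone)).trans
        (hdecay x z ε hε0 hz))
  have hθε : θ * ε ≤ r₀ := ((mul_le_of_le_one_left hε0.le hθ1.le).trans hε1).trans
    (hερ'.trans hρ1)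
  have hlow : ENNReal.ofReal (Real.exp ((1 + δ) * L) / 2) *
      ENNReal.ofReal (κ * (θ * ε) ^ (n : ℝ)) ≤ ENNReal.ofReal (|B| * (1 + T)) := by
    calc ENNReal.ofReal (Real.exp ((1 + δ) * L) / 2) * ENNReal.ofReal (κ * (θ * ε) ^ (n : ℝ))
        = ENNReal.ofReal (Real.exp ((1 + δ) * L) / 2) *
            volume.restrict Ω (Metric.ball x (θ * ε)) := by
          rw [← volume_ball_eq hn x (by positivity), Measure.restrict_apply (hb _)]
          congr 1
          refine measure_congr ?_
          filter_upwards [hae] with y hy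
          refine propext ⟨fun h => ⟨h, hy (Metric.ball_subset_ball hθε h)⟩, fun h => h.1⟩
      _ = ∫⁻ z in Metric.ball x (θ * ε), ENNReal.ofReal (Real.exp ((1 + δ) * L) / 2)
            ∂(volume.restrict Ω) := by rw [setLIntegral_const]
      _ ≤ ∫⁻ z in Metric.ball x (θ * ε), ENNReal.ofReal (regExp ⌈(n : ℝ) / α - 2⌉₊ (γ *
            |rieszPotential α (fun y => N⁻¹ * shellFun α x W w y) z| ^
              ((n : ℝ) / (n - α)))) ∂(volume.restrict Ω) := by
          refine setLIntegral_mono' (hb _) fun z hz => ?_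
          rw [Metric.mem_ball, dist_eq_norm] at hz
          have hl := le_rieszPotential_shellFun hαn hε0 hWm hWs hW₁m hWW hwm hw1 hwG hθ0.le hθ1
            hz.le
          have hA₂' := mul_le_mul_of_nonneg_left hA₂le
            (by positivity : 0 ≤ G * (1 - θ) ^ (α - (n : ℝ)))
          have hexp := hL₀ L hL1 A N
            |rieszPotential α (fun y => N⁻¹ * shellFun α x W w y) z| hAlow hN0 hN2' (by
              rw [hpot, abs_mul, abs_of_nonneg (inv_nonneg.2 hN0.le),
                mul_inv_cancel_left₀ hN0.ne']
              linarith [le_abs_self (rieszPotential α (shellFun α x W w) z)])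
          refine ENNReal.ofReal_le_ofReal (le_trans ?_ (ht₀ _ (hL4.trans hexp)))
          have := Real.exp_le_exp.2 hexp
          linarith
      _ ≤ ENNReal.ofReal B * (1 + eLpNorm
            (rieszPotential α (fun y => N⁻¹ * shellFun α x W w y))
            (ENNReal.ofReal (n / α)) (volume.restrict Ω) ^ ((n : ℝ) / α)) :=
          (setLIntegral_le_lintegral _ _).trans h1
      _ ≤ ENNReal.ofReal |B| * (1 + ENNReal.ofReal T) := by
          gcongr
          · exact le_abs_self B
          · exact (ENNReal.rpow_le_rpow (eLpNorm_mono_measure _ Measure.restrict_le_self)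
              hp.le).trans h2
      _ = _ := by
          rw [ENNReal.ofReal_mul (abs_nonneg _), ENNReal.ofReal_add zero_le_one hT0,
            ENNReal.ofReal_one]
  rw [← ENNReal.ofReal_mul (by positivity), Real.mul_rpow hθ0.le hε0.le, hεn,
    ENNReal.ofReal_le_ofReal_iff (by positivity)] at hlow
  linarith

end RegSharp

theorem theorem9 {n : ℕ} (Ω : Set (EuclideanSpace ℝ (Fin n)))
    (hΩ : NullMeasurableSet Ω volume) (α : ℝ) (hα0 : 0 < α) (hαn : α < n) :
    (IsRieszSubcritical Ω →
      -- the potential is well defined almost everywhere on `Ω`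
      (∀ f : EuclideanSpace ℝ (Fin n) → ℝ, MemLpOn Ω (n / α) f →
        ∀ᵐ x ∂(volume.restrict Ω), Integrable (fun y => ‖x - y‖ ^ (α - (n : ℝ)) * f y)) ∧
      -- the Adams inequality and its regularized form
      (∃ C : ℝ, 0 < C ∧
        (∀ E : Set (EuclideanSpace ℝ (Fin n)), E ⊆ Ω → NullMeasurableSet E volume →
          volume E < ∞ → AdamsBound Ω α (1 / unitBallVolume n) E C) ∧
        RegAdamsBound Ω α (1 / unitBallVolume n) C) ∧
      -- sharpness of the exponential constant
      ((∃ x₀ ∈ Ω, ∃ r₀ : ℝ, 0 < r₀ ∧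
          volume (Ω ∩ Metric.ball x₀ r₀) = volume (Metric.ball x₀ r₀)) →
        (∀ E : Set (EuclideanSpace ℝ (Fin n)), E ⊆ Ω → NullMeasurableSet E volume →
          0 < volume E → volume E < ∞ →
          ∀ γ : ℝ, 1 / unitBallVolume n < γ → ¬ ∃ C : ℝ, AdamsBound Ω α γ E C) ∧
        (∀ γ : ℝ, 1 / unitBallVolume n < γ → ¬ ∃ C : ℝ, RegAdamsBound Ω α γ C))) ∧
    (¬ IsRieszSubcritical Ω →
      (¬ ∃ C : ℝ, ∀ E : Set (EuclideanSpace ℝ (Fin n)), E ⊆ Ω → NullMeasurableSet E volume →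
          volume E < ∞ → AdamsBound Ω α (1 / unitBallVolume n) E C) ∧
      ∃ (Ψ : ℕ → EuclideanSpace ℝ (Fin n) → ℝ) (x : ℕ → EuclideanSpace ℝ (Fin n))
        (r : ℕ → ℝ) (δ : ℝ), 0 < δ ∧
        (∀ m, MemLpOn Ω (n / α) (Ψ m) ∧
          eLpNorm (Ψ m) (ENNReal.ofReal (n / α)) volume = 1 ∧
          x m ∈ Ω ∧ 0 < r m ∧
          volume (Metric.ball (x m) (r m) ∩ Ω) = ENNReal.ofReal δ) ∧
        Tendsto (fun m => ⨅ z ∈ Metric.ball (x m) (r m) ∩ Ω, ‖rieszPotential α (Ψ m) z‖ₑ)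
          atTop (𝓝 ∞)) := by
  refine ⟨fun h => ⟨fun f hf => ae_integrable_of_subcritical hα0 hαn hΩ h hf, ?_, ?_⟩,
    fun h => ⟨not_adamsBound_of_not_subcritical hα0 hαn hΩ h,
      exists_blowup_sequence hα0 hαn hΩ h⟩⟩
  · obtain ⟨C, hC, hadams⟩ := exists_adamsBound_of_subcritical hα0 hαn hΩ h
    obtain ⟨C', hCC', hreg⟩ := exists_regAdamsBound hα0 hαn hΩ hC hadams
    refine ⟨C', hC.trans_le hCC', fun E hE hEn hEv f hf hf1 => ?_, hreg⟩
    exact (hadams E hE hEn hEv f hf hf1).trans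
      (mul_le_mul_left (ENNReal.ofReal_le_ofReal hCC') _)
  · rintro ⟨x₀, -, r₀, hr₀, hx₀⟩
    exact ⟨fun E hE hEn hE0 hEv γ hγ => not_adamsBound_of_lt hα0 hαn hΩ hE hEn hE0 hEv hγ,
      fun γ hγ => not_regAdamsBound_of_lt hα0 hαn hΩ hr₀ hx₀ hγ⟩
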